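/- **Setting.** Let $G=(V,E)$ be a finite connected graph whose nodes carry distinct identifiers $0,\dots,n-1$, with maximum degree $\Delta$ and degrees $\delta(v)$. Each node of a set $S\subseteq V$ of $k$ sources has one rumor, and all rumors have to reach all nodes. A message transmitted by a node carries a batch of at most $c$ rumors known to this node, where $1\le c\le k$. Let $m_{opt}$ be the least number of messages of any schedule when interference is ignored (every transmission reaches all neighbors of the sender). Let $s_{opt}$ be the least number of time slots of any schedule under the protocol interference model (a node receives the message of a neighbor iff no other neighbor of it transmits in the same slot). A connected dominating set (CDS) $D_0$ is $\alpha$-approximate if $|D_0|$ is at most $\alpha$ times the minimum size of a CDS of $G$. **Transmission routine without collision detection, with parameter $\mu>0$.** Let $m=\mu\Delta$ be an integer. A round consists of $m$ slots for messages followed by $m$ slots for acknowledgments. In each round each node $v$ draws independent uniform slots $x_v,y_v\in\{1,\dots,m\}$. A node $v$ with a pending message transmits it in slot $x_v$, with the list of those intended receivers whose acknowledgment it has not received. A listed receiver $u$ that receives the message answers with an acknowledgment, in slot $m+x_v$ if the message is addressed to a single receiver (the parent, see below), and in slot $m+y_u$ if it is addressed to all children. In every slot a node receives a transmission iff it is silent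 itself and exactly one of its neighbors transmits; otherwise it hears nothing. The message is retransmitted in the following rounds until all its receivers have been heard to acknowledge it. **Implementation of the gossiping algorithm (Algorithm 2).** A backbone consists of a CDS $D$, the node $r$ with the lowest identifier as root, and a spanning tree of $G$ rooted at $r$ whose inner nodes lie in $D\cup\{r\}$. First all rumors are sent to $r$, each node transmitting batches of collected rumors to its parent. Once $r$ has all rumors, it sends them in batches to its children, and every inner node forwards the batches of its parent to its own children, each node transmitting at most $\lceil k/c\rceil$ batches to its children. All messages are sent by the routine above, and may carry one additional control bit. A distributed rule determines the next message of an idle node from what this node knows: its identifier, its neighbors, $n$, $\Delta$, the diameter, $k$, $c$, $m$, whether it is a source, whether it is in $D$, its parent and children, and the messages that it has received and sent so far. The construction of the backbone is not part of the costs. **Theorem.** There is a distributed rule such that for each $\mu_0>0$ there is a constant $C>0$ with the following property. For every connected graph $G$ and every CDS $D_0$ of $G$ there is a backbone with CDS $D\supseteq D_0$ such that for all $S$, all $1\le c\le k=|S|$, all $\alpha$ for which $D_0$ is $\alpha$-approximate, and all $\mu\ge\mu_0$ for which $\mu\Delta\ge 2$ is an integer, the execution satisfies, with $j'=\dfrac{\log(1/\Delta)}{\log(1-e^{-2/\mu})}$: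 1. the expected total number of transmitted messages, acknowledgments and retransmissions included, is at most $$C\,\alpha\, m_{opt}\Bigl(e^{2/\mu}\max_{v\in D}\delta(v)+j'\Bigr);$$ 2. if $j'\ge 1$, the expected number of slots until all nodes know all rumors is at most $$C\, s_{opt}\,\mu\,\Delta\, j'.$$ -/

import Mathlib

open MeasureTheory

noncomputable section

namespace MultiBroadcast

/-! ### Backbones, schedules and optimal costs -/

/-- `D` is a connected dominating set of `G` (connectedness includes non-emptiness). -/
def IsCDS {V : Type*} (G : SimpleGraph V) (D : Finset V) : Prop :=
  (G.induce (D : Set V)).Connected ∧ ∀ v, v ∉ D → ∃ u ∈ D, G.Adj u v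

/-- The size of a minimum connected dominating set. -/
def mcds {V : Type*} (G : SimpleGraph V) : ℕ :=
  sInf {d | ∃ D : Finset V, IsCDS G D ∧ D.card = d}

/-- Initial knowledge of each node. The rumor of a source is named by the source itself. -/
def initialKnowledge {V : Type*} [DecidableEq V] (S : Finset V) (v : V) : Finset V :=
  if v ∈ S then {v} else ∅

open Classical in
/-- `K` is the current knowledge of the nodes. The list of transmissions (sender, batch) can be
carried out from there, without interference, and afterwards every node knows all rumors of `S`.
A batch consists of at most `c` rumors known to the sender, and reaches all its neighbors. -/
def SolvesWithoutInterference {V : Type*} (G : SimpleGraph V) (S : Finset V) (c : ℕ) :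
    (V → Finset V) → List (V × Finset V) → Prop
  | K, [] => ∀ v, S ⊆ K v
  | K, (v, b) :: l => b ⊆ K v ∧ b.card ≤ c ∧
      SolvesWithoutInterference G S c (fun u => if G.Adj v u then K u ∪ b else K u) l

open Classical in
/-- The least number of messages with which all rumors can be brought to all nodes. -/
def mOpt {V : Type*} (G : SimpleGraph V) (S : Finset V) (c : ℕ) : ℕ :=
  sInf {t | ∃ l : List (V × Finset V),
    SolvesWithoutInterference G S c (initialKnowledge S) l ∧ l.length = t}

/-- With `T` the set of nodes that transmit in a slot, `v` is the only neighbor of `u` that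
transmits in this slot. -/
def OnlyTransmitter {V : Type*} (G : SimpleGraph V) (T : V → Prop) (u v : V) : Prop :=
  G.Adj u v ∧ T v ∧ ∀ w, G.Adj u w → T w → w = v

open Classical in
/-- The knowledge after one slot in which node `v` transmits the batch `a v` (or is silent, if
`a v = none`), under the protocol interference model. -/
def afterSlot {V : Type*} [Fintype V] (G : SimpleGraph V) (K : V → Finset V)
    (a : V → Option (Finset V)) (u : V) : Finset V :=
  K u ∪ Finset.univ.biUnion fun v =>
    if OnlyTransmitter G (fun w => (a w).isSome) u v then (a v).getD ∅ else ∅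

/-- `K` is the current knowledge of the nodes. The list of slots can be carried out from there,
with interference, and afterwards every node knows all rumors of `S`. -/
def SolvesWithInterference {V : Type*} [Fintype V] (G : SimpleGraph V) (S : Finset V) (c : ℕ) :
    (V → Finset V) → List (V → Option (Finset V)) → Prop
  | K, [] => ∀ v, S ⊆ K v
  | K, a :: l => (∀ v b, a v = some b → b ⊆ K v ∧ b.card ≤ c) ∧
      SolvesWithInterference G S c (afterSlot G K a) l

open Classical in
/-- The least number of slots in which all rumors can be brought to all nodes. -/
def sOpt {V : Type*} [Fintype V] (G : SimpleGraph V) (S : Finset V) (c : ℕ) : ℕ :=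
  sInf {t | ∃ l : List (V → Option (Finset V)),
    SolvesWithInterference G S c (initialKnowledge S) l ∧ l.length = t}

/-! ### The backbone and the local information of the nodes -/

/-- A connected dominating set `D`, the node with the lowest identifier as root, and an
arborescence that spans the graph, towards the root, whose inner nodes lie in `D ∪ {root}`. -/
structure Backbone {n : ℕ} (G : SimpleGraph (Fin n)) where
  D : Finset (Fin n)
  isCDS : IsCDS G D
  root : Fin n
  root_le : ∀ v, root ≤ v
  parent : Fin n → Fin n
  parent_root : parent root = root
  adj_parent : ∀ v, v ≠ root → G.Adj v (parent v)
  parent_mem : ∀ v, v ≠ root → parent v = root ∨ parent v ∈ D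
  reaches_root : ∀ v, ∃ i : ℕ, parent^[i] v = root

/-- The children of `v` in the arborescence. -/
def Backbone.children {n : ℕ} {G : SimpleGraph (Fin n)} (B : Backbone G) (v : Fin n) :
    Finset (Fin n) :=
  Finset.univ.filter fun u => u ≠ B.root ∧ B.parent u = v

/-- A network with its backbone, the set `S` of sources, the compression parameter `c`,
and the number `m` of slots of one phase of the transmission routine. -/
structure Network (n : ℕ) where
  G : SimpleGraph (Fin n)
  B : Backbone G
  S : Finset (Fin n)
  c : ℕ
  m : ℕ

/-- All that a node knows about the network when the rumors start to spread. -/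
structure LocalView (n : ℕ) where
  self : Fin n
  neighbors : Finset (Fin n)
  maxDegree : ℕ
  diam : ℕ
  numRumors : ℕ
  c : ℕ
  m : ℕ
  isSource : Prop
  inBackbone : Prop
  parent : Option (Fin n)
  children : Finset (Fin n)

open Classical in
def Network.localView {n : ℕ} (N : Network n) (v : Fin n) : LocalView n where
  self := v
  neighbors := N.G.neighborFinset v
  maxDegree := N.G.maxDegree
  diam := N.G.diam
  numRumors := N.S.card
  c := N.c
  m := N.m
  isSource := v ∈ N.S
  inBackbone := v ∈ N.B.D
  parent := if v = N.B.root then none else some (N.B.parent v)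
  children := N.B.children v

/-! ### Messages, node states and the local rule -/

/-- A message: its direction (`up`: towards the root, to the parent; otherwise away from the
root, to all children), a batch of rumors, and one control bit. -/
structure Msg (n : ℕ) where
  up : Bool
  batch : Finset (Fin n)
  flag : Bool

/-- The local state of a node: the message that it is transmitting, if any, with the list of the
receivers from which no acknowledgment has arrived; for each past round, and each sender, the
message received from this sender; and the messages whose transmission the node has begun. -/
structure NodeState (n : ℕ) where
  job : Option (Msg n × Finset (Fin n))
  inbox : List (Fin n → Option (Msg n))
  outbox : List (Msg n)

/-- A distributed rule: it tells an idle node which message to transmit next, if any, from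
nothing but the local view and the local state of this node. -/
abbrev Rule (n : ℕ) : Type := LocalView n → NodeState n → Option (Msg n)

/-- `g` has been received by a node in state `s`. -/
def NodeState.Received {n : ℕ} (s : NodeState n) (g : Msg n) : Prop :=
  ∃ r ∈ s.inbox, ∃ u, r u = some g

open Classical in
/-- The rumors collected at `v`: its own one, and those from messages on their way up. -/
def Network.collected {n : ℕ} (N : Network n) (v : Fin n) (s : NodeState n) : Finset (Fin n) :=
  Finset.univ.filter fun a =>
    (a = v ∧ v ∈ N.S) ∨ ∃ g, s.Received g ∧ g.up = true ∧ a ∈ g.batch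

open Classical in
/-- All rumors known to `v`. -/
def Network.known {n : ℕ} (N : Network n) (v : Fin n) (s : NodeState n) : Finset (Fin n) :=
  Finset.univ.filter fun a => (a = v ∧ v ∈ N.S) ∨ ∃ g, s.Received g ∧ a ∈ g.batch

/-- The intended receivers of a message of `v`. -/
def Network.receivers {n : ℕ} (N : Network n) (v : Fin n) (g : Msg n) : Finset (Fin n) :=
  if g.up then (if v = N.B.root then ∅ else {N.B.parent v}) else N.B.children v

/-- The messages that the two stages of the gossiping algorithm admit. A message has a receiver
and carries at most `c` rumors. First all rumors travel to the root: a message on its way up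
carries rumors collected at its sender. Then they travel from the root to all nodes: the root
starts this once it has collected all rumors, every other node forwards batches just as they
came from its parent, and each node transmits at most `⌈k / c⌉` of them. -/
def Network.Admissible {n : ℕ} (N : Network n) (v : Fin n) (s : NodeState n) (g : Msg n) : Prop :=
  (N.receivers v g).Nonempty ∧ g.batch.card ≤ N.c ∧
    if g.up then g.batch ⊆ N.collected v s
    else
      (s.outbox.filter fun g' => !g'.up).length < N.S.card ⌈/⌉ N.c ∧
      if v = N.B.root then N.S ⊆ N.collected v s ∧ g.batch ⊆ N.S
      else ∃ g', s.Received g' ∧ g'.up = false ∧ g'.batch = g.batch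

open Classical in
/-- An idle node begins to transmit the message given by the rule, if this is admissible. -/
def Network.load {n : ℕ} (N : Network n) (P : Rule n) (v : Fin n) (s : NodeState n) :
    NodeState n :=
  match s.job with
  | some _ => s
  | none =>
    match P (N.localView v) s with
    | none => s
    | some g =>
      if N.Admissible v s g then
        { s with job := some (g, N.receivers v g), outbox := s.outbox ++ [g] }
      else s

/-! ### The transmission routine without collision detection

One round consists of `m` slots for messages and then `m` slots for acknowledgments. Every node
draws two independent uniform slots `x v = (ω v).1` and `y v = (ω v).2`. A node with a job
transmits the message, with the list of the receivers that have not acknowledged, in slot `x v`.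
A listed receiver `u` that hears it sends an acknowledgment: in slot `x v` of the second half for
a message to a single receiver (towards the root), and in slot `y u` of the second half for a
message to a list of receivers (away from the root). What is lost in a collision leaves no
trace. The job is repeated until all receivers on the list have been heard to acknowledge. -/

section Round

variable {n m : ℕ} (G : SimpleGraph (Fin n)) (s : Fin n → NodeState n)
  (ω : Fin n → Fin m × Fin m)

/-- `u` hears the transmission of `v` in a slot with transmitters `T`: `u` is silent and `v` is
its only neighbor that transmits. -/
def Hears (T : Fin n → Prop) (u v : Fin n) : Prop := ¬ T u ∧ OnlyTransmitter G T u v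

/-- `v` transmits in slot `x` of the first half of the round. -/
def SendsIn (x : Fin m) (v : Fin n) : Prop := (s v).job.isSome ∧ (ω v).1 = x

/-- `u` receives the message of `v`, which lists `u`. -/
def GotMessage (u v : Fin n) : Prop :=
  (∃ j, (s v).job = some j ∧ u ∈ j.2) ∧ Hears G (SendsIn s ω (ω v).1) u v

/-- The slot of the second half in which `u` acknowledges the message of `v`. -/
def ackSlot (u v : Fin n) : Fin m :=
  if ((s v).job.map fun j => j.1.up) = some true then (ω v).1 else (ω u).2

/-- `u` transmits in slot `y` of the second half of the round. -/
def AcksIn (y : Fin m) (u : Fin n) : Prop := ∃ v, GotMessage G s ω u v ∧ ackSlot s ω u v = y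

/-- `v` receives the acknowledgment of `u` for its message. -/
def GotAck (v u : Fin n) : Prop :=
  GotMessage G s ω u v ∧ Hears G (AcksIn G s ω (ackSlot s ω u v)) v u

open Classical in
/-- The list of `v` after the round, given its list before. -/
def remaining (v : Fin n) (R : Finset (Fin n)) : Finset (Fin n) :=
  R.filter fun u => ¬ GotAck G s ω v u

open Classical in
/-- The state of `v` after the round. -/
def afterRound (v : Fin n) : NodeState n where
  job := (s v).job.bind fun j =>
    if remaining G s ω v j.2 = ∅ then none else some (j.1, remaining G s ω v j.2)
  inbox := (s v).inbox ++
    [fun u => if GotMessage G s ω v u then (s u).job.map Prod.fst else none]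
  outbox := (s v).outbox

open Classical in
/-- The number of transmissions in the round, acknowledgments included. -/
def roundMessages : ℕ :=
  (Finset.univ.filter fun v => (s v).job.isSome).card +
  (Finset.univ.filter fun p : Fin n × Fin m => AcksIn G s ω p.2 p.1).card

end Round

/-! ### Executions and their expected costs -/

/-- The slots drawn in all rounds. -/
abbrev Draws (n m : ℕ) : Type := ℕ → Fin n → Fin m × Fin m

/-- All slots are independent and uniform. -/
def drawMeasure (n m : ℕ) [NeZero m] : Measure (Draws n m) :=
  Measure.infinitePi fun _ : ℕ => (PMF.uniformOfFintype (Fin n → Fin m × Fin m)).toMeasure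

/-- The states of all nodes after `t` rounds. -/
def Network.state {n : ℕ} (N : Network n) (P : Rule n) (ω : Draws n N.m) :
    ℕ → Fin n → NodeState n
  | 0 => fun _ => { job := none, inbox := [], outbox := [] }
  | t + 1 => afterRound N.G (fun v => N.load P v (N.state P ω t v)) (ω t)

/-- The number of all messages transmitted in the course of the execution. -/
def Network.messages {n : ℕ} (N : Network n) (P : Rule n) (ω : Draws n N.m) : ENNReal :=
  ∑' t : ℕ, (roundMessages N.G (fun v => N.load P v (N.state P ω t v)) (ω t) : ENNReal)

/-- The number of slots until all nodes know all rumors (`⊤` if this never happens). -/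
def Network.time {n : ℕ} (N : Network n) (P : Rule n) (ω : Draws n N.m) : ENNReal :=
  ⨅ t : ℕ, ⨅ _ : ∀ v, N.S ⊆ N.known v (N.state P ω t v), ((2 * N.m * t : ℕ) : ENNReal)

def Network.expectedMessages {n : ℕ} (N : Network n) [NeZero N.m] (P : Rule n) : ENNReal :=
  ∫⁻ ω, N.messages P ω ∂(drawMeasure n N.m)

def Network.expectedTime {n : ℕ} (N : Network n) [NeZero N.m] (P : Rule n) : ENNReal :=
  ∫⁻ ω, N.time P ω ∂(drawMeasure n N.m)

/-- The number of rounds `log (1 / Δ) / log (1 - e ^ (-2 / μ))` of the transmission routine. -/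
def rounds (Δ : ℕ) (μ : ℝ) : ℝ := Real.log (1 / Δ) / Real.log (1 - Real.exp (-2 / μ))

end MultiBroadcast

end

/-! Lower bounds. The nodes that ever transmit a fixed rumor form a CDS, and a message carries at
most `c` rumors, so `k * mcds ≤ c * m_opt` (`card_mul_mcds_le_mOpt`). Under interference a node
hears at most one batch per slot and a rumor crosses at most one edge per slot; hence `K = ⌈k/c⌉`
and the diameter are both at most `2 * s_opt`.

Backbone. A tree built inside `D₀` alone may be much deeper than the diameter. Adding shortest paths
to the root from one sparse residue class of levels at most triples `D₀` and yields height at most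
`2 * diam + 1` (`exists_shallow_backbone`).

One round. Let `p = exp (-4 / μ)`. A listed receiver is heard to acknowledge with probability at
least `p` if the message goes to a parent, or if no message to a parent is pending anywhere
(`le_avg_gotAck`). This is why the root waits until `startTime`, when the upward traffic has very
probably ended. The control bit tells a parent that a child has nothing more to send, so a node
knows when it may send an incomplete batch.

Messages. The transmissions of a round are at most twice the pending pairs (sender, receiver), and
on average a fraction `p` of these pairs is settled per round. At most `n + K * |D| + K * n` pairs
ever arise. The only error comes from downward messages that overlap with upward ones, and
`startTime` keeps its total below 1. With `n ≤ |D| * (1 + max degree on D)` and `|D| ≤ 3 * |D₀|`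
this gives the first claim; since `p ≥ exp (-4 / μ₀)`, the factor `1 / p` is a constant.

Slots. A node with outstanding messages has a weight, a power of a small `ρ` whose exponent counts
acknowledged messages, corrected by the height in the tree. The weight of a transmission in progress
shrinks on average by `1 - p + ρ`. A stalled transmission waits for a child, a sibling or the
parent, and the height correction makes its weight at most `ρ` times the weights there
(`upWeight_idle_le`, `downWeight_idle_le`). So the whole potential contracts by `1 - p + (3 + 2 * Δ)
* ρ`, which is `1 - p ^ 2` for the chosen `discount`. The potential has to fall by a factor with
logarithm `O((K + diam) * log Δ)`, because `n ≤ (1 + Δ) ^ diam` and, by `j' ≥ 1`, `log (1 / ρ) =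
O(log Δ)`. The decay rate `-log (1 - p ^ 2)` is at least a constant times `-log (1 - exp (-2 / μ))`.
The quotient is `O((K + diam) * j')` rounds of `2 * μ * Δ` slots each. -/

noncomputable section

namespace MultiBroadcast

/-! ### Lower bounds for the optimal costs -/

section Optimum

variable {V : Type*} {G : SimpleGraph V}

/-- The nodes that transmit rumor `a` in the list of transmissions `l`. -/
def transmitters (l : List (V × Finset V)) (a : V) : Set V :=
  {v | ∃ b, (v, b) ∈ l ∧ a ∈ b}

theorem SolvesWithoutInterference.card_le {S : Finset V} {c : ℕ} {l : List (V × Finset V)} :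
    ∀ {K : V → Finset V}, SolvesWithoutInterference G S c K l → ∀ e ∈ l, e.2.card ≤ c := by
  induction l with
  | nil => simp
  | cons e l ih =>
    obtain ⟨v, b⟩ := e
    rintro K ⟨_, h2, h3⟩ e he
    rcases List.mem_cons.1 he with rfl | he
    · exact h2
    · exact ih h3 e he

theorem SolvesWithoutInterference.dominates {S : Finset V} {c : ℕ} {l : List (V × Finset V)}
    {a : V} (ha : a ∈ S) :
    ∀ {K : V → Finset V}, SolvesWithoutInterference G S c K l →
      ∀ v, a ∈ K v ∨ ∃ u ∈ transmitters l a, G.Adj u v := by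
  classical
  induction l with
  | nil => intro K h v; exact Or.inl (h v ha)
  | cons e l ih =>
    obtain ⟨w, b⟩ := e
    rintro K ⟨_, _, h3⟩ v
    rcases ih h3 v with h | ⟨u, ⟨b', hb', hab⟩, huv⟩
    · by_cases hwv : G.Adj w v
      · rw [if_pos hwv, Finset.mem_union] at h
        rcases h with h | h
        · exact Or.inl h
        · exact Or.inr ⟨w, ⟨b, by simp, h⟩, hwv⟩
      · rw [if_neg hwv] at h
        exact Or.inl h
    · exact Or.inr ⟨u, ⟨b', List.mem_cons_of_mem _ hb', hab⟩, huv⟩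

/-- Whoever transmits `a` either held it at the start or learned it from an earlier transmitter next
to it. Tracing this back leads, through transmitters only, to an initial holder. -/
theorem SolvesWithoutInterference.linked {S : Finset V} {c : ℕ} {l : List (V × Finset V)}
    (a : V) :
    ∀ {K : V → Finset V}, SolvesWithoutInterference G S c K l →
      ∀ v ∈ transmitters l a, ∃ w ∈ transmitters l a, a ∈ K w ∧
        Relation.ReflTransGen
          (fun x y => G.Adj x y ∧ x ∈ transmitters l a ∧ y ∈ transmitters l a) v w := by
  classical
  induction l with
  | nil => rintro K _ v ⟨b, hb, _⟩; simp at hb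
  | cons e l ih =>
    obtain ⟨w, b⟩ := e
    rintro K ⟨h1, _, h3⟩ v hv
    have mono : ∀ x ∈ transmitters l a, x ∈ transmitters ((w, b) :: l) a := by
      rintro x ⟨b', hb', hx⟩
      exact ⟨b', List.mem_cons_of_mem _ hb', hx⟩
    by_cases hvl : v ∈ transmitters l a
    · obtain ⟨x, hx, hax, hr⟩ := ih h3 v hvl
      have hr' : Relation.ReflTransGen (fun x y => G.Adj x y ∧
          x ∈ transmitters ((w, b) :: l) a ∧ y ∈ transmitters ((w, b) :: l) a) v x :=
        Relation.ReflTransGen.mono (fun _ _ h => ⟨h.1, mono _ h.2.1, mono _ h.2.2⟩) _ _ hr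
      by_cases hax' : a ∈ K x
      · exact ⟨x, mono x hx, hax', hr'⟩
      -- The end `x` of the chain for the tail did not know `a` before the first transmission, so it
      -- learned `a` from `w`, which therefore extends the chain.
      · by_cases hwx : G.Adj w x
        · have hab : a ∈ b := by
            simp only [if_pos hwx, Finset.mem_union] at hax
            exact hax.resolve_left hax'
          have hw : w ∈ transmitters ((w, b) :: l) a := ⟨b, by simp, hab⟩
          exact ⟨w, hw, h1 hab, hr'.tail ⟨hwx.symm, mono x hx, hw⟩⟩
        · simp only [if_neg hwx] at hax
          exact absurd hax hax'
    · obtain ⟨b', hb', hab⟩ := hv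
      rcases List.mem_cons.1 hb' with h | h
      · obtain ⟨rfl, rfl⟩ := Prod.mk.inj h
        exact ⟨v, ⟨b', by simp, hab⟩, h1 hab, .refl⟩
      · exact absurd ⟨b', h, hab⟩ hvl

theorem mem_initialKnowledge [DecidableEq V] {S : Finset V} {a v : V} :
    a ∈ initialKnowledge S v ↔ a = v ∧ v ∈ S := by
  unfold initialKnowledge
  split_ifs with h <;> simp [h]

theorem connected_induce_of_reach {T : Set V} {a : V} (ha : a ∈ T)
    (h : ∀ v ∈ T, Relation.ReflTransGen (fun x y => G.Adj x y ∧ x ∈ T ∧ y ∈ T) v a) :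
    (G.induce T).Connected := by
  have key : ∀ v (hv : v ∈ T), (G.induce T).Reachable ⟨v, hv⟩ ⟨a, ha⟩ := by
    intro v hv
    have := h v hv
    induction this using Relation.ReflTransGen.head_induction_on with
    | refl => exact SimpleGraph.Reachable.refl _
    | head hxy _ ih =>
      obtain ⟨h1, h2, h3⟩ := hxy
      refine SimpleGraph.Reachable.trans (SimpleGraph.Adj.reachable ?_) (ih h3)
      exact h1
  have : Nonempty T := ⟨⟨a, ha⟩⟩
  exact SimpleGraph.Connected.mk fun x y => (key x.1 x.2).trans (key y.1 y.2).symm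

/-- The transmitters of `a` dominate because everyone has to hear `a`, and they are connected
because all of them are linked to the source. With a second node present, the source itself has to
transmit. -/
theorem SolvesWithoutInterference.isCDS [Nontrivial V] [DecidableEq V] {S : Finset V} {c : ℕ}
    {l : List (V × Finset V)} (hl : SolvesWithoutInterference G S c (initialKnowledge S) l)
    {a : V} (ha : a ∈ S) (T : Finset V) (hT : (T : Set V) = transmitters l a) : IsCDS G T := by
  have hmem : ∀ v, v ∈ T ↔ v ∈ transmitters l a := fun v => by rw [← hT]; rfl
  have holder : ∀ v, a ∈ initialKnowledge S v → v = a := fun v h =>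
    (mem_initialKnowledge.1 h).1.symm
  have link : ∀ v ∈ transmitters l a, a ∈ transmitters l a ∧ Relation.ReflTransGen
      (fun x y => G.Adj x y ∧ x ∈ transmitters l a ∧ y ∈ transmitters l a) v a := by
    intro v hv
    obtain ⟨w, hw, haw, hr⟩ := hl.linked a v hv
    obtain rfl := holder w haw
    exact ⟨hw, hr⟩
  obtain ⟨v, hva⟩ := exists_ne a
  have haT : a ∈ transmitters l a := by
    rcases hl.dominates ha v with h | ⟨u, hu, _⟩
    · exact absurd (holder v h) hva
    · exact (link u hu).1
  refine ⟨?_, ?_⟩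
  · rw [hT]
    exact connected_induce_of_reach haT fun v hv => (link v hv).2
  · intro v hv
    rcases hl.dominates ha v with h | ⟨u, hu, huv⟩
    · rw [holder v h] at hv
      exact absurd ((hmem a).2 haT) hv
    · exact ⟨u, (hmem u).2 hu, huv⟩

theorem mcds_le {D : Finset V} (h : IsCDS G D) : mcds G ≤ D.card :=
  Nat.sInf_le ⟨D, h, rfl⟩

/-- Double counting of pairs (rumor, message that carries it): at least `mcds G` for each rumor, at
most `c` for each message. -/
theorem SolvesWithoutInterference.card_mul_mcds_le [Nontrivial V] [DecidableEq V]
    {S : Finset V} {c : ℕ} {l : List (V × Finset V)}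
    (hl : SolvesWithoutInterference G S c (initialKnowledge S) l) :
    S.card * mcds G ≤ c * l.length := by
  have h1 : ∀ a ∈ S, mcds G ≤ (l.map fun e => if a ∈ e.2 then 1 else 0).sum := by
    intro a ha
    let T : Finset V := ((l.filter fun e => a ∈ e.2).map Prod.fst).toFinset
    have hT : (T : Set V) = transmitters l a := by
      ext v
      simp [T, transmitters]
    refine (mcds_le (hl.isCDS ha T hT)).trans ((List.toFinset_card_le _).trans ?_)
    rw [List.length_map]
    clear hT
    induction l with
    | nil => simp
    | cons e l ih =>
      obtain ⟨w, b⟩ := e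
      have : ∀ l : List (V × Finset V), (l.filter fun e => a ∈ e.2).length ≤
          (l.map fun e => if a ∈ e.2 then 1 else 0).sum := by
        intro l
        induction l with
        | nil => simp
        | cons e l ih => by_cases h : a ∈ e.2 <;> simp [h] <;> omega
      exact this _
  have h2 : ∀ l : List (V × Finset V), (∀ e ∈ l, e.2.card ≤ c) →
      ∑ a ∈ S, (l.map fun e => if a ∈ e.2 then 1 else 0).sum ≤ c * l.length := by
    intro l
    induction l with
    | nil => simp
    | cons e l ih =>
      intro h
      simp only [List.map_cons, List.sum_cons, Finset.sum_add_distrib, List.length_cons]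
      have h3 := ih fun e he => h e (List.mem_cons_of_mem _ he)
      have h4 : ∑ a ∈ S, (if a ∈ e.2 then 1 else 0) ≤ c := by
        rw [← Finset.sum_filter, Finset.sum_const, smul_eq_mul, mul_one]
        refine (Finset.card_le_card fun x hx => ?_).trans (h e (by simp))
        exact (Finset.mem_filter.1 hx).2
      rw [mul_add, mul_one]
      omega
  calc S.card * mcds G = ∑ a ∈ S, mcds G := by simp
    _ ≤ _ := Finset.sum_le_sum h1
    _ ≤ _ := h2 l hl.card_le

/-- Needed because the infimum of an empty set of naturals is 0: without a schedule no lower bound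
for `mOpt` could hold. Singleton batches across an edge at which the knowledge of a rumor ends
reduce the total ignorance. -/
theorem exists_solvesWithoutInterference [Fintype V] (hG : G.Connected) {S : Finset V} {c : ℕ}
    (hc : 1 ≤ c) :
    ∀ K : V → Finset V, (∀ a ∈ S, ∃ v, a ∈ K v) →
      ∃ l, SolvesWithoutInterference G S c K l := by
  classical
  suffices h : ∀ (d : ℕ) (K : V → Finset V), ∑ v, (S \ K v).card ≤ d →
      (∀ a ∈ S, ∃ v, a ∈ K v) → ∃ l, SolvesWithoutInterference G S c K l from
    fun K hK => h _ K le_rfl hK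
  intro d
  induction d with
  | zero =>
    intro K hd _
    refine ⟨[], fun v => ?_⟩
    have : (S \ K v).card = 0 := by
      have := Finset.sum_eq_zero_iff.1 (Nat.le_zero.1 hd) v (Finset.mem_univ v)
      exact this
    exact Finset.sdiff_eq_empty_iff_subset.1 (Finset.card_eq_zero.1 this)
  | succ d ih =>
    intro K hd hK
    by_cases hall : ∀ v, S ⊆ K v
    · exact ⟨[], hall⟩
    · push Not at hall
      obtain ⟨w, hw⟩ := hall
      obtain ⟨a, haS, haw⟩ := Finset.not_subset.1 hw
      obtain ⟨v, hav⟩ := hK a haS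
      obtain ⟨x, y, hxy, hx, hy⟩ : ∃ x y, G.Adj x y ∧ a ∈ K x ∧ a ∉ K y := by
        by_contra hcon
        push Not at hcon
        have : ∀ x y, G.Walk x y → a ∈ K x → a ∈ K y := by
          intro x y p
          induction p with
          | nil => exact id
          | cons h _ ih => exact fun hx => ih (hcon _ _ h hx)
        obtain ⟨p⟩ := hG.preconnected v w
        exact haw (this v w p hav)
      let K' : V → Finset V := fun u => if G.Adj x u then K u ∪ {a} else K u
      have hKK' : ∀ u, K u ⊆ K' u := by
        intro u
        by_cases h : G.Adj x u
        · simp only [K', if_pos h]; exact Finset.subset_union_left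
        · simp only [K', if_neg h]; exact subset_rfl
      obtain ⟨l, hl⟩ := ih K' (by
        have : ∑ v, (S \ K' v).card < ∑ v, (S \ K v).card := by
          apply Finset.sum_lt_sum
          · intro u _
            exact Finset.card_le_card (Finset.sdiff_subset_sdiff subset_rfl (hKK' u))
          · refine ⟨y, Finset.mem_univ y, Finset.card_lt_card ?_⟩
            refine Finset.ssubset_iff_of_subset
              (Finset.sdiff_subset_sdiff subset_rfl (hKK' y)) |>.2 ⟨a, ?_, ?_⟩
            · simp [haS, hy]
            · simp [K', hxy]
        omega) (fun b hb => by
          obtain ⟨u, hu⟩ := hK b hb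
          exact ⟨u, hKK' u hu⟩)
      refine ⟨(x, {a}) :: l, by simpa using hx, by simpa using hc, ?_⟩
      convert hl using 1
      
theorem afterSlot_single [Fintype V] [DecidableEq V] (K : V → Finset V) (v : V) (b : Finset V)
    (a : V → Option (Finset V)) (hv : a v = some b) (ha : ∀ w, w ≠ v → a w = none) (u : V)
    [Decidable (G.Adj v u)] :
    afterSlot G K a u = if G.Adj v u then K u ∪ b else K u := by
  have hT : ∀ w, (a w).isSome ↔ w = v := by
    intro w
    by_cases h : w = v
    · simp [h, hv]
    · simp [h, ha w h]
  ext x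
  simp only [afterSlot, Finset.mem_union, Finset.mem_biUnion, Finset.mem_univ, true_and]
  constructor
  · rintro (h | ⟨w, hw⟩)
    · split_ifs <;> simp [h]
    · split_ifs at hw with h1
      · obtain ⟨h2, h3, _⟩ := h1
        obtain rfl := (hT w).1 h3
        rw [if_pos h2.symm, Finset.mem_union]
        right
        simpa [hv] using hw
      · simp at hw
  · intro h
    split_ifs at h with h1
    · rcases Finset.mem_union.1 h with h | h
      · exact Or.inl h
      · refine Or.inr ⟨v, ?_⟩
        rw [if_pos ⟨h1.symm, (hT v).2 rfl, fun w _ h => (hT w).1 h⟩, hv]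
        exact h
    · exact Or.inl h

/-- One transmission per slot cannot collide, so the infimum that defines `sOpt` is attained as
well. -/
theorem SolvesWithoutInterference.exists_withInterference [Fintype V] {S : Finset V} {c : ℕ}
    {l : List (V × Finset V)} :
    ∀ {K : V → Finset V}, SolvesWithoutInterference G S c K l →
      ∃ l', SolvesWithInterference G S c K l' := by
  classical
  induction l with
  | nil => intro K h; exact ⟨[], h⟩
  | cons e l ih =>
    obtain ⟨v, b⟩ := e
    rintro K ⟨h1, h2, h3⟩
    obtain ⟨l', hl'⟩ := ih h3
    refine ⟨(fun w => if w = v then some b else none) :: l', ?_, ?_⟩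
    · intro w b' hw
      dsimp only at hw
      split_ifs at hw with h
      · subst h
        cases hw
        exact ⟨h1, h2⟩
    · convert hl' using 1
      funext u
      rw [afterSlot_single K v b _ (by simp) (fun w hw => by simp [hw]) u]

theorem initialKnowledge_covers [DecidableEq V] (S : Finset V) :
    ∀ a ∈ S, ∃ v, a ∈ initialKnowledge S v :=
  fun a ha => ⟨a, mem_initialKnowledge.2 ⟨rfl, ha⟩⟩

theorem card_mul_mcds_le_mOpt [Fintype V] [Nontrivial V] (hG : G.Connected)
    (S : Finset V) {c : ℕ} (hc : 1 ≤ c) : S.card * mcds G ≤ c * mOpt G S c := by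
  classical
  obtain ⟨l, hl⟩ := exists_solvesWithoutInterference hG hc _ (initialKnowledge_covers S)
  obtain ⟨l', hl', hlen⟩ := Nat.sInf_mem (s := {t | ∃ l : List (V × Finset V),
    SolvesWithoutInterference G S c (initialKnowledge S) l ∧ l.length = t}) ⟨_, l, hl, rfl⟩
  have := hl'.card_mul_mcds_le
  rw [hlen] at this
  convert this using 2
  unfold mOpt
  congr!

/-! ### Limits on reception and propagation under interference -/

theorem card_afterSlot_le [Fintype V] {c : ℕ} (K : V → Finset V) (a : V → Option (Finset V))
    (ha : ∀ v b, a v = some b → b ⊆ K v ∧ b.card ≤ c) (u : V) :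
    (afterSlot G K a u).card ≤ (K u).card + c := by
  classical
  refine (Finset.card_union_le _ _).trans (Nat.add_le_add_left ?_ _)
  by_cases h : ∃ v, OnlyTransmitter G (fun w => (a w).isSome) u v
  · obtain ⟨v, hv⟩ := h
    have hsub : (Finset.univ.biUnion fun w =>
        if OnlyTransmitter G (fun w => (a w).isSome) u w then (a w).getD ∅ else ∅) ⊆
        (a v).getD ∅ := by
      intro x hx
      obtain ⟨w, _, hw⟩ := Finset.mem_biUnion.1 hx
      split_ifs at hw with h1
      · rwa [hv.2.2 w h1.1 h1.2.1] at hw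
      · simp at hw
    refine (Finset.card_le_card hsub).trans ?_
    cases hav : a v with
    | none => simp
    | some b => simpa using (ha v b hav).2
  · push Not at h
    refine (Finset.card_le_card (t := ∅) fun x hx => ?_).trans (by simp)
    obtain ⟨w, _, hw⟩ := Finset.mem_biUnion.1 hx
    rw [if_neg (h w)] at hw
    exact hw

theorem SolvesWithInterference.card_le [Fintype V] {S : Finset V} {c : ℕ}
    {l : List (V → Option (Finset V))} :
    ∀ {K : V → Finset V}, SolvesWithInterference G S c K l →
      ∀ v, S.card ≤ (K v).card + c * l.length := by
  induction l with
  | nil => intro K h v; simpa using Finset.card_le_card (h v)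
  | cons a l ih =>
    rintro K ⟨h1, h2⟩ v
    have := ih h2 v
    have := card_afterSlot_le (G := G) K a h1 v
    rw [List.length_cons, mul_add, mul_one]
    omega

/-- A rumor crosses at most one edge per slot, so every node lies within the schedule length of an
initial holder. -/
theorem SolvesWithInterference.exists_dist_le [Fintype V] (hG : G.Connected) {S : Finset V}
    {c : ℕ} {l : List (V → Option (Finset V))} {a : V} (ha : a ∈ S) :
    ∀ {K : V → Finset V}, SolvesWithInterference G S c K l →
      ∀ u, ∃ w, a ∈ K w ∧ G.dist u w ≤ l.length := by
  classical
  induction l with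
  | nil => intro K h u; exact ⟨u, h u ha, by simp⟩
  | cons s l ih =>
    rintro K ⟨h1, h2⟩ u
    obtain ⟨w, hw, hd⟩ := ih h2 u
    rcases Finset.mem_union.1 hw with hw | hw
    · exact ⟨w, hw, by rw [List.length_cons]; omega⟩
    · obtain ⟨x, _, hx⟩ := Finset.mem_biUnion.1 hw
      split_ifs at hx with h3
      · refine ⟨x, ?_, ?_⟩
        · cases hs : s x with
          | none => simp [hs] at hx
          | some b =>
            rw [hs] at hx
            exact (h1 x b hs).1 hx
        · have h4 := hG.dist_triangle (u := u) (v := w) (w := x)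
          have h5 : G.dist w x = 1 := SimpleGraph.dist_eq_one_iff_adj.2 h3.1
          rw [List.length_cons]
          omega
      · simp at hx

theorem exists_solves_sOpt [Fintype V] [DecidableEq V] (hG : G.Connected) (S : Finset V) {c : ℕ}
    (hc : 1 ≤ c) : ∃ l, SolvesWithInterference G S c (initialKnowledge S) l ∧
      l.length = sOpt G S c := by
  obtain ⟨l₀, hl₀⟩ := exists_solvesWithoutInterference hG hc _ (initialKnowledge_covers S)
  obtain ⟨l, hl⟩ := hl₀.exists_withInterference
  have := Nat.sInf_mem (s := {t | ∃ l : List (V → Option (Finset V)),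
    SolvesWithInterference G S c (initialKnowledge S) l ∧ l.length = t}) ⟨_, l, hl, rfl⟩
  obtain ⟨l', hl', h⟩ := this
  refine ⟨l', hl', h.trans ?_⟩
  unfold sOpt
  congr!

theorem card_initialKnowledge_le [DecidableEq V] (S : Finset V) (v : V) :
    (initialKnowledge S v).card ≤ 1 := by
  unfold initialKnowledge
  split_ifs <;> simp

theorem one_le_sOpt [Fintype V] [Nontrivial V] (hG : G.Connected) {S : Finset V}
    {c : ℕ} (hc : 1 ≤ c) (hS : c ≤ S.card) : 1 ≤ sOpt G S c := by
  classical
  obtain ⟨l, hl, hlen⟩ := exists_solves_sOpt hG S hc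
  by_contra h
  have h0 : l = [] := List.length_eq_zero_iff.1 (by omega)
  subst h0
  obtain ⟨a, ha⟩ := Finset.card_pos.1 (show 0 < S.card by omega)
  obtain ⟨v, hv⟩ := exists_ne a
  exact hv (mem_initialKnowledge.1 (hl v ha)).1.symm

theorem ceilDiv_le_two_mul_sOpt [Fintype V] [Nontrivial V] (hG : G.Connected)
    {S : Finset V} {c : ℕ} (hc : 1 ≤ c) (hS : c ≤ S.card) :
    S.card ⌈/⌉ c ≤ 2 * sOpt G S c := by
  classical
  obtain ⟨l, hl, hlen⟩ := exists_solves_sOpt hG S hc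
  have h1 := one_le_sOpt hG hc hS
  obtain ⟨v⟩ := hG.nonempty
  have h2 := hl.card_le v
  have h3 := card_initialKnowledge_le S v
  rw [hlen] at h2
  rw [ceilDiv_le_iff_le_mul (by omega)]
  -- `k ≤ 1 + c * s` because a node owns at most one rumor, and `1 ≤ c * s`.
  nlinarith

theorem diam_le_two_mul_sOpt [Fintype V] (hG : G.Connected)
    {S : Finset V} {c : ℕ} (hc : 1 ≤ c) (hS : c ≤ S.card) : G.diam ≤ 2 * sOpt G S c := by
  classical
  obtain ⟨l, hl, hlen⟩ := exists_solves_sOpt hG S hc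
  obtain ⟨a, ha⟩ := Finset.card_pos.1 (show 0 < S.card by omega)
  have hd : ∀ u, G.dist u a ≤ sOpt G S c := by
    intro u
    obtain ⟨w, hw, hd⟩ := hl.exists_dist_le hG ha u
    rw [(mem_initialKnowledge.1 hw).1, ← hlen]
    exact hd
  have := hG.nonempty
  obtain ⟨u, v, huv⟩ := G.exists_dist_eq_diam
  have h1 := hG.dist_triangle (u := u) (v := a) (w := v)
  have h2 := hd u
  have h3 := hd v
  rw [SimpleGraph.dist_comm] at h3
  omega

end Optimum

/-! ### Shallow backbones -/

theorem exists_adj_dist_succ {V : Type*} {G : SimpleGraph V} (hG : G.Connected) {v r : V}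
    (h : v ≠ r) : ∃ u, G.Adj v u ∧ G.dist v r = G.dist u r + 1 := by
  obtain ⟨p, hp⟩ := hG.exists_walk_length_eq_dist v r
  cases p with
  | nil => exact absurd rfl h
  | @cons _ u _ huv p =>
    refine ⟨u, huv, ?_⟩
    have h1 := SimpleGraph.dist_le p
    have h2 := hG.dist_triangle (u := v) (v := u) (w := r)
    have h3 : G.dist v u = 1 := SimpleGraph.dist_eq_one_iff_adj.2 huv
    rw [SimpleGraph.Walk.length_cons] at hp
    omega

theorem IsCDS.exists_level {V : Type*} {G : SimpleGraph V} {D : Finset V} (hD : IsCDS G D)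
    {b : V} (hb : b ∈ D) : ∃ e : V → ℕ, ∀ v ∈ D, v ≠ b → ∃ u ∈ D, G.Adj v u ∧ e v = e u + 1 := by
  classical
  refine ⟨fun v => if h : v ∈ D then
    (G.induce (D : Set V)).dist ⟨v, h⟩ ⟨b, hb⟩ else 0, fun v hv hvb => ?_⟩
  have hne : (⟨v, hv⟩ : (D : Set V)) ≠ ⟨b, hb⟩ := fun h => hvb (congrArg Subtype.val h)
  obtain ⟨⟨u, hu⟩, hadj, hd⟩ := exists_adj_dist_succ hD.1 hne
  have hu' : u ∈ D := hu
  exact ⟨u, hu', hadj, by dsimp only; rw [dif_pos hv, dif_pos hu']; exact hd⟩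

/-- A level function that can be decreased inside `D` until the root is reached gives both the
connectedness of `D` and the parents. Nodes outside `D` become leaves one level above the maximum.
-/
theorem exists_backbone_of_level {n : ℕ} {G : SimpleGraph (Fin n)} {D : Finset (Fin n)}
    {r : Fin n} (hmin : ∀ v, r ≤ v) (hr : r ∈ D) {g : Fin n → ℕ} {M : ℕ}
    (hg : ∀ v ∈ D, v ≠ r → ∃ u ∈ D, G.Adj v u ∧ g u < g v) (hM : ∀ v ∈ D, g v ≤ M)
    (hdom : ∀ v, v ∉ D → ∃ u ∈ D, G.Adj u v) :
    ∃ B : Backbone G, B.D = D ∧ B.root = r ∧ ∃ h : Fin n → ℕ,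
      (∀ v, v ≠ r → h (B.parent v) < h v) ∧ ∀ v, h v ≤ M + 1 := by
  classical
  let h : Fin n → ℕ := fun v => if v ∈ D then g v else M + 1
  have hpar : ∀ v, ∃ u, (v = r → u = r) ∧ (v ≠ r → u ∈ D ∧ G.Adj v u ∧ h u < h v) := by
    intro v
    by_cases hv : v = r
    · exact ⟨r, fun _ => rfl, fun h => absurd hv h⟩
    by_cases hvD : v ∈ D
    · obtain ⟨u, hu, huv, hlt⟩ := hg v hvD hv
      exact ⟨u, fun h => absurd h hv, fun _ => ⟨hu, huv, by simp only [h, if_pos hu, if_pos hvD, hlt]⟩⟩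
    · obtain ⟨u, hu, huv⟩ := hdom v hvD
      refine ⟨u, fun h => absurd h hv, fun _ => ⟨hu, huv.symm, ?_⟩⟩
      simp only [h, if_pos hu, if_neg hvD]
      exact Nat.lt_succ_of_le (hM u hu)
  choose parent hp1 hp2 using hpar
  have hconn : (G.induce (D : Set (Fin n))).Connected := by
    refine connected_induce_of_reach (a := r) hr ?_
    suffices ∀ k v, g v = k → v ∈ D → Relation.ReflTransGen (fun x y => G.Adj x y ∧
        x ∈ (D : Set (Fin n)) ∧ y ∈ (D : Set (Fin n))) v r from
      fun v hv => this _ v rfl hv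
    intro k
    induction k using Nat.strong_induction_on with
    | _ k ih =>
      intro v hk hv
      by_cases hvr : v = r
      · rw [hvr]
      · obtain ⟨u, hu, huv, hlt⟩ := hg v hv hvr
        exact .head ⟨huv, hv, hu⟩ (ih (g u) (hk ▸ hlt) u rfl hu)
  refine ⟨{ D := D, isCDS := ⟨hconn, hdom⟩, root := r, root_le := hmin, parent := parent,
            parent_root := hp1 r rfl, adj_parent := fun v hv => (hp2 v hv).2.1,
            parent_mem := fun v hv => Or.inr (hp2 v hv).1, reaches_root := ?_ }, rfl, rfl, h,
            fun v hv => (hp2 v hv).2.2, fun v => ?_⟩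
  · suffices ∀ k v, h v = k → ∃ i : ℕ, parent^[i] v = r from fun v => this _ v rfl
    intro k
    induction k using Nat.strong_induction_on with
    | _ k ih =>
      intro v hk
      by_cases hvr : v = r
      · exact ⟨0, hvr⟩
      · obtain ⟨i, hi⟩ := ih _ (hk ▸ (hp2 v hvr).2.2) (parent v) rfl
        exact ⟨i + 1, hi⟩
  · simp only [h]
    split_ifs with hv
    · exact (hM v hv).trans (Nat.le_succ M)
    · exact le_rfl

/-- Pigeonhole: the `L` shifts define disjoint subsets of `D`. -/
theorem exists_sparse_residue {V : Type*} (D : Finset V) (e : V → ℕ) {L : ℕ} (hL : 0 < L) :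
    ∃ j, (D.filter fun v => (e v + j) % L = 0).card * L ≤ D.card := by
  classical
  have key : ∑ j ∈ Finset.range L, (D.filter fun v => (e v + j) % L = 0).card ≤ D.card := by
    simp_rw [Finset.card_filter]
    rw [Finset.sum_comm, Finset.card_eq_sum_ones]
    refine Finset.sum_le_sum fun v _ => ?_
    rw [← Finset.card_filter, Finset.card_le_one]
    intro i hi j hj
    simp only [Finset.mem_filter, Finset.mem_range] at hi hj
    have : (e v + i) ≡ (e v + j) [MOD L] := by rw [Nat.ModEq, hi.2, hj.2]
    have := Nat.ModEq.add_left_cancel' _ this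
    rwa [Nat.ModEq, Nat.mod_eq_of_lt hi.1, Nat.mod_eq_of_lt hj.1] at this
  obtain ⟨j, _, hj⟩ := Finset.exists_le_of_sum_le (s := Finset.range L)
    (f := fun j => (D.filter fun v => (e v + j) % L = 0).card * L) (g := fun _ => D.card)
    ⟨0, by simpa using hL⟩ (by
      rw [← Finset.sum_mul, Finset.sum_const, Finset.card_range, smul_eq_mul, mul_comm]
      exact Nat.mul_le_mul_left L key)
  exact ⟨j, hj⟩

/-- Levels inside `D₀` are cut at every `L`-th one, with `L` the diameter. From the cut nodes
shortest paths of length at most `L` lead to the root. The cheapest cut has at most `|D₀| / L`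
nodes, so its paths cost at most `|D₀|` new nodes. A node of `D₀` descends fewer than `L` levels
before it meets a cut node or the base `b`, which is the root or next to it. -/
theorem exists_shallow_backbone {n : ℕ} {G : SimpleGraph (Fin n)} (hG : G.Connected) (hn : 2 ≤ n)
    {D₀ : Finset (Fin n)} (hD₀ : IsCDS G D₀) :
    ∃ B : Backbone G, D₀ ⊆ B.D ∧ B.root ∈ B.D ∧ B.D.card ≤ 3 * D₀.card ∧ ∃ h : Fin n → ℕ,
      (∀ v, v ≠ B.root → h (B.parent v) < h v) ∧ ∀ v, h v ≤ 2 * G.diam + 1 := by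
  classical
  have : Nontrivial (Fin n) := Fin.nontrivial_iff_two_le.2 hn
  have hL : 0 < G.diam := Nat.pos_of_ne_zero (SimpleGraph.connected_iff_diam_ne_zero.1 hG)
  have hdiam : ∀ u v, G.dist u v ≤ G.diam := fun u v => SimpleGraph.dist_le_diam
    (SimpleGraph.ediam_ne_top_of_diam_ne_zero hL.ne')
  set L := G.diam
  let r : Fin n := ⟨0, by omega⟩
  obtain ⟨b, hb, hbr⟩ : ∃ b ∈ D₀, b = r ∨ G.Adj b r := by
    by_cases hr : r ∈ D₀
    · exact ⟨r, hr, Or.inl rfl⟩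
    · obtain ⟨u, hu, hur⟩ := hD₀.2 r hr
      exact ⟨u, hu, Or.inr hur⟩
  obtain ⟨e, he⟩ := hD₀.exists_level hb
  obtain ⟨j, hj⟩ := exists_sparse_residue D₀ e hL
  set C := D₀.filter fun v => (e v + j) % L = 0
  have hnx : ∀ v, ∃ u, (v ≠ r → G.Adj v u ∧ G.dist v r = G.dist u r + 1) := fun v =>
    if h : v = r then ⟨r, fun h' => absurd h h'⟩
    else (exists_adj_dist_succ hG h).imp fun u hu _ => hu
  choose nx hnx using hnx
  have hpath : ∀ w i, (∃ i' < i, nx^[i'] w = r) ∨ G.dist w r = G.dist (nx^[i] w) r + i := by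
    intro w i
    induction i with
    | zero => right; rfl
    | succ i ih =>
      rcases ih with ⟨i', h1, h2⟩ | ih
      · exact Or.inl ⟨i', by omega, h2⟩
      · by_cases h : nx^[i] w = r
        · exact Or.inl ⟨i, by omega, h⟩
        · right
          have := (hnx _ h).2
          rw [Function.iterate_succ_apply']
          omega
  -- the geodesics from `C`, up to the point where they meet the root
  let P : Finset (Fin n) := insert r (Finset.univ.filter fun v => v ≠ r ∧
    ∃ w ∈ C, ∃ i, nx^[i] w = v ∧ G.dist w r = G.dist v r + i)
  have hrP : r ∈ P := Finset.mem_insert_self _ _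
  have hCP : ∀ v ∈ C, v ∈ P := by
    intro v hv
    by_cases h : v = r
    · rw [h]; exact hrP
    · exact Finset.mem_insert_of_mem (Finset.mem_filter.2 ⟨Finset.mem_univ _, h, v, hv, 0, rfl, rfl⟩)
  have hPn : ∀ v ∈ P, v ≠ r → nx v ∈ P := by
    intro v hv hvr
    obtain ⟨_, _, w, hw, i, hi, hd⟩ := Finset.mem_filter.1 ((Finset.mem_insert.1 hv).resolve_left hvr)
    by_cases h : nx v = r
    · rw [h]; exact hrP
    · refine Finset.mem_insert_of_mem (Finset.mem_filter.2 ⟨Finset.mem_univ _, h, w, hw, i + 1, ?_, ?_⟩)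
      · rw [Function.iterate_succ_apply', hi]
      · have := (hnx v hvr).2
        omega
  have hPcard : (P \ D₀).card ≤ 1 + C.card * L := by
    have hsub : P \ D₀ ⊆ insert r (C.biUnion fun w =>
        (Finset.range L).image fun i => nx^[i + 1] w) := by
      intro v hv
      obtain ⟨hv1, hv2⟩ := Finset.mem_sdiff.1 hv
      rcases Finset.mem_insert.1 hv1 with rfl | hv1
      · exact Finset.mem_insert_self _ _
      · obtain ⟨_, hvr, w, hw, i, hi, hd⟩ := Finset.mem_filter.1 hv1
        refine Finset.mem_insert_of_mem (Finset.mem_biUnion.2 ⟨w, hw, Finset.mem_image.2 ?_⟩)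
        cases i with
        -- The start of a path lies in `D₀` already, so at most `L` new nodes remain on it.
        | zero =>
          have hwv : w = v := hi
          rw [← hwv] at hv2
          exact absurd (Finset.mem_filter.1 hw).1 hv2
        | succ i =>
          refine ⟨i, ?_, hi⟩
          have := hdiam w r
          rw [Finset.mem_range]
          omega
    refine (Finset.card_le_card hsub).trans ((Finset.card_insert_le _ _).trans ?_)
    rw [add_comm]
    refine Nat.add_le_add_left (Finset.card_biUnion_le.trans ?_) 1
    refine (Finset.sum_le_card_nsmul _ _ L fun w _ => ?_).trans (by simp)
    exact Finset.card_image_le.trans (by simp)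
  -- All path nodes have levels at most `L`; the rest of `D₀` lies above them, ordered by residue,
  -- with levels at most `2 * L`.
  let g : Fin n → ℕ := fun v => if v ∈ P then G.dist v r else L + 1 + (e v + j) % L
  have hgP : ∀ v ∈ P, g v = G.dist v r := fun v hv => if_pos hv
  have hgN : ∀ v, v ∉ P → g v = L + 1 + (e v + j) % L := fun v hv => if_neg hv
  obtain ⟨B, hBD, hBr, h, h1, h2⟩ := exists_backbone_of_level (G := G) (D := D₀ ∪ P) (r := r)
    (g := g) (M := 2 * L) (fun v => Nat.zero_le _) (Finset.mem_union_right _ hrP) (by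
      intro v hv hvr
      by_cases hvP : v ∈ P
      · have := hnx v hvr
        refine ⟨nx v, Finset.mem_union_right _ (hPn v hvP hvr), this.1, ?_⟩
        rw [hgP _ hvP, hgP _ (hPn v hvP hvr)]
        omega
      · have hvD : v ∈ D₀ := (Finset.mem_union.1 hv).resolve_right hvP
        by_cases hvb : v = b
        · subst hvb
          refine ⟨r, Finset.mem_union_right _ hrP, hbr.resolve_left hvr, ?_⟩
          rw [hgP _ hrP, hgN _ hvP, SimpleGraph.dist_self]
          omega
        · obtain ⟨u, hu, huv, heu⟩ := he v hvD hvb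
          refine ⟨u, Finset.mem_union_left _ hu, huv, ?_⟩
          rw [hgN _ hvP]
          by_cases huP : u ∈ P
          · rw [hgP _ huP]
            have := hdiam u r
            omega
          · rw [hgN _ huP]
            have hne : (e v + j) % L ≠ 0 := fun h0 =>
              hvP (hCP v (Finset.mem_filter.2 ⟨hvD, h0⟩))
            -- No wrap-around occurs: residue 0 would put `v` into the cut and thus into `P`.
            have hs : (e v + j) % L = (e u + j) % L + 1 := by
              have e1 : e v + j = (e u + j) + 1 := by omega
              rw [e1] at hne ⊢
              rw [Nat.add_mod_eq_ite] at hne ⊢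
              rcases Nat.lt_or_ge 1 L with h1L | h1L
              · rw [Nat.mod_eq_of_lt h1L] at hne ⊢
                split_ifs at hne ⊢ with h2
                · have := Nat.mod_lt (e u + j) hL
                  omega
                · rfl
              · have : L = 1 := by omega
                rw [this] at hne
                simp [Nat.mod_one] at hne
            omega) (by
      intro v hv
      by_cases hvP : v ∈ P
      · rw [hgP _ hvP]
        have := hdiam v r
        omega
      · rw [hgN _ hvP]
        have := Nat.mod_lt (e v + j) hL
        omega) (by
      intro v hv
      obtain ⟨u, hu, huv⟩ := hD₀.2 v fun h => hv (Finset.mem_union_left _ h)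
      exact ⟨u, Finset.mem_union_left _ hu, huv⟩)
  have hpos : 1 ≤ D₀.card := Finset.card_pos.2 ⟨b, hb⟩
  refine ⟨B, ?_, ?_, ?_, h, ?_, h2⟩
  · rw [hBD]; exact Finset.subset_union_left
  · rw [hBD, hBr]; exact Finset.mem_union_right _ hrP
  · rw [hBD, ← Finset.union_sdiff_self_eq_union]
    have := Finset.card_union_le D₀ (P \ D₀)
    omega
  · rw [hBr]; exact h1

/-- Balls grow by a factor of at most `1 + Δ` per step. This makes `log n` comparable to `diam * log
Δ`, so that the number of nodes disappears from the time bound. -/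
theorem card_le_of_connected {n : ℕ} {G : SimpleGraph (Fin n)} [DecidableRel G.Adj]
    (hG : G.Connected) : n ≤ (1 + G.maxDegree) ^ G.diam := by
  classical
  obtain ⟨r⟩ := hG.nonempty
  have key : ∀ i : ℕ, (Finset.univ.filter fun v => G.dist v r ≤ i).card ≤
      (1 + G.maxDegree) ^ i := by
    intro i
    induction i with
    | zero =>
      rw [pow_zero, Finset.card_le_one]
      intro a ha b hb
      simp only [Finset.mem_filter, Finset.mem_univ, true_and, Nat.le_zero,
        hG.dist_eq_zero_iff] at ha hb
      rw [ha, hb]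
    | succ i ih =>
      have hsub : (Finset.univ.filter fun v => G.dist v r ≤ i + 1) ⊆
          (Finset.univ.filter fun v => G.dist v r ≤ i).biUnion
            fun u => insert u (G.neighborFinset u) := by
        intro v hv
        simp only [Finset.mem_filter, Finset.mem_univ, true_and] at hv
        simp only [Finset.mem_biUnion, Finset.mem_filter, Finset.mem_univ, true_and,
          Finset.mem_insert, SimpleGraph.mem_neighborFinset]
        by_cases h : v = r
        · exact ⟨v, by simp [h], Or.inl rfl⟩
        · obtain ⟨u, huv, hd⟩ := exists_adj_dist_succ hG h
          exact ⟨u, by omega, Or.inr huv.symm⟩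
      refine (Finset.card_le_card hsub).trans (Finset.card_biUnion_le.trans ?_)
      refine (Finset.sum_le_card_nsmul _ _ (1 + G.maxDegree) fun u _ => ?_).trans ?_
      · refine (Finset.card_insert_le _ _).trans ?_
        rw [SimpleGraph.card_neighborFinset_eq_degree, add_comm]
        exact Nat.add_le_add_left (G.degree_le_maxDegree u) 1
      · rw [smul_eq_mul, pow_succ]
        exact Nat.mul_le_mul_right _ ih
  have h := key G.diam
  rw [Finset.filter_true_of_mem, Finset.card_univ, Fintype.card_fin] at h
  · exact h
  · intro v _
    exact SimpleGraph.dist_le_diam (by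
      have := hG.nonempty
      exact SimpleGraph.connected_iff_ediam_ne_top.1 hG)

/-! ### One round of the transmission routine -/

/-! ### Averages over a finite sample space -/

section Avg

variable {Ω : Type*} [Fintype Ω]

/-- The average of a function on a finite type. -/
def avg (f : Ω → ℝ) : ℝ := (∑ ω, f ω) / Fintype.card Ω

theorem avg_mono {f g : Ω → ℝ} (h : ∀ ω, f ω ≤ g ω) : avg f ≤ avg g :=
  div_le_div_of_nonneg_right (Finset.sum_le_sum fun ω _ => h ω) (Nat.cast_nonneg _)

theorem avg_nonneg {f : Ω → ℝ} (h : ∀ ω, 0 ≤ f ω) : 0 ≤ avg f :=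
  div_nonneg (Finset.sum_nonneg fun ω _ => h ω) (Nat.cast_nonneg _)

theorem avg_sum {ι : Type*} (t : Finset ι) (f : ι → Ω → ℝ) :
    avg (fun ω => ∑ i ∈ t, f i ω) = ∑ i ∈ t, avg (f i) := by
  unfold avg
  rw [Finset.sum_comm, Finset.sum_div]

theorem avg_add (f g : Ω → ℝ) : avg (fun ω => f ω + g ω) = avg f + avg g := by
  unfold avg
  rw [Finset.sum_add_distrib, add_div]

theorem avg_const_mul (a : ℝ) (f : Ω → ℝ) : avg (fun ω => a * f ω) = a * avg f := by
  unfold avg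
  rw [← Finset.mul_sum, mul_div_assoc]

theorem avg_const [Nonempty Ω] (a : ℝ) : avg (fun _ : Ω => a) = a := by
  unfold avg
  rw [Finset.sum_const, Finset.card_univ, nsmul_eq_mul, mul_div_cancel_left₀]
  exact Nat.cast_ne_zero.2 Fintype.card_ne_zero

end Avg

/-! ### The probability of an acknowledgment in one round -/

section Round

variable {n m : ℕ}

open Classical in
theorem avg_box (X Y : Fin n → Finset (Fin m)) :
    avg (fun ω : Fin n → Fin m × Fin m =>
      if ∀ w, (ω w).1 ∈ X w ∧ (ω w).2 ∈ Y w then (1 : ℝ) else 0) =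
      ∏ w, (((X w).card : ℝ) / m * ((Y w).card / m)) := by
  have h1 : (Finset.univ.filter fun ω : Fin n → Fin m × Fin m =>
      ∀ w, (ω w).1 ∈ X w ∧ (ω w).2 ∈ Y w) = Fintype.piFinset fun w => X w ×ˢ Y w := by
    ext ω
    simp [Fintype.mem_piFinset, Finset.mem_product]
  unfold avg
  rw [Finset.sum_boole, h1, Fintype.card_piFinset]
  simp only [Finset.card_product, Fintype.card_pi, Fintype.card_prod, Fintype.card_fin]
  push_cast
  rw [← Finset.prod_div_distrib]
  exact Finset.prod_congr rfl fun w _ => by rw [div_mul_div_comm]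

theorem prod_pivot (a r : ℝ) (v : Fin n) (A : Finset (Fin n)) (hv : v ∉ A) :
    ∏ w, (if w = v then a else if w ∈ A then r else 1) = a * r ^ A.card := by
  classical
  have : ∀ w, (if w = v then a else if w ∈ A then r else 1) =
      (if w = v then a else 1) * (if w ∈ A then r else 1) := by
    intro w
    by_cases h : w = v
    · subst h; simp [hv]
    · simp [h]
  simp_rw [this]
  rw [Finset.prod_mul_distrib, Finset.prod_ite_eq' , if_pos (Finset.mem_univ v),
    Finset.prod_ite_mem, Finset.univ_inter, Finset.prod_const]

theorem card_compl_div [NeZero m] (i : Fin m) : ((({i}ᶜ : Finset (Fin m)).card : ℝ)) / m = 1 - 1 / m := by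
  have hm : 1 ≤ m := Nat.one_le_iff_ne_zero.2 (NeZero.ne m)
  rw [Finset.card_compl, Finset.card_singleton, Fintype.card_fin, Nat.cast_sub hm, sub_div,
    div_self (Nat.cast_ne_zero.2 (NeZero.ne m)), Nat.cast_one]

open Classical in
/-- Two independent slots: all of `A` avoid the first slot of `v`, and all of `B` avoid in their
second slot the first slot of `v`. -/
theorem avg_avoid_fst [NeZero m] (v : Fin n) (A B : Finset (Fin n)) (hv : v ∉ A) :
    avg (fun ω : Fin n → Fin m × Fin m =>
      if (∀ w ∈ A, (ω w).1 ≠ (ω v).1) ∧ (∀ w ∈ B, (ω w).2 ≠ (ω v).1) then (1 : ℝ) else 0) =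
      (1 - 1 / m) ^ (A.card + B.card) := by
  have hm : (m : ℝ) ≠ 0 := Nat.cast_ne_zero.2 (NeZero.ne m)
  -- The slot of `v` is fixed first: this splits the event into disjoint boxes, in each of which all
  -- draws are constrained independently.
  have key : ∀ ω : Fin n → Fin m × Fin m,
      (if (∀ w ∈ A, (ω w).1 ≠ (ω v).1) ∧ (∀ w ∈ B, (ω w).2 ≠ (ω v).1) then (1 : ℝ) else 0) =
      ∑ i : Fin m, if ∀ w,
        (ω w).1 ∈ (if w = v then {i} else if w ∈ A then {i}ᶜ else Finset.univ : Finset (Fin m)) ∧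
        (ω w).2 ∈ (if w ∈ B then {i}ᶜ else Finset.univ : Finset (Fin m)) then 1 else 0 := by
    intro ω
    rw [Finset.sum_eq_single (ω v).1]
    · congr 1
      refine propext ⟨fun h w => ⟨?_, ?_⟩, fun h => ⟨fun w hw => ?_, fun w hw => ?_⟩⟩
      · split_ifs with h1 h2
        · simp [h1]
        · simpa using h.1 w h2
        · simp
      · split_ifs with h1
        · simpa using h.2 w h1
        · simp
      · have := (h w).1
        rw [if_neg (fun e : w = v => hv (e ▸ hw)), if_pos hw] at this
        simpa using this
      · have := (h w).2
        rw [if_pos hw] at this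
        simpa using this
    · intro i _ hi
      rw [if_neg]
      intro h
      have := (h v).1
      rw [if_pos rfl, Finset.mem_singleton] at this
      exact hi this.symm
    · simp
  simp_rw [key]
  rw [avg_sum]
  have hbox : ∀ i : Fin m, avg (fun ω : Fin n → Fin m × Fin m => if ∀ w,
        (ω w).1 ∈ (if w = v then {i} else if w ∈ A then {i}ᶜ else Finset.univ : Finset (Fin m)) ∧
        (ω w).2 ∈ (if w ∈ B then {i}ᶜ else Finset.univ : Finset (Fin m)) then (1 : ℝ) else 0) =
      (1 / m) * (1 - 1 / m) ^ (A.card + B.card) := by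
    intro i
    rw [avg_box, Finset.prod_mul_distrib, pow_add, ← mul_assoc, ← prod_pivot (1 / (m : ℝ)) _ v A hv]
    congr 1
    · refine Finset.prod_congr rfl fun w _ => ?_
      split_ifs
      · simp
      · exact card_compl_div i
      · simp [hm]
    · have hB : ∏ w, (if w ∈ B then 1 - 1 / (m : ℝ) else 1) = (1 - 1 / (m : ℝ)) ^ B.card := by
        rw [Finset.prod_ite_mem, Finset.univ_inter, Finset.prod_const]
      rw [← hB]
      refine Finset.prod_congr rfl fun w _ => ?_
      split_ifs
      · exact card_compl_div i
      · simp [hm]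
  simp_rw [hbox]
  simp [hm]

open Classical in
/-- All of `A` avoid the first slot of `v`, and all of `B` avoid the second slot of `u`. -/
theorem avg_avoid_snd [NeZero m] (v u : Fin n) (A B : Finset (Fin n)) (hv : v ∉ A) (hu : u ∉ B) :
    avg (fun ω : Fin n → Fin m × Fin m =>
      if (∀ w ∈ A, (ω w).1 ≠ (ω v).1) ∧ (∀ w ∈ B, (ω w).2 ≠ (ω u).2) then (1 : ℝ) else 0) =
      (1 - 1 / m) ^ (A.card + B.card) := by
  have hm : (m : ℝ) ≠ 0 := Nat.cast_ne_zero.2 (NeZero.ne m)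
  have key : ∀ ω : Fin n → Fin m × Fin m,
      (if (∀ w ∈ A, (ω w).1 ≠ (ω v).1) ∧ (∀ w ∈ B, (ω w).2 ≠ (ω u).2) then (1 : ℝ) else 0) =
      ∑ i : Fin m × Fin m, if ∀ w,
        (ω w).1 ∈ (if w = v then {i.1} else if w ∈ A then {i.1}ᶜ else Finset.univ : Finset (Fin m)) ∧
        (ω w).2 ∈ (if w = u then {i.2} else if w ∈ B then {i.2}ᶜ else Finset.univ : Finset (Fin m))
        then 1 else 0 := by
    intro ω
    rw [Finset.sum_eq_single ((ω v).1, (ω u).2)]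
    · congr 1
      refine propext ⟨fun h w => ⟨?_, ?_⟩, fun h => ⟨fun w hw => ?_, fun w hw => ?_⟩⟩
      · split_ifs with h1 h2
        · simp [h1]
        · simpa using h.1 w h2
        · simp
      · split_ifs with h1 h2
        · simp [h1]
        · simpa using h.2 w h2
        · simp
      · have := (h w).1
        rw [if_neg (fun e : w = v => hv (e ▸ hw)), if_pos hw] at this
        simpa using this
      · have := (h w).2
        rw [if_neg (fun e : w = u => hu (e ▸ hw)), if_pos hw] at this
        simpa using this
    · intro i _ hi
      rw [if_neg]
      intro h
      have h1 := (h v).1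
      have h2 := (h u).2
      rw [if_pos rfl, Finset.mem_singleton] at h1 h2
      exact hi (Prod.ext h1.symm h2.symm)
    · simp
  simp_rw [key]
  rw [avg_sum]
  have hbox : ∀ i : Fin m × Fin m, avg (fun ω : Fin n → Fin m × Fin m => if ∀ w,
        (ω w).1 ∈ (if w = v then {i.1} else if w ∈ A then {i.1}ᶜ else Finset.univ : Finset (Fin m)) ∧
        (ω w).2 ∈ (if w = u then {i.2} else if w ∈ B then {i.2}ᶜ else Finset.univ : Finset (Fin m))
        then (1 : ℝ) else 0) =
      (1 / m * (1 / m)) * (1 - 1 / m) ^ (A.card + B.card) := by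
    intro i
    rw [avg_box, Finset.prod_mul_distrib, pow_add, mul_mul_mul_comm,
      ← prod_pivot (1 / (m : ℝ)) _ v A hv, ← prod_pivot (1 / (m : ℝ)) _ u B hu]
    congr 1
    · refine Finset.prod_congr rfl fun w _ => ?_
      split_ifs
      · simp
      · exact card_compl_div _
      · simp [hm]
    · refine Finset.prod_congr rfl fun w _ => ?_
      split_ifs
      · simp
      · exact card_compl_div _
      · simp [hm]
  simp_rw [hbox]
  simp
  field_simp

variable {G : SimpleGraph (Fin n)} {s : Fin n → NodeState n} {ω : Fin n → Fin m × Fin m}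

theorem gotMessage_of_avoid {v u : Fin n} {g : Msg n} {R : Finset (Fin n)}
    (hjob : (s v).job = some (g, R)) (hu : u ∈ R) (huv : G.Adj u v)
    (h : ∀ w, (w = u ∨ G.Adj u w) → w ≠ v → (ω w).1 ≠ (ω v).1) : GotMessage G s ω u v := by
  refine ⟨⟨_, hjob, hu⟩, fun hs => h u (Or.inl rfl) huv.ne hs.2, huv, ⟨by simp [hjob], rfl⟩, ?_⟩
  intro w hw hs
  by_contra hne
  exact h w (Or.inr hw) hne hs.2

theorem GotMessage.job {u v : Fin n} (h : GotMessage G s ω u v) :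
    ∃ g R, (s v).job = some (g, R) ∧ u ∈ R := by
  obtain ⟨⟨⟨g, R⟩, h1, h2⟩, _⟩ := h
  exact ⟨g, R, h1, h2⟩

theorem ackSlot_of_up {u v : Fin n} {g : Msg n} {R : Finset (Fin n)}
    (hjob : (s v).job = some (g, R)) (hg : g.up = true) : ackSlot s ω u v = (ω v).1 := by
  simp [ackSlot, hjob, hg]

theorem ackSlot_of_down {u v : Fin n} {g : Msg n} {R : Finset (Fin n)}
    (hjob : (s v).job = some (g, R)) (hg : g.up = false) : ackSlot s ω u v = (ω u).2 := by
  simp [ackSlot, hjob, hg]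

theorem gotAck_of_silent {v u : Fin n} (hmsg : GotMessage G s ω u v)
    (h : ∀ w, (w = v ∨ G.Adj v w) → w ≠ u → ¬ AcksIn G s ω (ackSlot s ω u v) w) :
    GotAck G s ω v u := by
  have huv : G.Adj u v := hmsg.2.2.1
  refine ⟨hmsg, h v (Or.inl rfl) huv.symm.ne, huv.symm, ⟨v, hmsg, rfl⟩, ?_⟩
  intro w hw hs
  by_contra hne
  exact h w (Or.inr hw) hne hs

/-- The point of answering in slot `x v`: two acknowledgments of upward messages can only share a
slot if the two messages shared one. A neighbor of `v` that received another message in that slot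
would have heard a collision with `v`. So only acknowledgments of downward messages can interfere,
and these use the second draws, which are independent of `x v`. -/
theorem gotAck_up {v u : Fin n} {g : Msg n} {R : Finset (Fin n)}
    (hjob : (s v).job = some (g, R)) (hg : g.up = true) (hR : R = {u}) (huv : G.Adj u v)
    (h1 : ∀ w, (w = u ∨ G.Adj u w) → w ≠ v → (ω w).1 ≠ (ω v).1)
    (h2 : ∀ w, (w = v ∨ G.Adj v w) → w ≠ u → (ω w).2 ≠ (ω v).1) : GotAck G s ω v u := by
  have hmsg : GotMessage G s ω u v := gotMessage_of_avoid hjob (by simp [hR]) huv h1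
  refine gotAck_of_silent hmsg fun w hw hwu => ?_
  rw [ackSlot_of_up hjob hg]
  rintro ⟨v', hm, ha⟩
  obtain ⟨g', R', hj', hwR⟩ := hm.job
  cases hg' : g'.up with
  | false =>
    rw [ackSlot_of_down hj' hg'] at ha
    exact h2 w hw hwu ha
  | true =>
    rw [ackSlot_of_up hj' hg'] at ha
    -- `v` transmits in the very slot in which `w` hears `v'`; hence `w = v` is impossible, and a
    -- neighbor `w` must have heard `v` itself.
    have hv : SendsIn s ω (ω v').1 v := ⟨by simp [hjob], ha.symm⟩
    rcases hw with rfl | hw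
    · exact hm.2.1 hv
    · obtain rfl := hm.2.2.2.2 v hw.symm hv
      rw [hjob] at hj'
      obtain ⟨rfl, rfl⟩ := Prod.mk.inj (Option.some.inj hj')
      rw [hR, Finset.mem_singleton] at hwR
      exact hwu hwR

/-- Without pending upward messages every acknowledgment uses the second draw of its sender, so the
two halves of the round involve independent draws. -/
theorem gotAck_down {v u : Fin n} {g : Msg n} {R : Finset (Fin n)}
    (hjob : (s v).job = some (g, R)) (hu : u ∈ R) (huv : G.Adj u v)
    (hno : ∀ w g R, (s w).job = some (g, R) → g.up = false)
    (h1 : ∀ w, (w = u ∨ G.Adj u w) → w ≠ v → (ω w).1 ≠ (ω v).1)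
    (h2 : ∀ w, (w = v ∨ G.Adj v w) → w ≠ u → (ω w).2 ≠ (ω u).2) : GotAck G s ω v u := by
  have hmsg : GotMessage G s ω u v := gotMessage_of_avoid hjob hu huv h1
  refine gotAck_of_silent hmsg fun w hw hwu => ?_
  rw [ackSlot_of_down hjob (hno _ _ _ hjob)]
  rintro ⟨v', hm, ha⟩
  obtain ⟨g', R', hj', _⟩ := hm.job
  rw [ackSlot_of_down hj' (hno _ _ _ hj')] at ha
  exact h2 w hw hwu ha

theorem one_sub_inv_bounds (hm : 2 ≤ m) : 0 ≤ 1 - 1 / (m : ℝ) ∧ 1 - 1 / (m : ℝ) ≤ 1 := by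
  have h : (2 : ℝ) ≤ m := by exact_mod_cast hm
  have h1 : 1 / (m : ℝ) ≤ 1 := by
    rw [div_le_one (by linarith)]
    linarith
  have h2 : 0 ≤ 1 / (m : ℝ) := by positivity
  constructor <;> linarith

open Classical in
/-- A listed receiver is heard to acknowledge with probability at least `(1 - 1 / m) ^ (2 * Δ)`,
if the message goes to a single receiver, or if no message to a single receiver is pending. -/
theorem le_avg_gotAck [NeZero m] [DecidableRel G.Adj] (hm : 2 ≤ m) {v u : Fin n} {g : Msg n}
    {R : Finset (Fin n)} (hjob : (s v).job = some (g, R)) (hu : u ∈ R) (huv : G.Adj u v)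
    (h : (g.up = true ∧ R = {u}) ∨ ∀ w g R, (s w).job = some (g, R) → g.up = false) :
    (1 - 1 / (m : ℝ)) ^ (2 * G.maxDegree) ≤
      avg (fun ω : Fin n → Fin m × Fin m => if GotAck G s ω v u then (1 : ℝ) else 0) := by
  -- The competitors around a receiver `x` are `x` itself and its neighbors except the sender `y`:
  -- exactly as many as the degree of `x`.
  have hcard : ∀ x y, G.Adj x y → ((insert x (G.neighborFinset x)).erase y).card ≤ G.maxDegree := by
    intro x y hxy
    rw [Finset.card_erase_of_mem (by simp [hxy]), Finset.card_insert_of_notMem (by simp),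
      SimpleGraph.card_neighborFinset_eq_degree]
    exact G.degree_le_maxDegree x
  set A := (insert u (G.neighborFinset u)).erase v with hA
  set B := (insert v (G.neighborFinset v)).erase u with hB
  have hAB : A.card + B.card ≤ 2 * G.maxDegree := by
    have h1 : A.card ≤ G.maxDegree := hcard u v huv
    have h2 : B.card ≤ G.maxDegree := hcard v u huv.symm
    omega
  obtain ⟨hr0, hr1⟩ := one_sub_inv_bounds hm
  refine (pow_le_pow_of_le_one hr0 hr1 hAB).trans ?_
  rcases h with ⟨hg, hR⟩ | hno
  · rw [← avg_avoid_fst v A B (by simp [hA])]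
    refine avg_mono fun ω => ?_
    split_ifs with h1 h2
    · exact le_rfl
    · refine absurd (gotAck_up hjob hg hR huv (fun w hw hne => h1.1 w ?_)
        (fun w hw hne => h1.2 w ?_)) h2 <;> simpa [A, B, hne] using hw
    · exact zero_le_one
    · exact le_rfl
  · rw [← avg_avoid_snd v u A B (by simp [hA]) (by simp [hB])]
    refine avg_mono fun ω => ?_
    split_ifs with h1 h2
    · exact le_rfl
    · refine absurd (gotAck_down hjob hu huv hno (fun w hw hne => h1.1 w ?_)
        (fun w hw hne => h1.2 w ?_)) h2 <;> simpa [A, B, hne] using hw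
    · exact zero_le_one
    · exact le_rfl

/-- `1 - t ≥ exp (-2 * t)` for `0 ≤ t ≤ 1 / 2`, which is where two slots are needed. With `m = μ *
Δ` the left side is `exp (-4 / μ)`. -/
theorem exp_le_success (hm : 2 ≤ m) (Δ : ℕ) :
    Real.exp (-4 * Δ / m) ≤ (1 - 1 / (m : ℝ)) ^ (2 * Δ) := by
  have h : (2 : ℝ) ≤ m := by exact_mod_cast hm
  have hx : 1 / (m : ℝ) ≤ 1 / 2 := one_div_le_one_div_of_le (by norm_num) h
  have hx0 : 0 < 1 / (m : ℝ) := by positivity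
  have key : Real.exp (-2 * (1 / m)) ≤ 1 - 1 / (m : ℝ) := by
    set t := 1 / (m : ℝ)
    have h1 : 1 + 2 * t + (2 * t) ^ 2 / 2 ≤ Real.exp (2 * t) :=
      Real.quadratic_le_exp_of_nonneg (by linarith)
    have h2 : 1 ≤ (1 - t) * Real.exp (2 * t) := by
      have : 1 ≤ (1 - t) * (1 + 2 * t + (2 * t) ^ 2 / 2) := by nlinarith [mul_nonneg hx0.le (sub_nonneg.2 hx), mul_nonneg hx0.le hx0.le]
      exact this.trans (mul_le_mul_of_nonneg_left h1 (by linarith))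
    have h3 : Real.exp (-2 * t) = 1 / Real.exp (2 * t) := by
      rw [neg_mul, Real.exp_neg, one_div]
    rw [h3, div_le_iff₀ (Real.exp_pos _)]
    exact h2
  calc Real.exp (-4 * Δ / m) = Real.exp (-2 * (1 / m)) ^ (2 * Δ) := by
        rw [← Real.exp_nat_mul]
        congr 1
        push_cast
        ring
    _ ≤ _ := pow_le_pow_left₀ (Real.exp_pos _).le key _

end Round

/-! ### Independence of the rounds -/

/-- `F` depends only on the first `t` terms of a sequence. -/
def DependsOnFirst {Ω β : Type*} (t : ℕ) (F : (ℕ → Ω) → β) : Prop :=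
  ∀ ω ω' : ℕ → Ω, (∀ i < t, ω i = ω' i) → F ω = F ω'

theorem DependsOnFirst.comp {Ω β γ : Type*} {t : ℕ} {F : (ℕ → Ω) → β} (h : DependsOnFirst t F)
    (g : β → γ) : DependsOnFirst t fun ω => g (F ω) :=
  fun ω ω' hω => congrArg g (h ω ω' hω)

/-- Passing to finitely many coordinates of a finite type makes all measurability questions discrete
and lets independence of disjoint sets of coordinates apply. The values filled in beyond `t` are
irrelevant. -/
theorem DependsOnFirst.factor {Ω β : Type*} [Nonempty Ω] {t : ℕ} {F : (ℕ → Ω) → β}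
    (h : DependsOnFirst t F) :
    ∃ F' : ((Finset.range t) → Ω) → β, F = fun ω => F' fun i => ω i := by
  classical
  refine ⟨fun x => F fun i => if hi : i ∈ Finset.range t then x ⟨i, hi⟩ else Classical.arbitrary Ω,
    funext fun ω => h _ _ fun i hi => ?_⟩
  rw [dif_pos (Finset.mem_range.2 hi)]

section

variable {Ω : Type*} [Fintype Ω] [Nonempty Ω] [MeasurableSpace Ω] [DiscreteMeasurableSpace Ω]

theorem DependsOnFirst.measurable {β : Type*} [MeasurableSpace β] {t : ℕ} {F : (ℕ → Ω) → β}
    (h : DependsOnFirst t F) : Measurable F := by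
  obtain ⟨F', rfl⟩ := h.factor
  exact (Measurable.of_discrete (f := F')).comp
    (measurable_pi_lambda _ fun i => measurable_pi_apply _)

/-- The conditional expectation given the first `t` rounds, in integrated form: `ω t` is uniform and
independent of the past. The proof sums over the finitely many values of `ω t`. -/
theorem lintegral_next (t : ℕ) {β : Type*} {F : (ℕ → Ω) → β} (hF : DependsOnFirst t F)
    (f : β → Ω → ℝ) (hf : ∀ b x, 0 ≤ f b x) :
    ∫⁻ ω, ENNReal.ofReal (f (F ω) (ω t))
        ∂(Measure.infinitePi fun _ : ℕ => (PMF.uniformOfFintype Ω).toMeasure) =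
      ∫⁻ ω, ENNReal.ofReal (avg (f (F ω)))
        ∂(Measure.infinitePi fun _ : ℕ => (PMF.uniformOfFintype Ω).toMeasure) := by
  classical
  set P := Measure.infinitePi fun _ : ℕ => (PMF.uniformOfFintype Ω).toMeasure with hP
  have hindep : ProbabilityTheory.iIndepFun (fun (i : ℕ) (ω : ℕ → Ω) => ω i) P :=
    ProbabilityTheory.iIndepFun_infinitePi (X := fun _ => id) fun _ => measurable_id
  have hind := hindep.indepFun_finset {t} (Finset.range t) (by simp) fun i => measurable_pi_apply i
  have hdec : ∀ ω : ℕ → Ω, ENNReal.ofReal (f (F ω) (ω t)) =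
      ∑ x : Ω, (if ω t = x then 1 else 0) * ENNReal.ofReal (f (F ω) x) := by
    intro ω
    rw [Finset.sum_eq_single (ω t)]
    · simp
    · intro x _ hx
      rw [if_neg (Ne.symm hx), zero_mul]
    · simp
  have hmeas : ∀ x, Measurable fun ω : ℕ → Ω => ENNReal.ofReal (f (F ω) x) := fun x =>
    (hF.comp fun b => ENNReal.ofReal (f b x)).measurable
  have hmeas' : ∀ x, Measurable fun ω : ℕ → Ω => if ω t = x then (1 : ENNReal) else 0 := fun x =>
    (Measurable.of_discrete (f := fun y : Ω => if y = x then (1 : ENNReal) else 0)).comp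
      (measurable_pi_apply t)
  have hprod : ∀ x, ∫⁻ ω, (if ω t = x then 1 else 0) * ENNReal.ofReal (f (F ω) x) ∂P =
      (Fintype.card Ω : ENNReal)⁻¹ * ∫⁻ ω, ENNReal.ofReal (f (F ω) x) ∂P := by
    intro x
    obtain ⟨F', hF'⟩ := (hF.comp fun b => ENNReal.ofReal (f b x)).factor
    have hi : ProbabilityTheory.IndepFun (fun ω : ℕ → Ω => if ω t = x then (1 : ENNReal) else 0)
        (fun ω => ENNReal.ofReal (f (F ω) x)) P := by
      rw [hF']
      exact hind.comp (φ := fun y => if y ⟨t, Finset.mem_singleton_self t⟩ = x then (1 : ENNReal) else 0)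
        (ψ := F') Measurable.of_discrete Measurable.of_discrete
    have := ProbabilityTheory.lintegral_mul_eq_lintegral_mul_lintegral_of_indepFun
      (hmeas' x) (hmeas x) hi
    simp only [Pi.mul_apply] at this
    rw [this]
    congr 1
    have h1 : ∫⁻ ω, (if ω t = x then (1 : ENNReal) else 0) ∂P =
        ∫⁻ y, (if y = x then (1 : ENNReal) else 0) ∂(P.map fun ω => ω t) :=
      (lintegral_map (Measurable.of_discrete (f := fun y : Ω => if y = x then (1 : ENNReal) else 0))
        (measurable_pi_apply t)).symm
    rw [h1, hP, Measure.infinitePi_map_eval]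
    have h2 : (fun y : Ω => if y = x then (1 : ENNReal) else 0) = Set.indicator {x} 1 := by
      funext y
      by_cases h : y = x <;> simp [h]
    rw [h2, lintegral_indicator_one (measurableSet_singleton x),
      PMF.toMeasure_apply_singleton _ _ (measurableSet_singleton x), PMF.uniformOfFintype_apply]
  simp_rw [hdec]
  have hmul : ∀ x, Measurable fun ω : ℕ → Ω =>
      (if ω t = x then (1 : ENNReal) else 0) * ENNReal.ofReal (f (F ω) x) :=
    fun x => (hmeas' x).mul (hmeas x)
  rw [lintegral_finsetSum _ fun x _ => hmul x]
  simp_rw [hprod]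
  rw [← Finset.mul_sum, ← lintegral_finsetSum _ fun x _ => hmeas x, ← lintegral_const_mul _
    (Finset.measurable_fun_sum _ fun x _ => hmeas x)]
  refine lintegral_congr fun ω => ?_
  rw [← ENNReal.ofReal_sum_of_nonneg fun x _ => hf _ x]
  unfold avg
  rw [div_eq_inv_mul, ENNReal.ofReal_mul (by positivity), ENNReal.ofReal_inv_of_pos
    (Nat.cast_pos.2 Fintype.card_pos), ENNReal.ofReal_natCast]

end

section Execution

variable {n : ℕ} (N : Network n) (P : Rule n)

theorem Network.state_dependsOnFirst (t : ℕ) : DependsOnFirst t fun ω => N.state P ω t := by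
  induction t with
  | zero => intro ω ω' _; rfl
  | succ t ih =>
    intro ω ω' h
    have h1 : N.state P ω t = N.state P ω' t := ih ω ω' fun i hi => h i (by omega)
    simp only [Network.state, h1, h t (by omega)]

/-- The states at the beginning of round `t`, after idle nodes have chosen their messages. -/
def Network.loaded (ω : Draws n N.m) (t : ℕ) : Fin n → NodeState n :=
  fun v => N.load P v (N.state P ω t v)

theorem Network.loaded_dependsOnFirst (t : ℕ) : DependsOnFirst t fun ω => N.loaded P ω t :=
  (N.state_dependsOnFirst P t).comp fun s v => N.load P v (s v)

/-- The loaded states one round later. -/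
def Network.step (s : Fin n → NodeState n) (x : Fin n → Fin N.m × Fin N.m) :
    Fin n → NodeState n :=
  fun v => N.load P v (afterRound N.G s x v)

theorem Network.lintegral_step [NeZero N.m] (t : ℕ)
    (f : (Fin n → NodeState n) → (Fin n → Fin N.m × Fin N.m) → ℝ) (hf : ∀ s x, 0 ≤ f s x) :
    ∫⁻ ω, ENNReal.ofReal (f (N.loaded P ω t) (ω t)) ∂(drawMeasure n N.m) =
      ∫⁻ ω, ENNReal.ofReal (avg (f (N.loaded P ω t))) ∂(drawMeasure n N.m) :=
  lintegral_next t (N.loaded_dependsOnFirst P t) f hf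

instance [NeZero N.m] : IsProbabilityMeasure (drawMeasure n N.m) := by
  unfold drawMeasure
  infer_instance

end Execution

/-! ### The distributed rule -/

section Rule

variable {n : ℕ}

/-- The rumors in a list of messages. -/
def batchUnion (l : List (Msg n)) : Finset (Fin n) :=
  open Classical in Finset.univ.filter fun a => ∃ g ∈ l, a ∈ g.batch

theorem mem_batchUnion {l : List (Msg n)} {a : Fin n} :
    a ∈ batchUnion l ↔ ∃ g ∈ l, a ∈ g.batch := by
  classical
  simp [batchUnion]

theorem batchUnion_append (l : List (Msg n)) (g : Msg n) :
    batchUnion (l ++ [g]) = batchUnion l ∪ g.batch := by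
  ext a
  simp [mem_batchUnion, or_and_right, exists_or]

namespace NodeState

variable (s : NodeState n)

/-- The messages to the parent, the messages to the children, and the former without and with
the control bit, among the messages whose transmission has begun. -/
def ups : List (Msg n) := s.outbox.filter fun g => g.up
def downs : List (Msg n) := s.outbox.filter fun g => !g.up
def fulls : List (Msg n) := s.outbox.filter fun g => g.up && !g.flag
def finals : List (Msg n) := s.outbox.filter fun g => g.up && g.flag

/-- The last message to the parent has been sent. -/
def FinalSent : Prop := ∃ g ∈ s.outbox, g.up = true ∧ g.flag = true

/-- The message `g` has been received from `u`. -/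
def RecvFrom (u : Fin n) (g : Msg n) : Prop := ∃ r ∈ s.inbox, r u = some g

/-- The last message of the child `u` has been received. -/
def FinalReceived (u : Fin n) : Prop := ∃ g, s.RecvFrom u g ∧ g.up = true ∧ g.flag = true

end NodeState

theorem NodeState.received_iff {s : NodeState n} {g : Msg n} :
    s.Received g ↔ ∃ u, s.RecvFrom u g :=
  ⟨fun ⟨r, h1, u, h2⟩ => ⟨u, r, h1, h2⟩, fun ⟨u, r, h1, h2⟩ => ⟨r, h1, u, h2⟩⟩

theorem NodeState.length_ups (s : NodeState n) :
    s.ups.length = s.fulls.length + s.finals.length := by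
  unfold ups fulls finals
  induction s.outbox with
  | nil => rfl
  | cons g l ih => cases hu : g.up <;> cases hf : g.flag <;> simp [hu, hf] <;> omega

theorem exists_take (c : ℕ) (U : Finset (Fin n)) : ∃ b ⊆ U, b.card = min c U.card :=
  Finset.exists_subset_card_eq (min_le_right c U.card)

/-- Up to `c` elements of a set. -/
def take (c : ℕ) (U : Finset (Fin n)) : Finset (Fin n) := (exists_take c U).choose

theorem take_subset (c : ℕ) (U : Finset (Fin n)) : take c U ⊆ U := (exists_take c U).choose_spec.1

theorem card_take (c : ℕ) (U : Finset (Fin n)) : (take c U).card = min c U.card :=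
  (exists_take c U).choose_spec.2

open Classical in
/-- The rumors collected at a node, computed from its local view. -/
def LocalView.collected (L : LocalView n) (s : NodeState n) : Finset (Fin n) :=
  Finset.univ.filter fun a =>
    (a = L.self ∧ L.isSource) ∨ ∃ g, s.Received g ∧ g.up = true ∧ a ∈ g.batch

open Classical in
/-- The gossiping rule. A node sends full batches to its parent. Once the last messages of all
its children have arrived, it sends the rest, and marks its own last message. Then it forwards
what its parent sends. The root begins with its own messages in round `T`, or when it has
collected all rumors, whichever is later. -/
def gossipRule (T : LocalView n → ℕ) : Rule n := fun L s =>
  match L.parent with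
  | none =>
    if T L ≤ s.inbox.length ∧ L.numRumors ≤ (L.collected s).card ∧
        L.collected s \ batchUnion s.downs ≠ ∅ then
      some ⟨false, take L.c (L.collected s \ batchUnion s.downs), false⟩
    else none
  | some _ =>
    if s.FinalSent then
      if h : ∃ g, s.Received g ∧ g.up = false ∧ g ∉ s.outbox then some h.choose else none
    else
      if ∀ u ∈ L.children, s.FinalReceived u then
        if (L.collected s \ batchUnion s.ups).card ≤ L.c then
          some ⟨true, L.collected s \ batchUnion s.ups, true⟩
        else some ⟨true, take L.c (L.collected s \ batchUnion s.ups), false⟩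
      else
        if L.c ≤ (L.collected s \ batchUnion s.ups).card then
          some ⟨true, take L.c (L.collected s \ batchUnion s.ups), false⟩
        else none

variable (N : Network n) (T : LocalView n → ℕ) {v : Fin n} {s : NodeState n} {g : Msg n}

theorem Network.localView_collected (v : Fin n) (s : NodeState n) :
    (N.localView v).collected s = N.collected v s := by
  classical
  unfold LocalView.collected Network.collected
  congr!

theorem gossipRule_root (hv : v = N.B.root) :
    gossipRule T (N.localView v) s = some g ↔
      (T (N.localView v) ≤ s.inbox.length ∧ N.S.card ≤ (N.collected v s).card ∧
        N.collected v s \ batchUnion s.downs ≠ ∅) ∧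
      ⟨false, take N.c (N.collected v s \ batchUnion s.downs), false⟩ = g := by
  classical
  have hp : (N.localView v).parent = none := if_pos hv
  unfold gossipRule
  rw [hp]
  simp only [Network.localView_collected]
  have hL : (N.localView v).numRumors = N.S.card ∧ (N.localView v).c = N.c := ⟨rfl, rfl⟩
  rw [hL.1, hL.2]
  split_ifs with h
  · rw [Option.some_inj]
    exact ⟨fun h' => ⟨h, h'⟩, fun h' => h'.2⟩
  · exact ⟨fun h' => (by cases h'), fun h' => absurd h'.1 h⟩

theorem gossipRule_nonroot_down (hv : v ≠ N.B.root) (hf : s.FinalSent) :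
    gossipRule T (N.localView v) s =
      open Classical in
      if h : ∃ g, s.Received g ∧ g.up = false ∧ g ∉ s.outbox then some h.choose else none := by
  have hp : (N.localView v).parent = some (N.B.parent v) := if_neg hv
  unfold gossipRule
  rw [hp]
  simp only [hf, if_true]

theorem gossipRule_nonroot_up (hv : v ≠ N.B.root) (hf : ¬ s.FinalSent) :
    gossipRule T (N.localView v) s =
      open Classical in
      if ∀ u ∈ N.B.children v, s.FinalReceived u then
        if (N.collected v s \ batchUnion s.ups).card ≤ N.c then
          some ⟨true, N.collected v s \ batchUnion s.ups, true⟩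
        else some ⟨true, take N.c (N.collected v s \ batchUnion s.ups), false⟩
      else
        if N.c ≤ (N.collected v s \ batchUnion s.ups).card then
          some ⟨true, take N.c (N.collected v s \ batchUnion s.ups), false⟩
        else none := by
  have hp : (N.localView v).parent = some (N.B.parent v) := if_neg hv
  unfold gossipRule
  rw [hp]
  simp only [hf, if_false, Network.localView_collected]
  congr!

theorem gossipRule_nonroot_spec (hv : v ≠ N.B.root)
    (h : gossipRule T (N.localView v) s = some g) :
    (s.FinalSent ∧ g.up = false ∧ s.Received g ∧ g ∉ s.outbox) ∨
    (¬ s.FinalSent ∧ g.up = true ∧ g.batch ⊆ N.collected v s \ batchUnion s.ups ∧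
      ((g.flag = true ∧ (∀ u ∈ N.B.children v, s.FinalReceived u) ∧
        g.batch = N.collected v s \ batchUnion s.ups) ∨
       (g.flag = false ∧ g.batch.card = N.c ∧ ((∀ u ∈ N.B.children v, s.FinalReceived u) →
        N.c < (N.collected v s \ batchUnion s.ups).card)))) := by
  classical
  by_cases hf : s.FinalSent
  · left
    rw [gossipRule_nonroot_down N T hv hf] at h
    split_ifs at h with hex
    obtain rfl := Option.some.inj h
    exact ⟨hf, hex.choose_spec.2.1, hex.choose_spec.1, hex.choose_spec.2.2⟩
  · right
    rw [gossipRule_nonroot_up N T hv hf] at h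
    split_ifs at h with h1 h2 h2
    · obtain rfl := Option.some.inj h
      exact ⟨hf, rfl, subset_rfl, Or.inl ⟨rfl, h1, rfl⟩⟩
    · obtain rfl := Option.some.inj h
      refine ⟨hf, rfl, take_subset _ _, Or.inr ⟨rfl, ?_, fun _ => not_le.1 h2⟩⟩
      rw [card_take]
      omega
    · obtain rfl := Option.some.inj h
      refine ⟨hf, rfl, take_subset _ _, Or.inr ⟨rfl, ?_, fun h => absurd h h1⟩⟩
      rw [card_take]
      omega

/-- The state of a node that begins to transmit `g`. -/
def Network.push (v : Fin n) (s : NodeState n) (g : Msg n) : NodeState n :=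
  { s with job := some (g, N.receivers v g), outbox := s.outbox ++ [g] }

theorem Network.load_cases (P : Rule n) (v : Fin n) (s : NodeState n) :
    (N.load P v s = s ∧ (s.job = none → ∀ g, P (N.localView v) s = some g →
      ¬ N.Admissible v s g)) ∨
    ∃ g, s.job = none ∧ P (N.localView v) s = some g ∧ N.Admissible v s g ∧
      N.load P v s = N.push v s g := by
  unfold Network.load
  cases hj : s.job with
  | some j => exact Or.inl ⟨rfl, fun h => by cases h⟩
  | none =>
    cases hP : P (N.localView v) s with
    | none => exact Or.inl ⟨rfl, fun _ g h => by cases h⟩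
    | some g =>
      by_cases hA : N.Admissible v s g
      · right
        exact ⟨g, rfl, rfl, hA, by simp only [hA, if_true]; rfl⟩
      · left
        refine ⟨by simp only [hA, if_false], fun _ g' h => ?_⟩
        rw [← Option.some.inj h]
        exact hA

theorem Network.load_inbox (P : Rule n) (v : Fin n) (s : NodeState n) :
    (N.load P v s).inbox = s.inbox := by
  rcases N.load_cases P v s with ⟨h, _⟩ | ⟨g, _, _, _, h⟩ <;> rw [h]
  rfl

end Rule

/-! ### Invariants of the execution -/

section Invariants

variable {n : ℕ} {N : Network n}

theorem Backbone.mem_children {G : SimpleGraph (Fin n)} {B : Backbone G} {u v : Fin n} :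
    u ∈ B.children v ↔ u ≠ B.root ∧ B.parent u = v := by
  simp [Backbone.children]

theorem Network.mem_collected {v a : Fin n} {s : NodeState n} :
    a ∈ N.collected v s ↔ (a = v ∧ v ∈ N.S) ∨ ∃ u g, s.RecvFrom u g ∧ g.up = true ∧ a ∈ g.batch := by
  simp only [Network.collected, NodeState.received_iff, Finset.mem_filter, Finset.mem_univ,
    true_and]
  constructor
  · rintro (h | ⟨g, ⟨u, h1⟩, h2⟩)
    · exact Or.inl h
    · exact Or.inr ⟨u, g, h1, h2⟩
  · rintro (h | ⟨u, g, h1, h2⟩)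
    · exact Or.inl h
    · exact Or.inr ⟨g, ⟨u, h1⟩, h2⟩

theorem Network.receivers_up {v : Fin n} {g : Msg n} (hg : g.up = true) (hv : v ≠ N.B.root) :
    N.receivers v g = {N.B.parent v} := by
  simp [Network.receivers, hg, hv]

theorem Network.receivers_up_root {g : Msg n} (hg : g.up = true) :
    N.receivers N.B.root g = ∅ := by
  simp [Network.receivers, hg]

theorem Network.receivers_down {v : Fin n} {g : Msg n} (hg : g.up = false) :
    N.receivers v g = N.B.children v := by
  simp [Network.receivers, hg]

theorem NodeState.finalSent_iff {s : NodeState n} : s.FinalSent ↔ s.finals ≠ [] := by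
  constructor
  · rintro ⟨g, h1, h2, h3⟩
    exact List.ne_nil_of_mem (a := g) (by simp [NodeState.finals, h1, h2, h3])
  · intro h
    obtain ⟨g, hg⟩ := List.exists_mem_of_ne_nil _ h
    exact ⟨g, by simpa [NodeState.finals] using hg⟩

theorem NodeState.mem_ups {s : NodeState n} {g : Msg n} :
    g ∈ s.ups ↔ g ∈ s.outbox ∧ g.up = true := by simp [NodeState.ups]

theorem NodeState.mem_downs {s : NodeState n} {g : Msg n} :
    g ∈ s.downs ↔ g ∈ s.outbox ∧ g.up = false := by simp [NodeState.downs]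

theorem NodeState.mem_fulls {s : NodeState n} {g : Msg n} :
    g ∈ s.fulls ↔ g ∈ s.outbox ∧ g.up = true ∧ g.flag = false := by simp [NodeState.fulls]

theorem NodeState.mem_finals {s : NodeState n} {g : Msg n} :
    g ∈ s.finals ↔ g ∈ s.outbox ∧ g.up = true ∧ g.flag = true := by simp [NodeState.finals]

/-- The invariants of the states `s` of all nodes after `t` rounds, if the root does not begin to
send before round `T₀`. -/
structure Inv (N : Network n) (T₀ t : ℕ) (s : Fin n → NodeState n) : Prop where
  len : ∀ v, (s v).inbox.length = t
  job_mem : ∀ v g R, (s v).job = some (g, R) →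
    g ∈ (s v).outbox ∧ R ⊆ N.receivers v g ∧ R.Nonempty
  recv_mem : ∀ u v g, (s u).RecvFrom v g → g ∈ (s v).outbox ∧ u ∈ N.receivers v g
  sent : ∀ v g, g ∈ (s v).outbox → ∀ u ∈ N.receivers v g,
    (s u).RecvFrom v g ∨ ∃ R, (s v).job = some (g, R) ∧ u ∈ R
  root_up : (s N.B.root).ups = []
  down_final : ∀ v g, v ≠ N.B.root → g ∈ (s v).downs → (s v).FinalSent
  down_recv : ∀ v g, v ≠ N.B.root → g ∈ (s v).downs → (s v).RecvFrom (N.B.parent v) g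
  down_nodup : ∀ v, (s v).downs.Nodup
  down_len : ∀ v, (s v).downs.length ≤ N.S.card ⌈/⌉ N.c
  root_sub : batchUnion (s N.B.root).downs ⊆ N.S
  root_lo : min N.S.card (N.c * (s N.B.root).downs.length) ≤ (batchUnion (s N.B.root).downs).card
  root_hi : (batchUnion (s N.B.root).downs).card ≤ N.c * (s N.B.root).downs.length
  early : ∀ v g, g ∈ (s v).downs → T₀ ≤ t
  ups_sub : ∀ v, batchUnion (s v).ups ⊆ N.S
  fulls_lo : ∀ v, N.c * (s v).fulls.length ≤ (batchUnion (s v).fulls).card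
  ups_hi : ∀ v, (batchUnion (s v).ups).card ≤ N.c * (s v).ups.length
  finals_le : ∀ v, (s v).finals.length ≤ 1
  final_own : ∀ v, (s v).FinalSent → v ∈ N.S → v ∈ batchUnion (s v).ups
  final_child : ∀ v u, (s v).FinalSent → u ∈ N.B.children v →
    (s u).FinalSent ∧ batchUnion (s u).ups ⊆ batchUnion (s v).ups
  pending_final : ∀ v g R, (s v).FinalSent → (s v).job = some (g, R) → g.up = true →
    g.flag = true
  leaf : ∀ v, N.B.children v = ∅ → (s v).fulls = []
  batch_card : ∀ v g, g ∈ (s v).outbox → g.batch.card ≤ N.c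

theorem Inv.init (T₀ : ℕ) : Inv N T₀ 0 fun _ => { job := none, inbox := [], outbox := [] } where
  len _ := rfl
  job_mem _ _ _ h := by cases h
  recv_mem u v g h := by obtain ⟨r, hr, _⟩ := h; cases hr
  sent v g h := by cases h
  root_up := rfl
  down_final v g _ h := by cases h
  down_recv v g _ h := by cases h
  down_nodup v := List.nodup_nil
  down_len v := Nat.zero_le _
  root_sub a h := by obtain ⟨g, hg, _⟩ := mem_batchUnion.1 h; cases hg
  root_lo := by simp [NodeState.downs]
  root_hi := by simp [NodeState.downs, batchUnion]
  early v g h := by cases h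
  ups_sub v a h := by obtain ⟨g, hg, _⟩ := mem_batchUnion.1 h; cases hg
  fulls_lo v := by simp [NodeState.fulls]
  ups_hi v := by simp [NodeState.ups, batchUnion]
  finals_le v := by simp [NodeState.finals]
  final_own v h := by obtain ⟨g, hg, _⟩ := h; cases hg
  final_child v u h := by obtain ⟨g, hg, _⟩ := h; cases hg
  pending_final v g R h := by obtain ⟨g, hg, _⟩ := h; cases hg
  leaf v _ := rfl
  batch_card v g h := by cases h

/-! ### Effect of a round on jobs and inboxes -/

section AfterRound

variable {m : ℕ} {G : SimpleGraph (Fin n)} {s : Fin n → NodeState n}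
  {x : Fin n → Fin m × Fin m}

theorem afterRound_job {v : Fin n} {g : Msg n} {R' : Finset (Fin n)} :
    (afterRound G s x v).job = some (g, R') ↔
      ∃ R, (s v).job = some (g, R) ∧ remaining G s x v R = R' ∧ R'.Nonempty := by
  classical
  simp only [afterRound, Option.bind_eq_some_iff]
  constructor
  · rintro ⟨⟨g₁, R⟩, h1, h2⟩
    split_ifs at h2 with h
    obtain ⟨rfl, rfl⟩ := Prod.mk.inj (Option.some.inj h2)
    exact ⟨R, h1, rfl, Finset.nonempty_iff_ne_empty.2 h⟩
  · rintro ⟨R, h1, h2, h3⟩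
    refine ⟨(g, R), h1, ?_⟩
    dsimp only
    rw [h2, if_neg h3.ne_empty]

theorem afterRound_recv {u v : Fin n} {g : Msg n} :
    (afterRound G s x v).RecvFrom u g ↔
      (s v).RecvFrom u g ∨ (GotMessage G s x v u ∧ ∃ R, (s u).job = some (g, R)) := by
  classical
  simp only [NodeState.RecvFrom, afterRound, List.mem_append, List.mem_singleton]
  constructor
  · rintro ⟨r, hr | rfl, h⟩
    · exact Or.inl ⟨r, hr, h⟩
    · right
      dsimp only at h
      split_ifs at h with h1
      · obtain ⟨⟨g', R⟩, h2, h3⟩ := Option.map_eq_some_iff.1 h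
        obtain rfl : g' = g := h3
        exact ⟨h1, R, h2⟩
  · rintro (⟨r, hr, h⟩ | ⟨h1, R, h2⟩)
    · exact ⟨r, Or.inl hr, h⟩
    · exact ⟨_, Or.inr rfl, by simp [h1, h2]⟩

theorem mem_remaining {v u : Fin n} {R : Finset (Fin n)} :
    u ∈ remaining G s x v R ↔ u ∈ R ∧ ¬ GotAck G s x v u := by
  classical
  simp [remaining]

end AfterRound

/-- A round changes only jobs and inboxes, so the invariants of the outboxes persist. A receiver
leaves a list only through an acknowledgment, and this presupposes that it got the message in the
same round. -/
theorem Inv.afterRound {T₀ t : ℕ} {s : Fin n → NodeState n} (h : Inv N T₀ t s)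
    (x : Fin n → Fin N.m × Fin N.m) : Inv N T₀ (t + 1) (afterRound N.G s x) where
  len v := by
    have := h.len v
    simp [MultiBroadcast.afterRound, this]
  job_mem v g R' hj := by
    obtain ⟨R, h1, h2, h3⟩ := afterRound_job.1 hj
    obtain ⟨h4, h5, _⟩ := h.job_mem v g R h1
    refine ⟨h4, fun u hu => h5 ?_, h3⟩
    rw [← h2] at hu
    exact (mem_remaining.1 hu).1
  recv_mem u v g hr := by
    rcases afterRound_recv.1 hr with hr | ⟨hm, R, hj⟩
    · exact h.recv_mem u v g hr
    · obtain ⟨g', R', hj', hu⟩ := hm.job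
      rw [hj] at hj'
      obtain ⟨rfl, rfl⟩ := Prod.mk.inj (Option.some.inj hj')
      obtain ⟨h1, h2, _⟩ := h.job_mem v g R hj
      exact ⟨h1, h2 hu⟩
  sent v g hg u hu := by
    rcases h.sent v g hg u hu with hr | ⟨R, hj, huR⟩
    · exact Or.inl (afterRound_recv.2 (Or.inl hr))
    · by_cases ha : GotAck N.G s x v u
      · exact Or.inl (afterRound_recv.2 (Or.inr ⟨ha.1, R, hj⟩))
      · have hmem : u ∈ remaining N.G s x v R := mem_remaining.2 ⟨huR, ha⟩
        exact Or.inr ⟨_, afterRound_job.2 ⟨R, hj, rfl, u, hmem⟩, hmem⟩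
  root_up := h.root_up
  down_final := h.down_final
  down_recv v g hv hg := afterRound_recv.2 (Or.inl (h.down_recv v g hv hg))
  down_nodup := h.down_nodup
  down_len := h.down_len
  root_sub := h.root_sub
  root_lo := h.root_lo
  root_hi := h.root_hi
  early v g hg := (h.early v g hg).trans (Nat.le_succ t)
  ups_sub := h.ups_sub
  fulls_lo := h.fulls_lo
  ups_hi := h.ups_hi
  finals_le := h.finals_le
  final_own := h.final_own
  final_child := h.final_child
  pending_final v g R' hf hj hg := by
    obtain ⟨R, h1, _⟩ := afterRound_job.1 hj
    exact h.pending_final v g R hf h1 hg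
  leaf := h.leaf
  batch_card := h.batch_card

/-! ### Effect of a new message on the outbox -/

section Push

variable {v : Fin n} {s : NodeState n} {g : Msg n}

theorem push_ups : (N.push v s g).ups = if g.up then s.ups ++ [g] else s.ups := by
  cases h : g.up <;> simp [Network.push, NodeState.ups, h]

theorem push_downs : (N.push v s g).downs = if g.up then s.downs else s.downs ++ [g] := by
  cases h : g.up <;> simp [Network.push, NodeState.downs, h]

theorem push_fulls :
    (N.push v s g).fulls = if g.up && !g.flag then s.fulls ++ [g] else s.fulls := by
  cases h : g.up <;> cases h' : g.flag <;> simp [Network.push, NodeState.fulls, h, h']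

theorem push_finals :
    (N.push v s g).finals = if g.up && g.flag then s.finals ++ [g] else s.finals := by
  cases h : g.up <;> cases h' : g.flag <;> simp [Network.push, NodeState.finals, h, h']

end Push

theorem Inv.finals_unique {T₀ t : ℕ} {s : Fin n → NodeState n} (h : Inv N T₀ t s) {v : Fin n}
    {g g' : Msg n} (hg : g ∈ (s v).finals) (hg' : g' ∈ (s v).finals) :
    g = g' := by
  have := h.finals_le v
  match hl : (s v).finals, this with
  | [], _ => rw [hl] at hg; cases hg
  | [a], _ =>
    rw [hl, List.mem_singleton] at hg hg'
    rw [hg, hg']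

/-- Once the last message of a child has arrived, all its messages have arrived. -/
theorem Inv.recv_of_final {T₀ t : ℕ} {s : Fin n → NodeState n} (h : Inv N T₀ t s) {u v : Fin n}
    (hu : u ∈ N.B.children v) (hf : (s v).FinalReceived u) {g : Msg n} (hg : g ∈ (s u).ups) :
    (s v).RecvFrom u g := by
  obtain ⟨hur, hup⟩ := Backbone.mem_children.1 hu
  obtain ⟨f, hfr, hf1, hf2⟩ := hf
  obtain ⟨hfo, _⟩ := h.recv_mem v u f hfr
  have hfs : (s u).FinalSent := ⟨f, hfo, hf1, hf2⟩
  obtain ⟨hgo, hgu⟩ := NodeState.mem_ups.1 hg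
  have hv : v ∈ N.receivers u g := by
    rw [Network.receivers_up hgu hur, hup]
    exact Finset.mem_singleton_self v
  rcases h.sent u g hgo v hv with h1 | ⟨R, hj, _⟩
  · exact h1
  · have hgf := h.pending_final u g R hfs hj hgu
    rwa [h.finals_unique (NodeState.mem_finals.2 ⟨hgo, hgu, hgf⟩)
      (NodeState.mem_finals.2 ⟨hfo, hf1, hf2⟩)]

theorem Inv.ups_subset_collected {T₀ t : ℕ} {s : Fin n → NodeState n} (h : Inv N T₀ t s)
    {u v : Fin n} (hu : u ∈ N.B.children v) (hf : (s v).FinalReceived u) :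
    batchUnion (s u).ups ⊆ N.collected v (s v) := by
  intro a ha
  obtain ⟨g, hg, hag⟩ := mem_batchUnion.1 ha
  exact Network.mem_collected.2 (Or.inr ⟨u, g, h.recv_of_final hu hf hg,
    (NodeState.mem_ups.1 hg).2, hag⟩)

theorem Inv.collected_subset {T₀ t : ℕ} {s : Fin n → NodeState n} (h : Inv N T₀ t s) (v : Fin n) :
    N.collected v (s v) ⊆ N.S := by
  intro a ha
  rcases Network.mem_collected.1 ha with ⟨rfl, h1⟩ | ⟨u, g, hr, hg, hag⟩
  · exact h1
  · exact h.ups_sub u (mem_batchUnion.2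
      ⟨g, NodeState.mem_ups.2 ⟨(h.recv_mem v u g hr).1, hg⟩, hag⟩)

theorem Inv.child_of_recv_up {T₀ t : ℕ} {s : Fin n → NodeState n} (h : Inv N T₀ t s) {u v : Fin n}
    {g : Msg n} (hr : (s v).RecvFrom u g) (hg : g.up = true) : u ∈ N.B.children v := by
  have h1 := (h.recv_mem v u g hr).2
  by_cases hu : u = N.B.root
  · rw [hu, Network.receivers_up_root hg] at h1
    cases h1
  · rw [Network.receivers_up hg hu, Finset.mem_singleton] at h1
    exact Backbone.mem_children.2 ⟨hu, h1.symm⟩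

theorem Inv.parent_of_recv_down {T₀ t : ℕ} {s : Fin n → NodeState n} (h : Inv N T₀ t s)
    {u v : Fin n} {g : Msg n} (hr : (s v).RecvFrom u g) (hg : g.up = false) :
    v ≠ N.B.root ∧ u = N.B.parent v := by
  have h1 := (h.recv_mem v u g hr).2
  rw [Network.receivers_down hg] at h1
  obtain ⟨h2, h3⟩ := Backbone.mem_children.1 h1
  exact ⟨h2, h3.symm⟩

theorem fulls_subset_ups (s : NodeState n) : batchUnion s.fulls ⊆ batchUnion s.ups := by
  intro a ha
  obtain ⟨g, hg, hag⟩ := mem_batchUnion.1 ha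
  obtain ⟨h1, h2, _⟩ := NodeState.mem_fulls.1 hg
  exact mem_batchUnion.2 ⟨g, NodeState.mem_ups.2 ⟨h1, h2⟩, hag⟩

/-- The ways in which an idle node begins to transmit. -/
inductive Begins (N : Network n) (T : LocalView n → ℕ) (v : Fin n) (s : NodeState n) :
    Msg n → Prop
  | root (hv : v = N.B.root) (hT : T (N.localView v) ≤ s.inbox.length)
      (hS : N.S ⊆ N.collected v s) (hU : N.collected v s \ batchUnion s.downs ≠ ∅) :
      Begins N T v s ⟨false, take N.c (N.collected v s \ batchUnion s.downs), false⟩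
  | forward (g : Msg n) (hv : v ≠ N.B.root) (hf : s.FinalSent) (hg : g.up = false)
      (hr : s.Received g) (hn : g ∉ s.outbox) : Begins N T v s g
  | last (hv : v ≠ N.B.root) (hf : ¬ s.FinalSent)
      (hc : ∀ u ∈ N.B.children v, s.FinalReceived u) :
      Begins N T v s ⟨true, N.collected v s \ batchUnion s.ups, true⟩
  | full (b : Finset (Fin n)) (hv : v ≠ N.B.root) (hf : ¬ s.FinalSent)
      (hb : b ⊆ N.collected v s \ batchUnion s.ups) (hcard : b.card = N.c)
      (hc : (∀ u ∈ N.B.children v, s.FinalReceived u) →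
        N.c < (N.collected v s \ batchUnion s.ups).card) : Begins N T v s ⟨true, b, false⟩

theorem Network.load_begins (T : LocalView n → ℕ) (v : Fin n) (s : NodeState n) :
    N.load (gossipRule T) v s = s ∨
    ∃ g, s.job = none ∧ (g.up = false → s.downs.length < N.S.card ⌈/⌉ N.c) ∧
      g.batch.card ≤ N.c ∧ Begins N T v s g ∧ N.load (gossipRule T) v s = N.push v s g := by
  rcases N.load_cases (gossipRule T) v s with ⟨h, _⟩ | ⟨g, h1, h2, h3, h4⟩
  · exact Or.inl h
  · refine Or.inr ⟨g, h1, fun hg => ?_, h3.2.1, ?_, h4⟩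
    · have := h3.2.2
      rw [hg] at this
      simp only [Bool.false_eq_true, if_false] at this
      exact this.1
    · by_cases hv : v = N.B.root
      · obtain ⟨⟨hT, _, hU⟩, rfl⟩ := (gossipRule_root N T hv).1 h2
        have := h3.2.2
        simp only [Bool.false_eq_true, if_false, hv, if_true] at this
        exact .root hv hT (by rw [hv]; exact this.2.1) hU
      · obtain ⟨u, b, f⟩ := g
        rcases gossipRule_nonroot_spec N T hv h2 with ⟨hf, hg, hr, hn⟩ | ⟨hf, hg, hb, h⟩
        · exact .forward _ hv hf hg hr hn
        · simp only at hg hb h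
          subst hg
          rcases h with ⟨rfl, hc, rfl⟩ | ⟨rfl, hcard, hc⟩
          · exact .last hv hf hc
          · exact .full b hv hf hb hcard hc

theorem NodeState.push_finalSent {v : Fin n} {s : NodeState n} {g : Msg n} (h : s.FinalSent) :
    (N.push v s g).FinalSent := by
  obtain ⟨f, h1, h2⟩ := h
  exact ⟨f, List.mem_append_left _ h1, h2⟩

theorem card_union_take (S D : Finset (Fin n)) (c l : ℕ) (hD : D ⊆ S)
    (h : min S.card (c * l) ≤ D.card) : min S.card (c * (l + 1)) ≤ (D ∪ take c (S \ D)).card := by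
  rw [Finset.card_union_of_disjoint (Finset.disjoint_of_subset_right (take_subset _ _)
    Finset.disjoint_sdiff), card_take, Finset.card_sdiff_of_subset hD]
  have := Finset.card_le_card hD
  rw [mul_add, mul_one]
  omega

-- A case distinction over `Begins`. The content lies in the following: full batches consist of
-- rumors not sent before, so they are disjoint; a last message is sent only after those of all
-- children, so it completes what the children have sent; each message of the root carries a new
-- rumor, so the forwarded messages are distinct.
set_option maxHeartbeats 1000000 in
theorem Inv.load {T : LocalView n → ℕ} {t : ℕ} {s : Fin n → NodeState n} (hc : 1 ≤ N.c)
    (h : Inv N (T (N.localView N.B.root)) t s) :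
    Inv N (T (N.localView N.B.root)) t fun v => N.load (gossipRule T) v (s v) := by
  have hinb : ∀ v, (N.load (gossipRule T) v (s v)).inbox = (s v).inbox := fun v =>
    N.load_inbox _ v _
  have hrecv : ∀ u v g, (N.load (gossipRule T) u (s u)).RecvFrom v g ↔ (s u).RecvFrom v g := by
    intro u v g
    unfold NodeState.RecvFrom
    rw [hinb]
  have hout : ∀ v g, g ∈ (s v).outbox → g ∈ (N.load (gossipRule T) v (s v)).outbox := by
    intro v g hg
    rcases N.load_begins T v (s v) with he | ⟨g', _, _, _, _, he⟩ <;> rw [he]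
    · exact hg
    · exact List.mem_append_left _ hg
  have hfin : ∀ v, (s v).FinalSent → (N.load (gossipRule T) v (s v)).FinalSent ∧
      (N.load (gossipRule T) v (s v)).ups = (s v).ups := by
    intro v hf
    rcases N.load_begins T v (s v) with he | ⟨g', _, _, _, hb, he⟩ <;> rw [he]
    · exact ⟨hf, rfl⟩
    · refine ⟨NodeState.push_finalSent hf, ?_⟩
      rw [push_ups]
      cases hb with
      | root => rfl
      | forward _ _ _ hg => simp [hg]
      | last _ hf' => exact absurd hf hf'
      | full _ _ hf' => exact absurd hf hf'
  refine
  { len := fun v => by rw [hinb]; exact h.len v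
    job_mem := ?_
    recv_mem := fun u v g hr => ?_
    sent := ?_
    root_up := ?_
    down_final := ?_
    down_recv := ?_
    down_nodup := ?_
    down_len := ?_
    root_sub := ?_
    root_lo := ?_
    root_hi := ?_
    early := ?_
    ups_sub := ?_
    fulls_lo := ?_
    ups_hi := ?_
    finals_le := ?_
    final_own := ?_
    final_child := ?_
    pending_final := ?_
    leaf := ?_
    batch_card := ?_ }
  · intro v g R hj
    rcases N.load_cases (gossipRule T) v (s v) with ⟨he, _⟩ | ⟨g', _, _, hA, he⟩ <;>
      rw [he] at hj ⊢
    · exact h.job_mem v g R hj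
    · obtain ⟨rfl, rfl⟩ := Prod.mk.inj (Option.some.inj hj)
      exact ⟨by simp [Network.push], subset_rfl, hA.1⟩
  · rw [hrecv] at hr
    obtain ⟨h1, h2⟩ := h.recv_mem u v g hr
    exact ⟨hout v g h1, h2⟩
  · intro v g hg u hu
    rw [hrecv]
    rcases N.load_begins T v (s v) with he | ⟨g', hj, _, _, _, he⟩ <;> rw [he] at hg ⊢
    · exact h.sent v g hg u hu
    · rcases List.mem_append.1 hg with hg | hg
      · rcases h.sent v g hg u hu with h1 | ⟨R, h1, _⟩
        · exact Or.inl h1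
        · rw [hj] at h1
          cases h1
      · obtain rfl := List.mem_singleton.1 hg
        exact Or.inr ⟨_, rfl, hu⟩
  · rcases N.load_begins T N.B.root (s N.B.root) with he | ⟨g', _, _, _, hb, he⟩ <;> rw [he]
    · exact h.root_up
    · rw [push_ups]
      cases hb with
      | root => exact h.root_up
      | forward _ hv => exact absurd rfl hv
      | last hv => exact absurd rfl hv
      | full _ hv => exact absurd rfl hv
  · intro v g hv hg
    rcases N.load_begins T v (s v) with he | ⟨g', _, _, _, hb, he⟩ <;> rw [he] at hg ⊢
    · exact h.down_final v g hv hg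
    · rw [push_downs] at hg
      cases hb with
      | root hv' => exact absurd hv' hv
      | forward _ _ hf => exact NodeState.push_finalSent hf
      | last => exact NodeState.push_finalSent (h.down_final v g hv hg)
      | full => exact NodeState.push_finalSent (h.down_final v g hv hg)
  · intro v g hv hg
    rw [hrecv]
    rcases N.load_begins T v (s v) with he | ⟨g', _, _, _, hb, he⟩ <;> rw [he] at hg
    · exact h.down_recv v g hv hg
    · rw [push_downs] at hg
      cases hb with
      | root hv' => exact absurd hv' hv
      | forward _ _ _ hg' hr =>
        simp only [hg', Bool.false_eq_true, if_false, List.mem_append, List.mem_singleton] at hg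
        rcases hg with hg | rfl
        · exact h.down_recv v g hv hg
        · obtain ⟨u, hu⟩ := NodeState.received_iff.1 hr
          obtain ⟨_, rfl⟩ := h.parent_of_recv_down hu hg'
          exact hu
      | last => exact h.down_recv v g hv hg
      | full => exact h.down_recv v g hv hg
  -- The root repeats no message because its batch is non-empty and avoids all former batches; this
  -- uses `1 ≤ c`.
  · intro v
    rcases N.load_begins T v (s v) with he | ⟨g', _, hl, _, hb, he⟩ <;> rw [he]
    · exact h.down_nodup v
    · rw [push_downs]
      have hadd : ∀ g, g ∉ (s v).downs → ((s v).downs ++ [g]).Nodup := by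
        intro g hg
        rw [List.nodup_append]
        refine ⟨h.down_nodup v, List.nodup_singleton _, ?_⟩
        rintro a ha b hb rfl
        exact hg (List.mem_singleton.1 hb ▸ ha)
      cases hb with
      | root hv _ _ hU =>
        refine hadd _ fun hmem => ?_
        have h0 : 0 < (take N.c (N.collected v (s v) \ batchUnion (s v).downs)).card := by
          rw [card_take]
          have := Finset.card_pos.2 (Finset.nonempty_iff_ne_empty.2 hU)
          omega
        obtain ⟨a, ha⟩ := Finset.card_pos.1 h0
        exact (Finset.mem_sdiff.1 (take_subset _ _ ha)).2 (mem_batchUnion.2 ⟨_, hmem, ha⟩)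
      | forward _ _ _ hg' _ hn =>
        simp only [hg', Bool.false_eq_true, if_false]
        exact hadd _ fun hmem => hn (NodeState.mem_downs.1 hmem).1
      | last => exact h.down_nodup v
      | full => exact h.down_nodup v
  · intro v
    rcases N.load_begins T v (s v) with he | ⟨g', _, hl, _, hb, he⟩ <;> rw [he]
    · exact h.down_len v
    · rw [push_downs]
      cases hg : g'.up with
      | true => exact h.down_len v
      | false =>
        simp only [Bool.false_eq_true, if_false, List.length_append, List.length_singleton]
        exact hl hg
  · rcases N.load_begins T N.B.root (s N.B.root) with he | ⟨g', _, hl, _, hb, he⟩ <;> rw [he]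
    · exact h.root_sub
    · rw [push_downs]
      cases hb with
      | root =>
        simp only [Bool.false_eq_true, if_false, batchUnion_append]
        refine Finset.union_subset h.root_sub ((take_subset _ _).trans ?_)
        exact Finset.sdiff_subset.trans (h.collected_subset _)
      | forward _ hv => exact absurd rfl hv
      | last hv => exact absurd rfl hv
      | full _ hv => exact absurd rfl hv
  · rcases N.load_begins T N.B.root (s N.B.root) with he | ⟨g', _, hl, _, hb, he⟩ <;> rw [he]
    · exact h.root_lo
    · rw [push_downs]
      cases hb with
      | root _ _ hS =>
        have hcS : N.collected N.B.root (s N.B.root) = N.S :=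
          (h.collected_subset _).antisymm hS
        simp only [Bool.false_eq_true, if_false, batchUnion_append, List.length_append,
          List.length_singleton, hcS]
        exact card_union_take _ _ _ _ h.root_sub h.root_lo
      | forward _ hv => exact absurd rfl hv
      | last hv => exact absurd rfl hv
      | full _ hv => exact absurd rfl hv
  · rcases N.load_begins T N.B.root (s N.B.root) with he | ⟨g', _, hl, hcard, hb, he⟩ <;> rw [he]
    · exact h.root_hi
    · rw [push_downs]
      cases hb with
      | root _ _ hS =>
        simp only [Bool.false_eq_true, if_false, batchUnion_append, List.length_append,
          List.length_singleton]
        have := Finset.card_union_le (batchUnion (s N.B.root).downs) (take N.c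
          (N.collected N.B.root (s N.B.root) \ batchUnion (s N.B.root).downs))
        have := h.root_hi
        simp only at hcard
        rw [mul_add, mul_one]
        omega
      | forward _ hv => exact absurd rfl hv
      | last hv => exact absurd rfl hv
      | full _ hv => exact absurd rfl hv
  · intro v g hg
    rcases N.load_begins T v (s v) with he | ⟨g', _, _, _, hb, he⟩ <;> rw [he] at hg
    · exact h.early v g hg
    · rw [push_downs] at hg
      cases hb with
      | root hv hT =>
        rw [h.len, hv] at hT
        exact hT
      | forward _ _ _ hg' hr =>
        simp only [hg', Bool.false_eq_true, if_false, List.mem_append, List.mem_singleton] at hg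
        rcases hg with hg | rfl
        · exact h.early v g hg
        · obtain ⟨u, hu⟩ := NodeState.received_iff.1 hr
          exact h.early u g (NodeState.mem_downs.2 ⟨(h.recv_mem _ _ _ hu).1, hg'⟩)
      | last => exact h.early v g hg
      | full => exact h.early v g hg
  · intro v
    rcases N.load_begins T v (s v) with he | ⟨g', _, _, _, hb, he⟩ <;> rw [he]
    · exact h.ups_sub v
    · rw [push_ups]
      cases hb with
      | root => exact h.ups_sub v
      | forward _ _ _ hg' => simp only [hg', Bool.false_eq_true, if_false]; exact h.ups_sub v
      | last =>
        simp only [if_true, batchUnion_append]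
        exact Finset.union_subset (h.ups_sub v) (Finset.sdiff_subset.trans (h.collected_subset v))
      | full b _ _ hb =>
        simp only [if_true, batchUnion_append]
        exact Finset.union_subset (h.ups_sub v)
          (hb.trans (Finset.sdiff_subset.trans (h.collected_subset v)))
  · intro v
    rcases N.load_begins T v (s v) with he | ⟨g', _, _, _, hb, he⟩ <;> rw [he]
    · exact h.fulls_lo v
    · rw [push_fulls]
      cases hb with
      | root => exact h.fulls_lo v
      | forward _ _ _ hg' => simp only [hg', Bool.false_and, Bool.false_eq_true, if_false]; exact h.fulls_lo v
      | last => exact h.fulls_lo v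
      | full b _ _ hb hcard =>
        simp only [Bool.not_false, Bool.and_true, if_true, batchUnion_append, List.length_append,
          List.length_singleton]
        rw [Finset.card_union_of_disjoint, hcard, mul_add, mul_one]
        · exact Nat.add_le_add_right (h.fulls_lo v) _
        · exact Finset.disjoint_of_subset_left (fulls_subset_ups _)
            (Finset.disjoint_of_subset_right hb Finset.disjoint_sdiff)
  · intro v
    rcases N.load_begins T v (s v) with he | ⟨g', _, _, hcard, hb, he⟩ <;> rw [he]
    · exact h.ups_hi v
    · rw [push_ups]
      cases hg : g'.up with
      | false => exact h.ups_hi v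
      | true =>
        simp only [if_true, batchUnion_append, List.length_append, List.length_singleton]
        have := Finset.card_union_le (batchUnion (s v).ups) g'.batch
        have := h.ups_hi v
        rw [mul_add, mul_one]
        omega
  · intro v
    rcases N.load_begins T v (s v) with he | ⟨g', _, _, _, hb, he⟩ <;> rw [he]
    · exact h.finals_le v
    · rw [push_finals]
      cases hb with
      | root => exact h.finals_le v
      | forward _ _ _ hg' => simp only [hg', Bool.false_and, Bool.false_eq_true, if_false]; exact h.finals_le v
      | last _ hf =>
        rw [NodeState.finalSent_iff, not_not] at hf
        simp [hf]
      | full => exact h.finals_le v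
  · intro v hf hvS
    by_cases hf0 : (s v).FinalSent
    · rw [(hfin v hf0).2]
      exact h.final_own v hf0 hvS
    · rcases N.load_begins T v (s v) with he | ⟨g', _, _, _, hb, he⟩ <;> rw [he] at hf ⊢
      · exact h.final_own v hf hvS
      · rw [NodeState.finalSent_iff] at hf hf0
        rw [push_finals] at hf
        rw [push_ups]
        cases hb with
        | root => exact absurd hf hf0
        | forward _ _ hf1 => exact absurd (NodeState.finalSent_iff.1 hf1) hf0
        | last =>
          simp only [if_true, batchUnion_append, Finset.union_sdiff_self_eq_union]
          exact Finset.mem_union_right _ (Network.mem_collected.2 (Or.inl ⟨rfl, hvS⟩))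
        | full => exact absurd hf hf0
  · intro v u hf hu
    by_cases hf0 : (s v).FinalSent
    · obtain ⟨h1, h2⟩ := h.final_child v u hf0 hu
      obtain ⟨h3, h4⟩ := hfin u h1
      rw [(hfin v hf0).2, h4]
      exact ⟨h3, h2⟩
    · rcases N.load_begins T v (s v) with he | ⟨g', _, _, _, hb, he⟩
      · rw [he] at hf
        exact absurd hf hf0
      · rw [he] at hf ⊢
        rw [NodeState.finalSent_iff] at hf hf0
        rw [push_finals] at hf
        rw [push_ups]
        cases hb with
        | root => exact absurd hf hf0
        | forward _ _ hf1 => exact absurd (NodeState.finalSent_iff.1 hf1) hf0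
        | last _ _ hch =>
          simp only [if_true, batchUnion_append, Finset.union_sdiff_self_eq_union]
          have hr := hch u hu
          obtain ⟨f, hr1, hf1, hf2⟩ := id hr
          have hfu : (s u).FinalSent := ⟨f, (h.recv_mem v u f hr1).1, hf1, hf2⟩
          obtain ⟨h3, h4⟩ := hfin u hfu
          rw [h4]
          exact ⟨h3, (h.ups_subset_collected hu hr).trans Finset.subset_union_right⟩
        | full => exact absurd hf hf0
  · intro v g R hf hj hg
    rcases N.load_begins T v (s v) with he | ⟨g', _, _, _, hb, he⟩ <;> rw [he] at hf hj
    · exact h.pending_final v g R hf hj hg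
    · obtain ⟨rfl, _⟩ := Prod.mk.inj (Option.some.inj hj)
      rw [NodeState.finalSent_iff, push_finals] at hf
      cases hb with
      | root => cases hg
      | forward _ _ _ hg' => rw [hg] at hg'; cases hg'
      | last => rfl
      | full _ _ hf0 => exact absurd (NodeState.finalSent_iff.2 hf) hf0
  · intro v hch
    rcases N.load_begins T v (s v) with he | ⟨g', _, _, _, hb, he⟩ <;> rw [he]
    · exact h.leaf v hch
    · rw [push_fulls]
      cases hb with
      | root => exact h.leaf v hch
      | forward _ _ _ hg' => simp only [hg', Bool.false_and, Bool.false_eq_true, if_false]; exact h.leaf v hch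
      | last => exact h.leaf v hch
      -- A leaf has at most one rumor, and `1 ≤ c`, so the rule sends this rumor with its last
      -- message and never as a full batch.
      | full _ _ _ _ _ hall =>
        exfalso
        have h1 := hall (by rw [hch]; simp)
        have h2 : N.collected v (s v) \ batchUnion (s v).ups ⊆ {v} := by
          intro a ha
          rcases Network.mem_collected.1 (Finset.mem_sdiff.1 ha).1 with ⟨rfl, _⟩ | ⟨u, g, hr, hg, _⟩
          · exact Finset.mem_singleton_self _
          · have := h.child_of_recv_up hr hg
            rw [hch] at this
            cases this
        have h3 := Finset.card_le_card h2
        rw [Finset.card_singleton] at h3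
        omega
  · intro v g hg
    rcases N.load_begins T v (s v) with he | ⟨g', _, _, hcard, _, he⟩ <;> rw [he] at hg
    · exact h.batch_card v g hg
    · rcases List.mem_append.1 hg with hg | hg
      · exact h.batch_card v g hg
      · rwa [List.mem_singleton.1 hg]

theorem Network.inv_state {T : LocalView n → ℕ} (hc : 1 ≤ N.c) (ω : Draws n N.m) (t : ℕ) :
    Inv N (T (N.localView N.B.root)) t (N.state (gossipRule T) ω t) := by
  induction t with
  | zero => exact Inv.init _
  | succ t ih => exact (ih.load hc).afterRound (ω t)

theorem Network.inv_loaded {T : LocalView n → ℕ} (hc : 1 ≤ N.c) (ω : Draws n N.m) (t : ℕ) :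
    Inv N (T (N.localView N.B.root)) t (N.loaded (gossipRule T) ω t) :=
  (N.inv_state hc ω t).load hc

end Invariants

/-! ### Progress of the execution -/

section Progress

variable {n : ℕ} {N : Network n}

namespace NodeState

/-- A message to the parent is pending. -/
def UpBusy (s : NodeState n) : Prop := ∃ g R, s.job = some (g, R) ∧ g.up = true

/-- A message to the children is pending that `u` has not acknowledged. -/
def Waits (s : NodeState n) (u : Fin n) : Prop :=
  ∃ g R, s.job = some (g, R) ∧ g.up = false ∧ u ∈ R

/-- All messages to the parent have been sent and acknowledged. -/
def Finished (s : NodeState n) : Prop := s.FinalSent ∧ ¬ s.UpBusy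

open Classical in
/-- The number of messages to the parent that have been acknowledged. -/
def upCount (s : NodeState n) : ℕ := s.ups.length - if s.UpBusy then 1 else 0

open Classical in
/-- The number of messages to the children that `u` has acknowledged. -/
def downCount (s : NodeState n) (u : Fin n) : ℕ := s.downs.length - if s.Waits u then 1 else 0

theorem UpBusy.one_le {T₀ t : ℕ} {s : Fin n → NodeState n} (h : Inv N T₀ t s) {v : Fin n}
    (hb : (s v).UpBusy) : 1 ≤ (s v).ups.length := by
  obtain ⟨g, R, hj, hg⟩ := hb
  exact List.length_pos_of_mem (NodeState.mem_ups.2 ⟨(h.job_mem v g R hj).1, hg⟩)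

theorem Waits.one_le {T₀ t : ℕ} {s : Fin n → NodeState n} (h : Inv N T₀ t s) {v u : Fin n}
    (hb : (s v).Waits u) : 1 ≤ (s v).downs.length := by
  obtain ⟨g, R, hj, hg, _⟩ := hb
  exact List.length_pos_of_mem (NodeState.mem_downs.2 ⟨(h.job_mem v g R hj).1, hg⟩)

theorem upCount_of_not_busy {s : NodeState n} (h : ¬ s.UpBusy) : s.upCount = s.ups.length := by
  simp [upCount, h]

theorem upCount_of_busy {s : NodeState n} (h : s.UpBusy) : s.upCount = s.ups.length - 1 := by
  simp [upCount, h]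

theorem downCount_of_not_waits {s : NodeState n} {u : Fin n} (h : ¬ s.Waits u) :
    s.downCount u = s.downs.length := by
  simp [downCount, h]

theorem downCount_of_waits {s : NodeState n} {u : Fin n} (h : s.Waits u) :
    s.downCount u = s.downs.length - 1 := by
  simp [downCount, h]

theorem not_upBusy_of_none {s : NodeState n} (h : s.job = none) : ¬ s.UpBusy := by
  rintro ⟨g, R, hj, _⟩
  rw [h] at hj
  cases hj

theorem not_waits_of_none {s : NodeState n} (h : s.job = none) (u : Fin n) : ¬ s.Waits u := by
  rintro ⟨g, R, hj, _⟩
  rw [h] at hj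
  cases hj

end NodeState

theorem push_upBusy {v : Fin n} {s : NodeState n} {g : Msg n} :
    (N.push v s g).UpBusy ↔ g.up = true := by
  constructor
  · rintro ⟨g', R, hj, hg⟩
    obtain ⟨rfl, _⟩ := Prod.mk.inj (Option.some.inj hj)
    exact hg
  · exact fun hg => ⟨g, _, rfl, hg⟩

theorem push_waits {v u : Fin n} {s : NodeState n} {g : Msg n} :
    (N.push v s g).Waits u ↔ g.up = false ∧ u ∈ N.receivers v g := by
  constructor
  · rintro ⟨g', R, hj, hg, hu⟩
    obtain ⟨rfl, rfl⟩ := Prod.mk.inj (Option.some.inj hj)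
    exact ⟨hg, hu⟩
  · exact fun ⟨hg, hu⟩ => ⟨g, _, rfl, hg, hu⟩

/-- A newly begun message is counted as sent and as pending at once, so the number of acknowledged
ones stays the same. -/
theorem upCount_load (T : LocalView n → ℕ) (v : Fin n) (s : NodeState n) :
    (N.load (gossipRule T) v s).upCount = s.upCount := by
  rcases N.load_cases (gossipRule T) v s with ⟨he, _⟩ | ⟨g, hj, _, _, he⟩ <;> rw [he]
  have h0 := NodeState.upCount_of_not_busy (NodeState.not_upBusy_of_none hj)
  cases hg : g.up with
  | true =>
    rw [h0, NodeState.upCount_of_busy (push_upBusy.2 hg), push_ups]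
    simp [hg]
  | false =>
    rw [h0, NodeState.upCount_of_not_busy (fun h => by
      rw [push_upBusy, hg] at h
      cases h), push_ups]
    simp [hg]

theorem downCount_load (T : LocalView n → ℕ) {v u : Fin n} (hu : u ∈ N.B.children v)
    (s : NodeState n) : (N.load (gossipRule T) v s).downCount u = s.downCount u := by
  rcases N.load_cases (gossipRule T) v s with ⟨he, _⟩ | ⟨g, hj, _, _, he⟩ <;> rw [he]
  have h0 := NodeState.downCount_of_not_waits (NodeState.not_waits_of_none hj u)
  cases hg : g.up with
  | true =>
    rw [h0, NodeState.downCount_of_not_waits (fun h => by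
      rw [push_waits, hg] at h
      cases h.1), push_downs]
    simp [hg]
  | false =>
    rw [h0, NodeState.downCount_of_waits (push_waits.2 ⟨hg, by rwa [Network.receivers_down hg]⟩),
      push_downs]
    simp [hg]

theorem finished_load (T : LocalView n → ℕ) {v : Fin n} {s : NodeState n} (hs : s.Finished) :
    (N.load (gossipRule T) v s).Finished := by
  rcases N.load_begins T v s with he | ⟨g, hj, _, _, hb, he⟩ <;> rw [he]
  · exact hs
  · refine ⟨NodeState.push_finalSent hs.1, ?_⟩
    rw [push_upBusy]
    cases hb with
    | root => simp
    | forward _ _ _ hg => simp [hg]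
    | last _ hf => exact absurd hs.1 hf
    | full _ _ hf => exact absurd hs.1 hf

section AfterRound

variable {m : ℕ} {G : SimpleGraph (Fin n)} {s : Fin n → NodeState n}
  {x : Fin n → Fin m × Fin m} {v u : Fin n}

theorem afterRound_upBusy (h : (afterRound G s x v).UpBusy) : (s v).UpBusy := by
  obtain ⟨g, R', hj, hg⟩ := h
  obtain ⟨R, h1, _⟩ := afterRound_job.1 hj
  exact ⟨g, R, h1, hg⟩

theorem afterRound_waits :
    (afterRound G s x v).Waits u ↔ (s v).Waits u ∧ ¬ GotAck G s x v u := by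
  constructor
  · rintro ⟨g, R', hj, hg, hu⟩
    obtain ⟨R, h1, h2, _⟩ := afterRound_job.1 hj
    rw [← h2, mem_remaining] at hu
    exact ⟨⟨g, R, h1, hg, hu.1⟩, hu.2⟩
  · rintro ⟨⟨g, R, hj, hg, hu⟩, hn⟩
    have hm : u ∈ remaining G s x v R := mem_remaining.2 ⟨hu, hn⟩
    exact ⟨g, _, afterRound_job.2 ⟨R, hj, rfl, u, hm⟩, hg, hm⟩

end AfterRound

variable {T : LocalView n → ℕ} {T₀ t : ℕ} {s : Fin n → NodeState n} {v u : Fin n}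

theorem finished_step (x : Fin n → Fin N.m × Fin N.m) (hs : (s v).Finished) :
    (N.step (gossipRule T) s x v).Finished :=
  finished_load T ⟨hs.1, fun h => hs.2 (afterRound_upBusy h)⟩

theorem upCount_le_step (x : Fin n → Fin N.m × Fin N.m) :
    (s v).upCount ≤ (N.step (gossipRule T) s x v).upCount := by
  unfold Network.step
  rw [upCount_load]
  by_cases hb : (afterRound N.G s x v).UpBusy
  · rw [NodeState.upCount_of_busy hb, NodeState.upCount_of_busy (afterRound_upBusy hb)]
    exact le_rfl
  · rw [NodeState.upCount_of_not_busy hb]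
    exact Nat.sub_le _ _

theorem Inv.job_up (h : Inv N T₀ t s) {g : Msg n} {R : Finset (Fin n)}
    (hj : (s v).job = some (g, R)) (hg : g.up = true) :
    v ≠ N.B.root ∧ R = {N.B.parent v} := by
  obtain ⟨_, h2, h3⟩ := h.job_mem v g R hj
  by_cases hv : v = N.B.root
  · rw [hv, Network.receivers_up_root hg] at h2
    obtain ⟨a, ha⟩ := h3
    cases h2 ha
  · rw [Network.receivers_up hg hv] at h2
    refine ⟨hv, (Finset.subset_singleton_iff.1 h2).resolve_left h3.ne_empty⟩

theorem Inv.upCount_lt_step (h : Inv N T₀ t s) (x : Fin n → Fin N.m × Fin N.m)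
    (hb : (s v).UpBusy) (ha : GotAck N.G s x v (N.B.parent v)) :
    (s v).upCount + 1 ≤ (N.step (gossipRule T) s x v).upCount := by
  unfold Network.step
  rw [upCount_load, NodeState.upCount_of_busy hb, Nat.sub_add_cancel (hb.one_le h)]
  have hnb : ¬ (MultiBroadcast.afterRound N.G s x v).UpBusy := by
    rintro ⟨g, R', hj, hg⟩
    obtain ⟨R, h1, h2, w, hw⟩ := afterRound_job.1 hj
    rw [← h2, mem_remaining, (h.job_up h1 hg).2, Finset.mem_singleton] at hw
    exact hw.2 (hw.1 ▸ ha)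
  rw [NodeState.upCount_of_not_busy hnb]
  exact le_rfl

theorem downCount_le_step (x : Fin n → Fin N.m × Fin N.m) (hu : u ∈ N.B.children v) :
    (s v).downCount u ≤ (N.step (gossipRule T) s x v).downCount u := by
  unfold Network.step
  rw [downCount_load T hu]
  by_cases hb : (afterRound N.G s x v).Waits u
  · rw [NodeState.downCount_of_waits hb, NodeState.downCount_of_waits (afterRound_waits.1 hb).1]
    exact le_rfl
  · rw [NodeState.downCount_of_not_waits hb]
    exact Nat.sub_le _ _

theorem Inv.downCount_lt_step (h : Inv N T₀ t s) (x : Fin n → Fin N.m × Fin N.m)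
    (hu : u ∈ N.B.children v) (hb : (s v).Waits u) (ha : GotAck N.G s x v u) :
    (s v).downCount u + 1 ≤ (N.step (gossipRule T) s x v).downCount u := by
  unfold Network.step
  rw [downCount_load T hu, NodeState.downCount_of_waits hb, Nat.sub_add_cancel (hb.one_le h),
    NodeState.downCount_of_not_waits fun hw => (afterRound_waits.1 hw).2 ha]
  exact le_rfl

/-! ### No stalling -/

/-- No idle node has a message that it could begin to transmit. -/
def Settled (N : Network n) (T : LocalView n → ℕ) (s : Fin n → NodeState n) : Prop :=
  ∀ v, (s v).job = none → ∀ g, gossipRule T (N.localView v) (s v) = some g →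
    ¬ N.Admissible v (s v) g

theorem settled_load (T : LocalView n → ℕ) (s : Fin n → NodeState n) :
    Settled N T fun v => N.load (gossipRule T) v (s v) := by
  intro v
  dsimp only
  intro hj
  rcases N.load_cases (gossipRule T) v (s v) with ⟨he, h⟩ | ⟨g, _, _, _, he⟩
  · rw [he] at hj ⊢
    exact h hj
  · rw [he] at hj
    cases hj

/-- Full batches contain `c` fresh rumors of `S` each. -/
theorem Inv.fulls_le (h : Inv N T₀ t s) (hc : 1 ≤ N.c) (v : Fin n) :
    (s v).fulls.length ≤ N.S.card ⌈/⌉ N.c := by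
  have h1 := h.fulls_lo v
  have h2 := Finset.card_le_card ((fulls_subset_ups (s v)).trans (h.ups_sub v))
  have h3 : N.S.card ≤ N.c * (N.S.card ⌈/⌉ N.c) := (ceilDiv_le_iff_le_mul (by omega)).1 le_rfl
  exact Nat.le_of_mul_le_mul_left (h1.trans (h2.trans h3)) (by omega)

/-- The last message does not count: as long as the node is unfinished, it is either unsent or still
pending. -/
theorem Inv.upCount_eq_of_not_finished (h : Inv N T₀ t s) (hf : ¬ (s v).Finished) :
    (s v).upCount ≤ (s v).fulls.length := by
  have hl := (s v).length_ups
  by_cases hfs : (s v).FinalSent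
  · have hb : (s v).UpBusy := by
      by_contra hb
      exact hf ⟨hfs, hb⟩
    have := h.finals_le v
    rw [NodeState.upCount_of_busy hb]
    omega
  · rw [NodeState.finalSent_iff, not_not] at hfs
    rw [hfs] at hl
    refine (Nat.sub_le _ _).trans ?_
    simp at hl
    omega

theorem Inv.upCount_le (h : Inv N T₀ t s) (hc : 1 ≤ N.c) (hf : ¬ (s v).Finished) :
    (s v).upCount ≤ N.S.card ⌈/⌉ N.c :=
  (h.upCount_eq_of_not_finished hf).trans (h.fulls_le hc v)

/-- The rumors of all acknowledged messages of an unfinished child have been collected. -/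
theorem Inv.upCount_mul_le (h : Inv N T₀ t s) (hu : u ∈ N.B.children v)
    (hf : ¬ (s u).Finished) : N.c * (s u).upCount ≤ (N.collected v (s v)).card := by
  obtain ⟨hur, hup⟩ := Backbone.mem_children.1 hu
  have hrecv : ∀ g ∈ (s u).fulls, (∀ R, (s u).job ≠ some (g, R)) →
      g.batch ⊆ N.collected v (s v) := by
    intro g hg hj a ha
    obtain ⟨h1, h2, _⟩ := NodeState.mem_fulls.1 hg
    have hv : v ∈ N.receivers u g := by
      rw [Network.receivers_up h2 hur, hup]
      exact Finset.mem_singleton_self v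
    rcases h.sent u g h1 v hv with h3 | ⟨R, h3, _⟩
    · exact Network.mem_collected.2 (Or.inr ⟨u, g, h3, h2, ha⟩)
    · exact absurd h3 (hj R)
  have hlo := h.fulls_lo u
  -- A pending full batch may not have arrived. It is missing from `upCount`, and it accounts for at
  -- most `c` of the rumors sent by `u`.
  by_cases hpend : ∃ g R, (s u).job = some (g, R) ∧ g ∈ (s u).fulls
  · obtain ⟨g, R, hj, hg⟩ := hpend
    obtain ⟨h1, h2, h3⟩ := NodeState.mem_fulls.1 hg
    have hb : (s u).UpBusy := ⟨g, R, hj, h2⟩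
    have hfin : (s u).finals = [] := by
      by_contra hne
      have := h.pending_final u g R (NodeState.finalSent_iff.2 hne) hj h2
      rw [h3] at this
      cases this
    have hl := (s u).length_ups
    rw [hfin, List.length_nil, add_zero] at hl
    have hsub : batchUnion (s u).fulls \ g.batch ⊆ N.collected v (s v) := by
      intro a ha
      obtain ⟨ha1, ha2⟩ := Finset.mem_sdiff.1 ha
      obtain ⟨g', hg', hag'⟩ := mem_batchUnion.1 ha1
      refine hrecv g' hg' (fun R' hj' => ?_) hag'
      rw [hj] at hj'
      obtain ⟨rfl, _⟩ := Prod.mk.inj (Option.some.inj hj')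
      exact ha2 hag'
    have h4 := Finset.card_le_card hsub
    have h5 := Finset.le_card_sdiff g.batch (batchUnion (s u).fulls)
    have h6 := h.batch_card u g h1
    rw [NodeState.upCount_of_busy hb, hl, Nat.mul_sub, mul_one]
    omega
  · have hsub : batchUnion (s u).fulls ⊆ N.collected v (s v) := by
      intro a ha
      obtain ⟨g, hg, hag⟩ := mem_batchUnion.1 ha
      exact hrecv g hg (fun R hj => hpend ⟨g, R, hj, hg⟩) hag
    exact (Nat.mul_le_mul_left _ (h.upCount_eq_of_not_finished hf)).trans
      (hlo.trans (Finset.card_le_card hsub))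

/-- An idle unfinished node waits for an unfinished child that is not ahead. -/
theorem Inv.exists_child_behind (h : Inv N T₀ t s) (hs : Settled N T s)
    (hv : v ≠ N.B.root) (hf : ¬ (s v).Finished) (hb : ¬ (s v).UpBusy) :
    ∃ u ∈ N.B.children v, ¬ (s u).Finished ∧ (s u).upCount ≤ (s v).upCount := by
  classical
  have hfs : ¬ (s v).FinalSent := fun hfs => hf ⟨hfs, hb⟩
  -- A pending downward message would mean that the last upward message has been sent.
  have hj : (s v).job = none := by
    cases hj : (s v).job with
    | none => rfl
    | some j =>
      obtain ⟨g, R⟩ := j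
      exfalso
      cases hg : g.up with
      | true => exact hb ⟨g, R, hj, hg⟩
      | false =>
        exact hfs (h.down_final v g hv (NodeState.mem_downs.2 ⟨(h.job_mem v g R hj).1, hg⟩))
  have hadm : ∀ b f, b ⊆ N.collected v (s v) → b.card ≤ N.c →
      N.Admissible v (s v) ⟨true, b, f⟩ := by
    intro b f h1 h2
    refine ⟨?_, h2, by simpa using h1⟩
    rw [Network.receivers_up rfl hv]
    exact Finset.singleton_nonempty _
  have hrule := gossipRule_nonroot_up N T hv hfs
  have hs' := hs v hj
  split_ifs at hrule with h1 h2 h2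
  · exact absurd (hadm _ _ Finset.sdiff_subset h2) (hs' _ hrule)
  · refine absurd (hadm _ _ ((take_subset _ _).trans Finset.sdiff_subset) ?_) (hs' _ hrule)
    rw [card_take]
    exact min_le_left _ _
  · refine absurd (hadm _ _ ((take_subset _ _).trans Finset.sdiff_subset) ?_) (hs' _ hrule)
    rw [card_take]
    exact min_le_left _ _
  -- Only the silent branch of the rule remains: the last message of some child is missing, and
  -- fewer than `c` collected rumors are unsent.
  · push Not at h1 h2
    obtain ⟨u, hu, hfr⟩ := h1
    obtain ⟨hur, hup⟩ := Backbone.mem_children.1 hu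
    have hfu : ¬ (s u).Finished := by
      rintro ⟨⟨g, h3, h4, h5⟩, h6⟩
      have hvr : v ∈ N.receivers u g := by
        rw [Network.receivers_up h4 hur, hup]
        exact Finset.mem_singleton_self v
      rcases h.sent u g h3 v hvr with h7 | ⟨R, h7, _⟩
      · exact hfr ⟨g, h7, h4, h5⟩
      · exact h6 ⟨g, R, h7, h4⟩
    refine ⟨u, hu, hfu, ?_⟩
    have h3 := h.upCount_mul_le hu hfu
    have h4 := Finset.le_card_sdiff (batchUnion (s v).ups) (N.collected v (s v))
    have h5 := h.ups_hi v
    rw [NodeState.upCount_of_not_busy hb]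
    -- `v` has collected at least `c` rumors per acknowledged message of `u`, has sent at most `c`
    -- per message of its own, and has fewer than `c` left over.
    have h6 : N.c * (s u).upCount < N.c * ((s v).ups.length + 1) := by
      rw [mul_add, mul_one]
      omega
    exact Nat.lt_succ_iff.1 (Nat.lt_of_mul_lt_mul_left h6)

/-- By `final_child` the rumors sent by a node are contained in those sent by its parent, up to a
child of the root, all of whose messages have arrived. -/
theorem Inv.subset_collected_root (h : Inv N T₀ t s) (hfin : ∀ v, v ≠ N.B.root → (s v).Finished) :
    N.S ⊆ N.collected N.B.root (s N.B.root) := by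
  have key : ∀ i w, N.B.parent^[i] w = N.B.root → w ≠ N.B.root →
      batchUnion (s w).ups ⊆ N.collected N.B.root (s N.B.root) := by
    intro i
    induction i with
    | zero => intro w hw hne; exact absurd hw hne
    | succ i ih =>
      intro w hw hne
      by_cases hp : N.B.parent w = N.B.root
      · intro a ha
        obtain ⟨g, hg, hag⟩ := mem_batchUnion.1 ha
        obtain ⟨h1, h2⟩ := NodeState.mem_ups.1 hg
        have hr : N.B.root ∈ N.receivers w g := by
          rw [Network.receivers_up h2 hne, hp]
          exact Finset.mem_singleton_self _
        rcases h.sent w g h1 _ hr with h3 | ⟨R, h3, _⟩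
        · exact Network.mem_collected.2 (Or.inr ⟨w, g, h3, h2, hag⟩)
        · exact absurd ⟨g, R, h3, h2⟩ (hfin w hne).2
      · exact (h.final_child _ w (hfin _ hp).1 (Backbone.mem_children.2 ⟨hne, rfl⟩)).2.trans
          (ih _ hw hp)
  intro a ha
  by_cases har : a = N.B.root
  · exact Network.mem_collected.2 (Or.inl ⟨har, har ▸ ha⟩)
  · obtain ⟨i, hi⟩ := N.B.reaches_root a
    exact key i a hi har (h.final_own a (hfin a har).1 ha)

/-- If no messages to parents are pending and `u` lacks batches for which `v` does not wait, then
a sibling of `u` is behind `u`, or `v` itself is not ahead of `u`. -/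
theorem Inv.exists_behind (h : Inv N T₀ t s) (hs : Settled N T s)
    (hT : T (N.localView N.B.root) ≤ t) (hfin : ∀ v, v ≠ N.B.root → (s v).Finished)
    (hu : u ∈ N.B.children v) (hlt : (s v).downCount u < N.S.card ⌈/⌉ N.c)
    (hw : ¬ (s v).Waits u) :
    (∃ u' ∈ N.B.children v, (s v).downCount u' + 1 ≤ (s v).downCount u) ∨
    (v ≠ N.B.root ∧ (s (N.B.parent v)).downCount v ≤ (s v).downCount u) := by
  classical
  rw [NodeState.downCount_of_not_waits hw] at hlt ⊢
  cases hj : (s v).job with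
  | some j =>
    obtain ⟨g, R⟩ := j
    cases hg : g.up with
    | true => exact absurd ⟨g, R, hj, hg⟩ (hfin v (h.job_up hj hg).1).2
    | false =>
      left
      obtain ⟨_, h2, u', hu'⟩ := h.job_mem v g R hj
      have hw' : (s v).Waits u' := ⟨g, R, hj, hg, hu'⟩
      refine ⟨u', ?_, ?_⟩
      · have := h2 hu'
        rwa [Network.receivers_down hg] at this
      · rw [NodeState.downCount_of_waits hw', Nat.sub_add_cancel (hw'.one_le h)]
  | none =>
    right
    have hs' := hs v hj
    have hne : (N.B.children v).Nonempty := ⟨u, hu⟩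
    by_cases hv : v = N.B.root
    · exfalso
      have hS := h.subset_collected_root hfin
      have hcS := (h.collected_subset N.B.root).antisymm hS
      rw [← hv] at hcS
      have hc : 0 < N.c := by
        by_contra hc
        have h0 : N.c = 0 := by omega
        have : N.S.card ⌈/⌉ N.c = 0 := by rw [h0]; exact ceilDiv_zero _
        omega
      -- Fewer than `⌈k / c⌉` batches cannot cover all `k` rumors, so an idle root would have a
      -- message to send.
      have hU : N.collected v (s v) \ batchUnion (s v).downs ≠ ∅ := by
        rw [hcS]
        intro hemp
        have h1 := Finset.card_le_card (Finset.sdiff_eq_empty_iff_subset.1 hemp)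
        have h2 := h.root_hi
        rw [← hv] at h2
        exact absurd ((ceilDiv_le_iff_le_mul hc).2 (h1.trans h2)) (not_le.2 hlt)
      refine hs' _ ((gossipRule_root N T hv).2 ⟨⟨?_, ?_, hU⟩, rfl⟩) ⟨?_, ?_, ?_⟩
      · rw [h.len, hv]
        exact hT
      · rw [hcS]
      · rw [Network.receivers_down rfl]
        exact hne
      · rw [card_take]
        exact min_le_left _ _
      · simp only [Bool.false_eq_true, if_false, hv, if_true]
        rw [hv] at hlt
        exact ⟨hlt, hS, (take_subset _ _).trans
          (Finset.sdiff_subset.trans (h.collected_subset _))⟩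
    · refine ⟨hv, ?_⟩
      -- Otherwise the rule would offer a message to forward, which is admissible since the quota of
      -- `v` is not exhausted.
      have hrec : ∀ g, (s v).RecvFrom (N.B.parent v) g → g.up = false → g ∈ (s v).downs := by
        by_contra hcon
        push Not at hcon
        obtain ⟨g, hg1, hg2, hg3⟩ := hcon
        have hex : ∃ g, (s v).Received g ∧ g.up = false ∧ g ∉ (s v).outbox :=
          ⟨g, NodeState.received_iff.2 ⟨_, hg1⟩, hg2, fun h' =>
            hg3 (NodeState.mem_downs.2 ⟨h', hg2⟩)⟩
        have hrule := gossipRule_nonroot_down N T hv (hfin v hv).1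
        rw [dif_pos hex] at hrule
        obtain ⟨hr, hup, _⟩ := hex.choose_spec
        refine hs' _ hrule ⟨?_, ?_, ?_⟩
        · rw [Network.receivers_down hup]
          exact hne
        · obtain ⟨w, hw⟩ := NodeState.received_iff.1 hr
          exact h.batch_card w _ (h.recv_mem _ _ _ hw).1
        · rw [hup]
          simp only [Bool.false_eq_true, if_false, hv]
          exact ⟨hlt, _, hr, hup, rfl⟩
      set l := (s (N.B.parent v)).downs
      have hvc : v ∈ N.B.children (N.B.parent v) := Backbone.mem_children.2 ⟨hv, rfl⟩
      have hl : ∀ g ∈ l, (∀ R, (s (N.B.parent v)).job = some (g, R) → v ∉ R) →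
          g ∈ (s v).downs := by
        intro g hg hR
        obtain ⟨h1, h2⟩ := NodeState.mem_downs.1 hg
        rcases h.sent _ g h1 v (by rwa [Network.receivers_down h2]) with h3 | ⟨R, h3, h4⟩
        · exact hrec g h3 h2
        · exact absurd h4 (hR R h3)
      by_cases hwv : (s (N.B.parent v)).Waits v
      -- All messages of the parent except the pending one have been received, hence forwarded; as
      -- they are distinct, they can be counted.
      · rw [NodeState.downCount_of_waits hwv]
        obtain ⟨g, R, hj', hg, _⟩ := hwv
        have hgl : g ∈ l := NodeState.mem_downs.2 ⟨(h.job_mem _ g R hj').1, hg⟩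
        have hnd := h.down_nodup (N.B.parent v)
        have hsub : l.erase g ⊆ (s v).downs := by
          intro g' hg'
          obtain ⟨hne', hg'⟩ := (hnd.mem_erase_iff).1 hg'
          refine hl g' hg' fun R' h1 => ?_
          rw [hj'] at h1
          exact absurd (Prod.mk.inj (Option.some.inj h1)).1.symm hne'
        have := (List.subperm_of_subset (hnd.erase g) hsub).length_le
        rwa [List.length_erase_of_mem hgl] at this
      · rw [NodeState.downCount_of_not_waits hwv]
        refine (List.subperm_of_subset (h.down_nodup _) fun g hg => hl g hg fun R h1 h2 => ?_).length_le
        exact hwv ⟨g, R, h1, (NodeState.mem_downs.1 hg).2, h2⟩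

/-- When all messages have been acknowledged, all nodes know all rumors. -/
theorem Inv.known_of_complete (h : Inv N T₀ t s) (hc : 1 ≤ N.c) (hS : N.c ≤ N.S.card)
    (hfin : ∀ v, v ≠ N.B.root → (s v).Finished)
    (hdown : ∀ u, u ≠ N.B.root → N.S.card ⌈/⌉ N.c ≤ (s (N.B.parent u)).downCount u) (v : Fin n) :
    N.S ⊆ N.known v (s v) := by
  classical
  have hK : 1 ≤ N.S.card ⌈/⌉ N.c := by
    by_contra hK
    have : N.S.card ⌈/⌉ N.c ≤ 0 := by omega
    rw [ceilDiv_le_iff_le_mul (by omega)] at this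
    omega
  have hlen : ∀ u, u ≠ N.B.root → (s (N.B.parent u)).downs.length = N.S.card ⌈/⌉ N.c ∧
      ¬ (s (N.B.parent u)).Waits u := by
    intro u hu
    have h1 := hdown u hu
    have h2 := h.down_len (N.B.parent u)
    by_cases hw : (s (N.B.parent u)).Waits u
    · rw [NodeState.downCount_of_waits hw] at h1
      omega
    · rw [NodeState.downCount_of_not_waits hw] at h1
      exact ⟨by omega, hw⟩
  have key : ∀ i w, N.B.parent^[i] w = N.B.root → (s w).downs.length = N.S.card ⌈/⌉ N.c →
      N.S ⊆ batchUnion (s w).downs := by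
    have hroot : (s N.B.root).downs.length = N.S.card ⌈/⌉ N.c →
        N.S ⊆ batchUnion (s N.B.root).downs := by
      intro hl
      have h1 := h.root_lo
      have h2 : N.S.card ≤ N.c * (N.S.card ⌈/⌉ N.c) := (ceilDiv_le_iff_le_mul (by omega)).1 le_rfl
      rw [hl, min_eq_left h2] at h1
      exact (Finset.eq_of_subset_of_card_le h.root_sub h1).symm.subset
    intro i
    induction i with
    | zero =>
      intro w hw hl
      obtain rfl : w = N.B.root := hw
      exact hroot hl
    | succ i ih =>
      intro w hw hl
      by_cases hwr : w = N.B.root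
      · subst hwr
        exact hroot hl
      · have hp := (hlen w hwr).1
        have hsub : (s w).downs ⊆ (s (N.B.parent w)).downs := by
          intro g hg
          exact NodeState.mem_downs.2 ⟨(h.recv_mem _ _ _ (h.down_recv w g hwr hg)).1,
            (NodeState.mem_downs.1 hg).2⟩
        -- A node forwards distinct messages of its parent; if both have sent the full number, the
        -- two sets agree, so the coverage of `S` passes down from the root.
        have hperm := (List.subperm_of_subset (h.down_nodup w) hsub).perm_of_length_le
          (by rw [hp, hl])
        refine (ih _ hw hp).trans fun a ha => ?_
        obtain ⟨g, hg, hag⟩ := mem_batchUnion.1 ha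
        exact mem_batchUnion.2 ⟨g, hperm.mem_iff.2 hg, hag⟩
  have hkn : ∀ a, a ∈ N.known v (s v) ↔
      (a = v ∧ v ∈ N.S) ∨ ∃ g, (s v).Received g ∧ a ∈ g.batch := by
    intro a
    simp [Network.known]
  intro a ha
  rw [hkn]
  by_cases hv : v = N.B.root
  · have := h.subset_collected_root hfin ha
    rw [← hv] at this
    rcases Network.mem_collected.1 this with h1 | ⟨u, g, h1, _, h2⟩
    · exact Or.inl h1
    · exact Or.inr ⟨g, NodeState.received_iff.2 ⟨u, h1⟩, h2⟩
  · right
    obtain ⟨i, hi⟩ := N.B.reaches_root (N.B.parent v)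
    obtain ⟨hl, hw⟩ := hlen v hv
    obtain ⟨g, hg, hag⟩ := mem_batchUnion.1 (key i _ hi hl ha)
    obtain ⟨h1, h2⟩ := NodeState.mem_downs.1 hg
    have hvc : v ∈ N.receivers (N.B.parent v) g := by
      rw [Network.receivers_down h2]
      exact Backbone.mem_children.2 ⟨hv, rfl⟩
    rcases h.sent _ g h1 v hvc with h3 | ⟨R, h3, h4⟩
    · exact ⟨g, NodeState.received_iff.2 ⟨_, h3⟩, hag⟩
    · exact absurd ⟨g, R, h3, h2, h4⟩ hw

end Progress

/-! ### Potentials -/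

section Potential

variable {n : ℕ} {N : Network n}

open Classical in
/-- The weight of the messages that `v` still has to send to its parent. -/
def upWeight (N : Network n) (ρ : ℝ) (h : Fin n → ℕ) (s : Fin n → NodeState n) (v : Fin n) : ℝ :=
  if v = N.B.root ∨ (s v).Finished then 0 else ρ ^ (s v).upCount * ρ⁻¹ ^ h v

open Classical in
/-- The weight of the messages that `u` still has to receive from its parent. -/
def downWeight (N : Network n) (ρ : ℝ) (h : Fin n → ℕ) (s : Fin n → NodeState n) (u : Fin n) : ℝ :=
  if u = N.B.root ∨ N.S.card ⌈/⌉ N.c ≤ (s (N.B.parent u)).downCount u then 0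
  else ρ ^ ((s (N.B.parent u)).downCount u + h (N.B.parent u))

def upPotential (N : Network n) (ρ : ℝ) (h : Fin n → ℕ) (s : Fin n → NodeState n) : ℝ :=
  ∑ v, upWeight N ρ h s v

def downPotential (N : Network n) (ρ : ℝ) (h : Fin n → ℕ) (s : Fin n → NodeState n) : ℝ :=
  ∑ v, downWeight N ρ h s v

variable {T : LocalView n → ℕ} {T₀ t : ℕ} {s : Fin n → NodeState n} {v u : Fin n}
  {ρ p : ℝ} {h : Fin n → ℕ}

theorem upWeight_nonneg (hρ : 0 < ρ) : 0 ≤ upWeight N ρ h s v := by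
  unfold upWeight
  split_ifs
  · exact le_rfl
  · positivity

theorem downWeight_nonneg (hρ : 0 < ρ) : 0 ≤ downWeight N ρ h s u := by
  unfold downWeight
  split_ifs
  · exact le_rfl
  · positivity

theorem upPotential_nonneg (hρ : 0 < ρ) : 0 ≤ upPotential N ρ h s :=
  Finset.sum_nonneg fun _ _ => upWeight_nonneg hρ

theorem downPotential_nonneg (hρ : 0 < ρ) : 0 ≤ downPotential N ρ h s :=
  Finset.sum_nonneg fun _ _ => downWeight_nonneg hρ

theorem one_le_inv_pow (hρ : 0 < ρ) (hρ1 : ρ ≤ 1) (i : ℕ) : 1 ≤ ρ⁻¹ ^ i :=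
  one_le_pow₀ ((one_le_inv₀ hρ).2 hρ1)

theorem upPotential_le (hρ : 0 < ρ) (hρ1 : ρ ≤ 1) {H : ℕ} (hH : ∀ v, h v ≤ H) :
    upPotential N ρ h s ≤ n * ρ⁻¹ ^ H := by
  refine (Finset.sum_le_card_nsmul _ _ (ρ⁻¹ ^ H) fun v _ => ?_).trans (by simp)
  unfold upWeight
  split_ifs
  · positivity
  · calc ρ ^ (s v).upCount * ρ⁻¹ ^ h v ≤ 1 * ρ⁻¹ ^ H := by
          refine mul_le_mul (pow_le_one₀ hρ.le hρ1)
            (pow_le_pow_right₀ ((one_le_inv₀ hρ).2 hρ1) (hH v)) (by positivity) zero_le_one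
      _ = _ := one_mul _

theorem downPotential_le (hρ : 0 < ρ) (hρ1 : ρ ≤ 1) : downPotential N ρ h s ≤ n := by
  refine (Finset.sum_le_card_nsmul _ _ 1 fun v _ => ?_).trans (by simp)
  unfold downWeight
  split_ifs
  · exact zero_le_one
  · exact pow_le_one₀ hρ.le hρ1

/-- An unfinished node has at most `K` acknowledged messages, and its height only increases the
weight. The gap between this value and 0 is what Markov's inequality exploits. -/
theorem Inv.le_upPotential (hI : Inv N T₀ t s) (hc : 1 ≤ N.c) (hρ : 0 < ρ) (hρ1 : ρ ≤ 1)
    (hv : v ≠ N.B.root) (hf : ¬ (s v).Finished) :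
    ρ ^ (N.S.card ⌈/⌉ N.c) ≤ upPotential N ρ h s := by
  refine le_trans ?_ (Finset.single_le_sum (f := fun v => upWeight N ρ h s v)
    (fun _ _ => upWeight_nonneg hρ) (Finset.mem_univ v))
  rw [upWeight, if_neg (by tauto)]
  calc ρ ^ (N.S.card ⌈/⌉ N.c) = ρ ^ (N.S.card ⌈/⌉ N.c) * 1 := (mul_one _).symm
    _ ≤ _ := mul_le_mul (pow_le_pow_of_le_one hρ.le hρ1 (hI.upCount_le hc hf))
        (one_le_inv_pow hρ hρ1 _) zero_le_one (by positivity)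

theorem le_downPotential (hρ : 0 < ρ) (hρ1 : ρ ≤ 1) {H : ℕ} (hH : ∀ v, h v ≤ H)
    (hu : u ≠ N.B.root) (hlt : (s (N.B.parent u)).downCount u < N.S.card ⌈/⌉ N.c) :
    ρ ^ (N.S.card ⌈/⌉ N.c + H) ≤ downPotential N ρ h s := by
  refine le_trans ?_ (Finset.single_le_sum (f := fun v => downWeight N ρ h s v)
    (fun _ _ => downWeight_nonneg hρ) (Finset.mem_univ u))
  rw [downWeight, if_neg (by rw [not_or, not_le]; exact ⟨hu, hlt⟩)]
  exact pow_le_pow_of_le_one hρ.le hρ1 (Nat.add_le_add hlt.le (hH _))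

theorem upWeight_step_le (hρ : 0 < ρ) (hρ1 : ρ ≤ 1) (x : Fin n → Fin N.m × Fin N.m) :
    upWeight N ρ h (N.step (gossipRule T) s x) v ≤ upWeight N ρ h s v := by
  by_cases h0 : v = N.B.root ∨ (N.step (gossipRule T) s x v).Finished
  · rw [upWeight, if_pos h0]
    exact upWeight_nonneg hρ
  · have h1 : ¬ (v = N.B.root ∨ (s v).Finished) := fun h1 => h0 (h1.imp_right (finished_step x))
    rw [upWeight, if_neg h0, upWeight, if_neg h1]
    exact mul_le_mul_of_nonneg_right (pow_le_pow_of_le_one hρ.le hρ1 (upCount_le_step x))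
      (by positivity)

theorem downWeight_step_le (hρ : 0 < ρ) (hρ1 : ρ ≤ 1) (x : Fin n → Fin N.m × Fin N.m) :
    downWeight N ρ h (N.step (gossipRule T) s x) u ≤ downWeight N ρ h s u := by
  by_cases hu : u = N.B.root
  · rw [downWeight, if_pos (Or.inl hu), downWeight, if_pos (Or.inl hu)]
  have hmono := downCount_le_step (T := T) (s := s) x (Backbone.mem_children.2 ⟨hu, rfl⟩ :
    u ∈ N.B.children (N.B.parent u))
  rw [downWeight]
  split_ifs with h0
  · exact downWeight_nonneg hρ
  · rw [not_or, not_le] at h0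
    rw [downWeight, if_neg (by rw [not_or, not_le]; exact ⟨hu, hmono.trans_lt h0.2⟩)]
    exact pow_le_pow_of_le_one hρ.le hρ1 (Nat.add_le_add_right hmono _)

open Classical in
theorem avg_ite_le {Ω : Type*} [Fintype Ω] [Nonempty Ω] (A : Ω → Prop) (hρ : 0 ≤ ρ)
    (hρ1 : ρ ≤ 1) (hp1 : p ≤ 1) (hA : p ≤ avg fun ω => if A ω then (1 : ℝ) else 0) :
    avg (fun ω => if A ω then ρ else 1) ≤ 1 - p + ρ := by
  have h1 : (fun ω => if A ω then ρ else 1) =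
      fun ω => 1 + (ρ - 1) * (if A ω then (1 : ℝ) else 0) := by
    funext ω
    split_ifs <;> ring
  rw [h1, avg_add, avg_const, avg_const_mul]
  nlinarith [mul_le_mul_of_nonneg_left hA (sub_nonneg.2 hρ1), mul_nonneg hρ (sub_nonneg.2 hp1)]

/-! ### Contraction of single weights -/

section Contraction

variable [NeZero N.m] [DecidableRel N.G.Adj]

/-- An acknowledgment multiplies the weight by at most `ρ` and has probability at least `p`; weights
never grow. -/
theorem Inv.avg_upWeight_le (hI : Inv N T₀ t s) (hm : 2 ≤ N.m) (hρ : 0 < ρ) (hρ1 : ρ ≤ 1)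
    (hp1 : p ≤ 1) (hp : p ≤ (1 - 1 / (N.m : ℝ)) ^ (2 * N.G.maxDegree)) (hb : (s v).UpBusy) :
    avg (fun x => upWeight N ρ h (N.step (gossipRule T) s x) v) ≤
      (1 - p + ρ) * upWeight N ρ h s v := by
  classical
  obtain ⟨g, R, hj, hg⟩ := id hb
  obtain ⟨hv, hR⟩ := hI.job_up hj hg
  have hP := hp.trans (le_avg_gotAck (G := N.G) (s := s) hm hj (u := N.B.parent v)
    (by rw [hR]; exact Finset.mem_singleton_self _) (N.B.adj_parent v hv).symm (Or.inl ⟨hg, hR⟩))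
  refine (avg_mono (g := fun x => upWeight N ρ h s v *
    if GotAck N.G s x v (N.B.parent v) then ρ else 1) fun x => ?_).trans ?_
  · split_ifs with ha
    · have h1 : ¬ (v = N.B.root ∨ (s v).Finished) := by
        rintro (h1 | h1)
        · exact hv h1
        · exact h1.2 hb
      rw [upWeight]
      split_ifs with h0
      · exact mul_nonneg (upWeight_nonneg hρ) hρ.le
      · rw [upWeight, if_neg h1]
        calc ρ ^ (N.step (gossipRule T) s x v).upCount * ρ⁻¹ ^ h v
            ≤ ρ ^ ((s v).upCount + 1) * ρ⁻¹ ^ h v := mul_le_mul_of_nonneg_right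
              (pow_le_pow_of_le_one hρ.le hρ1 (hI.upCount_lt_step x hb ha)) (by positivity)
          _ = _ := by ring
    · rw [mul_one]
      exact upWeight_step_le hρ hρ1 x
  · rw [avg_const_mul, mul_comm]
    exact mul_le_mul_of_nonneg_right (avg_ite_le _ hρ.le hρ1 hp1 hP) (upWeight_nonneg hρ)

theorem Inv.avg_downWeight_le (hI : Inv N T₀ t s) (hm : 2 ≤ N.m) (hρ : 0 < ρ) (hρ1 : ρ ≤ 1)
    (hp1 : p ≤ 1) (hp : p ≤ (1 - 1 / (N.m : ℝ)) ^ (2 * N.G.maxDegree))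
    (hfin : ∀ v, v ≠ N.B.root → (s v).Finished) (hu : u ≠ N.B.root)
    (hw : (s (N.B.parent u)).Waits u) :
    avg (fun x => downWeight N ρ h (N.step (gossipRule T) s x) u) ≤
      (1 - p + ρ) * downWeight N ρ h s u := by
  classical
  obtain ⟨g, R, hj, hg, huR⟩ := id hw
  have huc : u ∈ N.B.children (N.B.parent u) := Backbone.mem_children.2 ⟨hu, rfl⟩
  have hP := hp.trans (le_avg_gotAck (G := N.G) (s := s) hm hj huR (N.B.adj_parent u hu)
    (Or.inr fun w g R hjw => by
      cases hgu : g.up with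
      | false => rfl
      | true => exact absurd ⟨g, R, hjw, hgu⟩ (hfin w (hI.job_up hjw hgu).1).2))
  refine (avg_mono (g := fun x => downWeight N ρ h s u *
    if GotAck N.G s x (N.B.parent u) u then ρ else 1) fun x => ?_).trans ?_
  · split_ifs with ha
    · have h2 := hI.downCount_lt_step (T := T) x huc hw ha
      rw [downWeight]
      split_ifs with h0
      · exact mul_nonneg (downWeight_nonneg hρ) hρ.le
      · rw [not_or, not_le] at h0
        rw [downWeight, if_neg (by rw [not_or, not_le]; exact ⟨hu, by omega⟩)]
        calc ρ ^ ((N.step (gossipRule T) s x (N.B.parent u)).downCount u + h (N.B.parent u))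
            ≤ ρ ^ ((s (N.B.parent u)).downCount u + h (N.B.parent u) + 1) :=
              pow_le_pow_of_le_one hρ.le hρ1 (by omega)
          _ = _ := by ring
    · rw [mul_one]
      exact downWeight_step_le hρ hρ1 x
  · rw [avg_const_mul, mul_comm]
    exact mul_le_mul_of_nonneg_right (avg_ite_le _ hρ.le hρ1 hp1 hP) (downWeight_nonneg hρ)

end Contraction

/-- Some unfinished child is not ahead, and its greater height makes its weight larger by a factor
of at least `ρ⁻¹`. -/
theorem Inv.upWeight_idle_le (hI : Inv N T₀ t s) (hs : Settled N T s) (hρ : 0 < ρ) (hρ1 : ρ ≤ 1)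
    (hh : ∀ v, v ≠ N.B.root → h (N.B.parent v) < h v) (hb : ¬ (s v).UpBusy) :
    upWeight N ρ h s v ≤ ρ * ∑ u ∈ N.B.children v, upWeight N ρ h s u := by
  by_cases h0 : v = N.B.root ∨ (s v).Finished
  · rw [upWeight, if_pos h0]
    exact mul_nonneg hρ.le (Finset.sum_nonneg fun _ _ => upWeight_nonneg hρ)
  · rw [not_or] at h0
    obtain ⟨u, hu, hfu, hle⟩ := hI.exists_child_behind hs h0.1 h0.2 hb
    obtain ⟨hur, hup⟩ := Backbone.mem_children.1 hu
    refine le_trans ?_ (mul_le_mul_of_nonneg_left (Finset.single_le_sum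
      (f := fun u => upWeight N ρ h s u) (fun _ _ => upWeight_nonneg hρ) hu) hρ.le)
    rw [upWeight, if_neg (by tauto), upWeight, if_neg (by tauto)]
    have h1 : h v + 1 ≤ h u := by
      have := hh u hur
      rwa [hup] at this
    calc ρ ^ (s v).upCount * ρ⁻¹ ^ h v ≤ ρ ^ (s u).upCount * ρ⁻¹ ^ h v :=
          mul_le_mul_of_nonneg_right (pow_le_pow_of_le_one hρ.le hρ1 hle) (by positivity)
      _ = ρ ^ (s u).upCount * (ρ * ρ⁻¹ ^ (h v + 1)) := by
          rw [pow_succ]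
          field_simp
      _ ≤ ρ ^ (s u).upCount * (ρ * ρ⁻¹ ^ h u) := by
          refine mul_le_mul_of_nonneg_left (mul_le_mul_of_nonneg_left ?_ hρ.le) (by positivity)
          exact pow_le_pow_right₀ ((one_le_inv₀ hρ).2 hρ1) h1
      _ = _ := by ring

/-- Either a sibling is behind by one message, or the parent is itself not ahead as a receiver. In
the second case the smaller height of the grandparent gives the factor `ρ`. -/
theorem Inv.downWeight_idle_le (hI : Inv N T₀ t s) (hs : Settled N T s)
    (hT : T (N.localView N.B.root) ≤ t) (hρ : 0 < ρ) (hρ1 : ρ ≤ 1)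
    (hh : ∀ v, v ≠ N.B.root → h (N.B.parent v) < h v)
    (hfin : ∀ v, v ≠ N.B.root → (s v).Finished) (hu : u ≠ N.B.root)
    (hw : ¬ (s (N.B.parent u)).Waits u) :
    downWeight N ρ h s u ≤ ρ * ((∑ u' ∈ N.B.children (N.B.parent u), downWeight N ρ h s u') +
      downWeight N ρ h s (N.B.parent u)) := by
  have hsum : 0 ≤ ∑ u' ∈ N.B.children (N.B.parent u), downWeight N ρ h s u' :=
    Finset.sum_nonneg fun _ _ => downWeight_nonneg hρ
  by_cases h0 : N.S.card ⌈/⌉ N.c ≤ (s (N.B.parent u)).downCount u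
  · rw [downWeight, if_pos (Or.inr h0)]
    exact mul_nonneg hρ.le (add_nonneg hsum (downWeight_nonneg hρ))
  · have huc : u ∈ N.B.children (N.B.parent u) := Backbone.mem_children.2 ⟨hu, rfl⟩
    rw [not_le] at h0
    rw [downWeight, if_neg (by rw [not_or, not_le]; exact ⟨hu, h0⟩)]
    rcases hI.exists_behind hs hT hfin huc h0 hw with ⟨u', hu', hle⟩ | ⟨hp, hle⟩
    · obtain ⟨hur, hup⟩ := Backbone.mem_children.1 hu'
      refine le_trans ?_ (mul_le_mul_of_nonneg_left (le_add_of_le_of_nonneg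
        (Finset.single_le_sum (f := fun u => downWeight N ρ h s u)
          (fun _ _ => downWeight_nonneg hρ) hu') (downWeight_nonneg hρ)) hρ.le)
      rw [downWeight, if_neg (by rw [not_or, not_le, hup]; exact ⟨hur, by omega⟩), hup, ← pow_succ']
      exact pow_le_pow_of_le_one hρ.le hρ1 (by omega)
    · refine le_trans ?_ (mul_le_mul_of_nonneg_left (le_add_of_nonneg_left hsum) hρ.le)
      rw [downWeight, if_neg (by rw [not_or, not_le]; exact ⟨hp, by omega⟩), ← pow_succ']
      have := hh _ hp
      exact pow_le_pow_of_le_one hρ.le hρ1 (by omega)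

theorem sum_children (f : Fin n → ℝ) :
    ∑ v, ∑ u ∈ N.B.children v, f u = ∑ u, if u = N.B.root then 0 else f u := by
  classical
  simp only [Backbone.children, Finset.sum_filter]
  rw [Finset.sum_comm]
  refine Finset.sum_congr rfl fun u _ => ?_
  by_cases hu : u = N.B.root <;> simp [hu]

theorem sum_children_le {f : Fin n → ℝ} (hf : ∀ u, 0 ≤ f u) :
    ∑ v, ∑ u ∈ N.B.children v, f u ≤ ∑ u, f u := by
  rw [sum_children]
  refine Finset.sum_le_sum fun u _ => ?_
  split_ifs
  · exact hf u
  · exact le_rfl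

theorem sum_parent_le [DecidableRel N.G.Adj] {f : Fin n → ℝ} (hf : ∀ u, 0 ≤ f u) :
    ∑ u, (if u = N.B.root then 0 else f (N.B.parent u)) ≤ N.G.maxDegree * ∑ u, f u := by
  classical
  rw [← sum_children (N := N), Finset.mul_sum]
  refine Finset.sum_le_sum fun v _ => ?_
  have h1 : ∀ u ∈ N.B.children v, f (N.B.parent u) ≤ f v := fun u hu => by
    rw [(Backbone.mem_children.1 hu).2]
  refine (Finset.sum_le_card_nsmul _ _ _ h1).trans ?_
  rw [nsmul_eq_mul]
  refine mul_le_mul_of_nonneg_right (Nat.cast_le.2 ?_) (hf v)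
  refine le_trans (Finset.card_le_card fun u hu => ?_) (N.G.degree_le_maxDegree v)
  obtain ⟨h2, h3⟩ := Backbone.mem_children.1 hu
  rw [SimpleGraph.mem_neighborFinset, ← h3]
  exact (N.B.adj_parent u h2).symm

/-- The weight of all that is still to be sent. -/
def potential (N : Network n) (ρ : ℝ) (h : Fin n → ℕ) (s : Fin n → NodeState n) : ℝ :=
  n * ρ⁻¹ ^ (N.S.card ⌈/⌉ N.c + 1) * upPotential N ρ h s + downPotential N ρ h s

theorem potential_nonneg (hρ : 0 < ρ) : 0 ≤ potential N ρ h s :=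
  add_nonneg (mul_nonneg (by positivity) (upPotential_nonneg hρ)) (downPotential_nonneg hρ)

/-! ### Contraction of the potentials -/

section Contraction

variable [NeZero N.m] [DecidableRel N.G.Adj]

/-- Every node has one parent, so the weights to which idle nodes are charged are used at most once
each: one further `ρ`. -/
theorem Inv.avg_upPotential_le (hI : Inv N T₀ t s) (hs : Settled N T s) (hm : 2 ≤ N.m)
    (hρ : 0 < ρ) (hρ1 : ρ ≤ 1) (hh : ∀ v, v ≠ N.B.root → h (N.B.parent v) < h v)
    (hp1 : p ≤ 1) (hp : p ≤ (1 - 1 / (N.m : ℝ)) ^ (2 * N.G.maxDegree)) :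
    avg (fun x => upPotential N ρ h (N.step (gossipRule T) s x)) ≤
      (1 - p + 2 * ρ) * upPotential N ρ h s := by
  unfold upPotential
  rw [avg_sum]
  have key : ∀ v, avg (fun x => upWeight N ρ h (N.step (gossipRule T) s x) v) ≤
      (1 - p + ρ) * upWeight N ρ h s v + ρ * ∑ u ∈ N.B.children v, upWeight N ρ h s u := by
    intro v
    have h0 : 0 ≤ ∑ u ∈ N.B.children v, upWeight N ρ h s u :=
      Finset.sum_nonneg fun _ _ => upWeight_nonneg hρ
    by_cases hb : (s v).UpBusy
    · exact (hI.avg_upWeight_le hm hρ hρ1 hp1 hp hb).trans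
        (le_add_of_nonneg_right (mul_nonneg hρ.le h0))
    · refine (avg_mono fun x => upWeight_step_le hρ hρ1 x).trans ?_
      rw [avg_const]
      exact (hI.upWeight_idle_le hs hρ hρ1 hh hb).trans
        (le_add_of_nonneg_left (mul_nonneg (by linarith) (upWeight_nonneg hρ)))
  refine (Finset.sum_le_sum fun v _ => key v).trans ?_
  rw [Finset.sum_add_distrib, ← Finset.mul_sum, ← Finset.mul_sum]
  have := mul_le_mul_of_nonneg_left (sum_children_le (N := N)
    (f := fun u => upWeight N ρ h s u) fun u => upWeight_nonneg hρ) hρ.le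
  linarith

/-- A weight is charged by its siblings and by its children, each at most `Δ` in number, whence `2 *
Δ * ρ`. -/
theorem Inv.avg_downPotential_le (hI : Inv N T₀ t s) (hs : Settled N T s) (hm : 2 ≤ N.m)
    (hT : T (N.localView N.B.root) ≤ t) (hρ : 0 < ρ) (hρ1 : ρ ≤ 1)
    (hh : ∀ v, v ≠ N.B.root → h (N.B.parent v) < h v)
    (hfin : ∀ v, v ≠ N.B.root → (s v).Finished)
    (hp1 : p ≤ 1) (hp : p ≤ (1 - 1 / (N.m : ℝ)) ^ (2 * N.G.maxDegree)) :
    avg (fun x => downPotential N ρ h (N.step (gossipRule T) s x)) ≤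
      (1 - p + (1 + 2 * N.G.maxDegree) * ρ) * downPotential N ρ h s := by
  unfold downPotential
  rw [avg_sum]
  have hw0 : ∀ u, 0 ≤ downWeight N ρ h s u := fun u => downWeight_nonneg hρ
  set F : Fin n → ℝ := fun v => (∑ u' ∈ N.B.children v, downWeight N ρ h s u') +
    downWeight N ρ h s v
  have hF : ∀ v, 0 ≤ F v := fun v => add_nonneg (Finset.sum_nonneg fun u _ => hw0 u) (hw0 v)
  have key : ∀ u, avg (fun x => downWeight N ρ h (N.step (gossipRule T) s x) u) ≤
      (1 - p + ρ) * downWeight N ρ h s u +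
        ρ * if u = N.B.root then 0 else F (N.B.parent u) := by
    intro u
    by_cases hu : u = N.B.root
    · have h1 : ∀ s, downWeight N ρ h s u = 0 := fun s => by rw [downWeight, if_pos (Or.inl hu)]
      rw [if_pos hu]
      simp only [h1, mul_zero, add_zero]
      rw [avg_const]
    rw [if_neg hu]
    by_cases hw : (s (N.B.parent u)).Waits u
    · exact (hI.avg_downWeight_le hm hρ hρ1 hp1 hp hfin hu hw).trans
        (le_add_of_nonneg_right (mul_nonneg hρ.le (hF _)))
    · refine (avg_mono fun x => downWeight_step_le hρ hρ1 x).trans ?_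
      rw [avg_const]
      exact (hI.downWeight_idle_le hs hT hρ hρ1 hh hfin hu hw).trans
        (le_add_of_nonneg_left (mul_nonneg (by linarith) (hw0 u)))
  refine (Finset.sum_le_sum fun v _ => key v).trans ?_
  rw [Finset.sum_add_distrib, ← Finset.mul_sum, ← Finset.mul_sum]
  have h1 := mul_le_mul_of_nonneg_left (sum_parent_le (N := N) hF) hρ.le
  have h2 : ∑ v, F v ≤ 2 * ∑ u, downWeight N ρ h s u := by
    simp only [F]
    rw [Finset.sum_add_distrib, two_mul]
    exact add_le_add_left (sum_children_le (N := N) hw0) _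
  have h3 := mul_le_mul_of_nonneg_left h2 (show 0 ≤ ρ * (N.G.maxDegree : ℝ) by positivity)
  linarith

/-- The downward part is known to contract only after the upward part has vanished. Until then the
factor in front of the latter is so large that its slack `ρ` covers the downward part, which is at
most `n`. -/
theorem Inv.avg_potential_le (hI : Inv N T₀ t s) (hs : Settled N T s) (hm : 2 ≤ N.m)
    (hc : 1 ≤ N.c) (hT : T (N.localView N.B.root) ≤ t) (hρ : 0 < ρ) (hρ1 : ρ ≤ 1)
    (hh : ∀ v, v ≠ N.B.root → h (N.B.parent v) < h v)
    (hp1 : p ≤ 1) (hp : p ≤ (1 - 1 / (N.m : ℝ)) ^ (2 * N.G.maxDegree)) :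
    avg (fun x => potential N ρ h (N.step (gossipRule T) s x)) ≤
      (1 - p + (3 + 2 * N.G.maxDegree) * ρ) * potential N ρ h s := by
  have hup := hI.avg_upPotential_le hs hm hρ hρ1 hh hp1 hp
  set b : ℝ := n * ρ⁻¹ ^ (N.S.card ⌈/⌉ N.c + 1)
  have hb : 0 ≤ b := by positivity
  have hΔ : (0 : ℝ) ≤ N.G.maxDegree := Nat.cast_nonneg _
  have hU := upPotential_nonneg (N := N) (h := h) (s := s) hρ
  have hD := downPotential_nonneg (N := N) (h := h) (s := s) hρ
  have hsplit : avg (fun x => potential N ρ h (N.step (gossipRule T) s x)) =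
      b * avg (fun x => upPotential N ρ h (N.step (gossipRule T) s x)) +
        avg (fun x => downPotential N ρ h (N.step (gossipRule T) s x)) := by
    unfold potential
    rw [avg_add, avg_const_mul]
  rw [hsplit]
  change _ ≤ _ * (b * _ + _)
  have hup' := mul_le_mul_of_nonneg_left hup hb
  have hbU : 0 ≤ b * upPotential N ρ h s := mul_nonneg hb hU
  by_cases hfin : ∀ v, v ≠ N.B.root → (s v).Finished
  · have hdown := hI.avg_downPotential_le hs hm hT hρ hρ1 hh hfin hp1 hp
    nlinarith [mul_nonneg hρ.le hbU, mul_nonneg hρ.le hD, mul_nonneg hΔ (mul_nonneg hρ.le hbU)]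
  · push Not at hfin
    obtain ⟨v, hv, hf⟩ := hfin
    have hle := hI.le_upPotential (h := h) hc hρ hρ1 hv hf
    have hdown : avg (fun x => downPotential N ρ h (N.step (gossipRule T) s x)) ≤ n := by
      refine (avg_mono fun x => downPotential_le hρ hρ1).trans ?_
      rw [avg_const]
    -- The exponent `K + 1` in `potential` is made for this: `ρ ^ K` is the least positive size of
    -- the upward part, and one more `ρ` is given away.
    have hn : (n : ℝ) ≤ ρ * (b * upPotential N ρ h s) := by
      calc (n : ℝ) = ρ * (b * ρ ^ (N.S.card ⌈/⌉ N.c)) := by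
            simp only [b, pow_succ, inv_pow]
            field_simp
        _ ≤ _ := by gcongr
    have h1 : 0 ≤ (1 - p + (3 + 2 * N.G.maxDegree) * ρ) * downPotential N ρ h s :=
      mul_nonneg (by nlinarith [mul_nonneg hΔ hρ.le]) hD
    nlinarith [mul_nonneg hΔ (mul_nonneg hρ.le hbU)]

end Contraction

end Potential

/-! ### The expected number of messages -/

section Messages

variable {n : ℕ} {N : Network n}

/-- The number of receivers from which acknowledgments are pending. -/
def NodeState.pending (s : NodeState n) : ℕ :=
  match s.job with
  | none => 0
  | some j => j.2.card

/-- The number of receivers of the messages of `v`, with multiplicity. -/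
def Network.begun (N : Network n) (v : Fin n) (s : NodeState n) : ℕ :=
  (s.outbox.map fun g => (N.receivers v g).card).sum

variable {T : LocalView n → ℕ} {T₀ t : ℕ} {s : Fin n → NodeState n} {v u : Fin n} {p : ℝ}

theorem pending_of_none {s : NodeState n} (h : s.job = none) : s.pending = 0 := by
  simp [NodeState.pending, h]

theorem pending_of_some {s : NodeState n} {g : Msg n} {R : Finset (Fin n)}
    (h : s.job = some (g, R)) : s.pending = R.card := by
  simp [NodeState.pending, h]

theorem Inv.pending_le_begun (hI : Inv N T₀ t s) (v : Fin n) :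
    (s v).pending ≤ N.begun v (s v) := by
  cases hj : (s v).job with
  | none => rw [pending_of_none hj]; exact Nat.zero_le _
  | some j =>
    obtain ⟨g, R⟩ := j
    obtain ⟨h1, h2, _⟩ := hI.job_mem v g R hj
    rw [pending_of_some hj]
    refine (Finset.card_le_card h2).trans (List.le_sum_of_mem ?_)
    exact List.mem_map.2 ⟨g, h1, rfl⟩

theorem load_begun (P : Rule n) (v : Fin n) (s : NodeState n) :
    (N.begun v (N.load P v s) : ℝ) - (N.load P v s).pending = N.begun v s - s.pending := by
  rcases N.load_cases P v s with ⟨he, _⟩ | ⟨g, hj, _, _, he⟩ <;> rw [he]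
  rw [pending_of_none hj, pending_of_some (s := N.push v s g) rfl]
  simp [Network.begun, Network.push]

open Classical in
theorem afterRound_pending {m : ℕ} {G : SimpleGraph (Fin n)} (x : Fin n → Fin m × Fin m)
    {g : Msg n} {R : Finset (Fin n)} (hj : (s v).job = some (g, R)) :
    ((afterRound G s x v).pending : ℝ) = R.card - ∑ u ∈ R, if GotAck G s x v u then (1 : ℝ) else 0 := by
  have h1 : (afterRound G s x v).pending = (remaining G s x v R).card := by
    by_cases h : (remaining G s x v R).Nonempty
    · exact pending_of_some (afterRound_job.2 ⟨R, hj, rfl, h⟩)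
    · rw [Finset.not_nonempty_iff_eq_empty] at h
      rw [h, Finset.card_empty]
      refine pending_of_none ?_
      simp [afterRound, hj, h]
  rw [h1, remaining, Finset.sum_boole, eq_sub_iff_add_eq, ← Nat.cast_add]
  congr 1
  rw [add_comm]
  convert Finset.card_filter_add_card_filter_not (s := R) fun u => GotAck G s x v u

/-- The number of acknowledgments that have arrived. -/
def acknowledged (N : Network n) (s : Fin n → NodeState n) : ℝ :=
  ∑ v, ((N.begun v (s v) : ℝ) - (s v).pending)

def totalPending (s : Fin n → NodeState n) : ℝ := ∑ v, ((s v).pending : ℝ)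

open Classical in
/-- The indicator of the event that some message to a parent is not yet dealt with. -/
def unfinished (N : Network n) (s : Fin n → NodeState n) : ℝ :=
  if ∀ v, v ≠ N.B.root → (s v).Finished then 0 else 1

theorem unfinished_nonneg : 0 ≤ unfinished N s := by
  unfold unfinished
  split_ifs
  · exact le_rfl
  · exact zero_le_one

theorem Inv.acknowledged_nonneg (hI : Inv N T₀ t s) : 0 ≤ acknowledged N s :=
  Finset.sum_nonneg fun v _ => sub_nonneg.2 (Nat.cast_le.2 (hI.pending_le_begun v))

theorem totalPending_nonneg (s : Fin n → NodeState n) : 0 ≤ totalPending s :=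
  Finset.sum_nonneg fun _ _ => Nat.cast_nonneg _

/-- The drift of the number of acknowledged pairs is at least `p` per pending pair. The exception
are downward messages that coexist with upward ones: they are charged in full, which costs at most
one unit per tree edge and cannot happen before `T₀`. -/
theorem Inv.pending_add_acknowledged_le [NeZero N.m] [DecidableRel N.G.Adj]
    (hI : Inv N T₀ t s) (hm : 2 ≤ N.m) (hp1 : p ≤ 1)
    (hp : p ≤ (1 - 1 / (N.m : ℝ)) ^ (2 * N.G.maxDegree)) :
    p * totalPending s + acknowledged N s ≤
      avg (fun x => acknowledged N (N.step (gossipRule T) s x)) +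
        (if T₀ ≤ t then n * unfinished N s else 0) := by
  classical
  have key : ∀ v, p * (s v).pending + ((N.begun v (s v) : ℝ) - (s v).pending) ≤
      avg (fun x => (N.begun v (N.step (gossipRule T) s x v) : ℝ) -
        (N.step (gossipRule T) s x v).pending) +
        (if T₀ ≤ t then (N.B.children v).card * unfinished N s else 0) := by
    intro v
    have hstep : ∀ x, (N.begun v (N.step (gossipRule T) s x v) : ℝ) -
        (N.step (gossipRule T) s x v).pending =
        N.begun v (s v) - (MultiBroadcast.afterRound N.G s x v).pending := fun x => load_begun _ _ _
    simp_rw [hstep]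
    have hextra : (0 : ℝ) ≤ (if T₀ ≤ t then (N.B.children v).card * unfinished N s else 0) := by
      split_ifs
      · exact mul_nonneg (Nat.cast_nonneg _) unfinished_nonneg
      · exact le_rfl
    cases hj : (s v).job with
    | none =>
      have h0 : ∀ x : Fin n → Fin N.m × Fin N.m, (MultiBroadcast.afterRound N.G s x v).pending = 0 := by
        intro x
        refine pending_of_none ?_
        simp [MultiBroadcast.afterRound, hj]
      simp_rw [h0]
      rw [avg_const, pending_of_none hj]
      simpa using hextra
    | some j =>
      obtain ⟨g, R⟩ := j
      obtain ⟨hgo, hRsub, hRne⟩ := hI.job_mem v g R hj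
      simp_rw [afterRound_pending _ hj]
      rw [pending_of_some hj]
      have hsum : avg (fun x : Fin n → Fin N.m × Fin N.m => (N.begun v (s v) : ℝ) -
          (R.card - ∑ u ∈ R, if GotAck N.G s x v u then (1 : ℝ) else 0)) =
          (N.begun v (s v) - R.card) + ∑ u ∈ R,
            avg (fun x : Fin n → Fin N.m × Fin N.m => if GotAck N.G s x v u then (1 : ℝ) else 0) := by
        rw [← avg_sum, ← avg_const (Ω := Fin n → Fin N.m × Fin N.m)
          ((N.begun v (s v) : ℝ) - R.card), ← avg_add]
        congr 1
        funext x
        ring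
      rw [hsum]
      have hgood : (g.up = true ∨ ∀ v, v ≠ N.B.root → (s v).Finished) →
          p * R.card ≤ ∑ u ∈ R, avg (fun x : Fin n → Fin N.m × Fin N.m => if GotAck N.G s x v u then (1 : ℝ) else 0) := by
        intro hor
        rw [mul_comm, ← nsmul_eq_mul]
        refine Finset.card_nsmul_le_sum _ _ _ fun u hu => ?_
        refine hp.trans ?_
        by_cases hg : g.up = true
        · obtain ⟨hv, hR⟩ := hI.job_up hj hg
          rw [hR, Finset.mem_singleton] at hu
          subst hu
          exact le_avg_gotAck hm hj (by rw [hR]; exact Finset.mem_singleton_self _)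
            (N.B.adj_parent v hv).symm (Or.inl ⟨hg, hR⟩)
        · have huc := hRsub hu
          rw [Network.receivers_down (by simpa using hg)] at huc
          obtain ⟨h1, h2⟩ := Backbone.mem_children.1 huc
          have hadj := N.B.adj_parent u h1
          rw [h2] at hadj
          refine le_avg_gotAck hm hj hu hadj (Or.inr fun w g' R' hjw => ?_)
          cases hgu : g'.up with
          | false => rfl
          | true =>
            exact absurd ⟨g', R', hjw, hgu⟩ ((hor.resolve_left hg) w (hI.job_up hjw hgu).1).2
      by_cases hor : g.up = true ∨ ∀ v, v ≠ N.B.root → (s v).Finished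
      · have := hgood hor
        linarith
      · rw [not_or] at hor
        have hg : g.up = false := by simpa using hor.1
        have hT : T₀ ≤ t := hI.early v g (NodeState.mem_downs.2 ⟨hgo, hg⟩)
        rw [if_pos hT, unfinished, if_neg hor.2, mul_one]
        have h1 : 0 ≤ ∑ u ∈ R, avg (fun x : Fin n → Fin N.m × Fin N.m =>
            if GotAck N.G s x v u then (1 : ℝ) else 0) :=
          Finset.sum_nonneg fun u _ => avg_nonneg fun x => by split_ifs <;> simp
        have h2 : (R.card : ℝ) ≤ (N.B.children v).card := by
          rw [Network.receivers_down hg] at hRsub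
          exact Nat.cast_le.2 (Finset.card_le_card hRsub)
        have h3 : p * R.card ≤ R.card := mul_le_of_le_one_left (Nat.cast_nonneg _) hp1
        linarith
  have hsumc : ∑ v, ((N.B.children v).card : ℝ) ≤ n := by
    have := sum_children_le (N := N) (f := fun _ => (1 : ℝ)) fun _ => zero_le_one
    simpa using this
  calc p * totalPending s + acknowledged N s
      = ∑ v, (p * (s v).pending + ((N.begun v (s v) : ℝ) - (s v).pending)) := by
        rw [totalPending, acknowledged, Finset.mul_sum, Finset.sum_add_distrib]
    _ ≤ _ := Finset.sum_le_sum fun v _ => key v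
    _ ≤ _ := by
        rw [Finset.sum_add_distrib, ← avg_sum]
        refine add_le_add le_rfl ?_
        split_ifs
        · rw [← Finset.sum_mul]
          exact mul_le_mul_of_nonneg_right hsumc unfinished_nonneg
        · simp

/-- A transmitter has a pending receiver, and each acknowledgment answers a pending pair. -/
theorem Inv.roundMessages_le (hI : Inv N T₀ t s) {m : ℕ} (x : Fin n → Fin m × Fin m) :
    (roundMessages N.G s x : ℝ) ≤ 2 * totalPending s := by
  classical
  have h1 : (Finset.univ.filter fun v => (s v).job.isSome).card ≤ ∑ v, (s v).pending := by
    rw [Finset.card_filter]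
    refine Finset.sum_le_sum fun v _ => ?_
    split_ifs with h
    · obtain ⟨⟨g, R⟩, hj⟩ := Option.isSome_iff_exists.1 h
      rw [pending_of_some hj]
      exact Finset.card_pos.2 (hI.job_mem v g R hj).2.2
    · exact Nat.zero_le _
  have h2 : (Finset.univ.filter fun q : Fin n × Fin m => AcksIn N.G s x q.2 q.1).card ≤
      ∑ v, (s v).pending := by
    have hsub : (Finset.univ.filter fun q : Fin n × Fin m => AcksIn N.G s x q.2 q.1) ⊆
        Finset.univ.biUnion fun v => (((s v).job.map Prod.snd).getD ∅).image
          fun u => (u, ackSlot s x u v) := by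
      rintro ⟨u, y⟩ hq
      obtain ⟨v, hm, hy⟩ := (Finset.mem_filter.1 hq).2
      obtain ⟨g, R, hj, hu⟩ := hm.job
      refine Finset.mem_biUnion.2 ⟨v, Finset.mem_univ v, Finset.mem_image.2 ⟨u, ?_, ?_⟩⟩
      · simpa [hj] using hu
      · exact Prod.ext rfl hy
    refine (Finset.card_le_card hsub).trans (Finset.card_biUnion_le.trans ?_)
    refine Finset.sum_le_sum fun v _ => Finset.card_image_le.trans ?_
    cases hj : (s v).job with
    | none => simp
    | some j => simp [NodeState.pending, hj]
  have h3 : roundMessages N.G s x ≤ 2 * ∑ v, (s v).pending := by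
    unfold roundMessages
    have := Nat.add_le_add h1 h2
    rw [two_mul]
    convert this
  have h4 : ((2 * ∑ v, (s v).pending : ℕ) : ℝ) = 2 * totalPending s := by
    push_cast [totalPending]
    rfl
  rw [← h4]
  exact Nat.cast_le.2 h3

/-- One last message per node, full batches from inner nodes only, and at most `K` downward messages
over each of the fewer than `n + 1` tree edges. -/
theorem Inv.acknowledged_le (hI : Inv N T₀ t s) (hc : 1 ≤ N.c)
    (hD : ∀ v, v ≠ N.B.root → N.B.parent v ∈ N.B.D) :
    acknowledged N s ≤ n + (N.S.card ⌈/⌉ N.c) * N.B.D.card + (N.S.card ⌈/⌉ N.c) * n := by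
  classical
  set K := N.S.card ⌈/⌉ N.c
  have hbeg : ∀ v, N.begun v (s v) ≤ (s v).ups.length + (s v).downs.length * (N.B.children v).card := by
    intro v
    unfold Network.begun NodeState.ups NodeState.downs
    induction (s v).outbox with
    | nil => simp
    | cons g l ih =>
      cases hg : g.up with
      | false =>
        simp only [List.map_cons, List.sum_cons, hg, Network.receivers_down, List.filter_cons,
          Bool.false_eq_true, if_false, Bool.not_false, if_true, List.length_cons]
        rw [add_mul, one_mul]
        omega
      | true =>
        have : (N.receivers v g).card ≤ 1 := by
          by_cases hv : v = N.B.root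
          · rw [hv, Network.receivers_up_root hg]
            simp
          · rw [Network.receivers_up hg hv]
            simp
        simp only [List.map_cons, List.sum_cons, hg, List.filter_cons,
          Bool.false_eq_true, if_false, Bool.not_true, if_true, List.length_cons]
        omega
  have hup : ∀ v, (s v).ups.length ≤ 1 + if v ∈ N.B.D then K else 0 := by
    intro v
    have h1 := (s v).length_ups
    have h2 := hI.finals_le v
    split_ifs with hv
    · have : (s v).fulls.length ≤ K := hI.fulls_le hc v
      omega
    · have : N.B.children v = ∅ := by
        rw [Finset.eq_empty_iff_forall_notMem]
        intro u hu
        obtain ⟨h3, h4⟩ := Backbone.mem_children.1 hu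
        exact hv (h4 ▸ hD u h3)
      rw [hI.leaf v this, List.length_nil] at h1
      omega
  have hsumc : ∑ v, ((N.B.children v).card : ℝ) ≤ n := by
    have := sum_children_le (N := N) (f := fun _ => (1 : ℝ)) fun _ => zero_le_one
    simpa using this
  calc acknowledged N s ≤ ∑ v, ((1 + if v ∈ N.B.D then (K : ℝ) else 0) +
        K * (N.B.children v).card) := by
        refine Finset.sum_le_sum fun v _ => ?_
        have h1 : (N.begun v (s v) : ℝ) ≤
            (s v).ups.length + (s v).downs.length * (N.B.children v).card := by
          exact_mod_cast hbeg v
        have h2 : ((s v).ups.length : ℝ) ≤ 1 + if v ∈ N.B.D then (K : ℝ) else 0 := by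
          have := hup v
          split_ifs at this ⊢ <;> exact_mod_cast this
        have h3 : ((s v).downs.length : ℝ) * (N.B.children v).card ≤ K * (N.B.children v).card :=
          mul_le_mul_of_nonneg_right (Nat.cast_le.2 (hI.down_len v)) (Nat.cast_nonneg _)
        have h4 : (0 : ℝ) ≤ (s v).pending := Nat.cast_nonneg _
        linarith
    _ = n + K * N.B.D.card + K * ∑ v, ((N.B.children v).card : ℝ) := by
        rw [Finset.sum_add_distrib, Finset.sum_add_distrib, Finset.mul_sum, Finset.sum_ite_mem]
        simp [mul_comm]
    _ ≤ _ := by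
        have := mul_le_mul_of_nonneg_left hsumc (Nat.cast_nonneg (α := ℝ) K)
        linarith

theorem Network.settled_loaded (ω : Draws n N.m) (t : ℕ) :
    Settled N T (N.loaded (gossipRule T) ω t) :=
  settled_load T _

/-! ### Expectations along the execution -/

section Expectation

variable [NeZero N.m]

/-- The expectation of `f` at the beginning of round `t`. -/
def expect (N : Network n) [NeZero N.m] (T : LocalView n → ℕ) (t : ℕ)
    (f : (Fin n → NodeState n) → ℝ) : ENNReal :=
  ∫⁻ ω, ENNReal.ofReal (f (N.loaded (gossipRule T) ω t)) ∂(drawMeasure n N.m)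

theorem measurable_loaded (t : ℕ) (f : (Fin n → NodeState n) → ℝ) :
    Measurable fun ω => ENNReal.ofReal (f (N.loaded (gossipRule T) ω t)) :=
  ((N.loaded_dependsOnFirst (gossipRule T) t).comp fun s => ENNReal.ofReal (f s)).measurable

theorem expect_succ {f : (Fin n → NodeState n) → ℝ} (hf : ∀ s, 0 ≤ f s) (t : ℕ) :
    expect N T (t + 1) f = expect N T t fun s => avg fun x => f (N.step (gossipRule T) s x) :=
  N.lintegral_step (gossipRule T) t (fun s x => f (N.step (gossipRule T) s x)) fun _ _ => hf _

theorem expect_mono {f g : (Fin n → NodeState n) → ℝ}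
    (h : ∀ ω, f (N.loaded (gossipRule T) ω t) ≤ g (N.loaded (gossipRule T) ω t)) :
    expect N T t f ≤ expect N T t g :=
  lintegral_mono fun ω => ENNReal.ofReal_le_ofReal (h ω)

theorem expect_add_le {f g f' g' : (Fin n → NodeState n) → ℝ}
    (hf : ∀ ω, 0 ≤ f (N.loaded (gossipRule T) ω t)) (hg : ∀ ω, 0 ≤ g (N.loaded (gossipRule T) ω t))
    (h : ∀ ω, f (N.loaded (gossipRule T) ω t) + g (N.loaded (gossipRule T) ω t) ≤
      f' (N.loaded (gossipRule T) ω t) + g' (N.loaded (gossipRule T) ω t)) :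
    expect N T t f + expect N T t g ≤ expect N T t f' + expect N T t g' := by
  have hadd : ∀ f₁ f₂ : (Fin n → NodeState n) → ℝ, expect N T t f₁ + expect N T t f₂ =
      ∫⁻ ω, (ENNReal.ofReal (f₁ (N.loaded (gossipRule T) ω t)) +
        ENNReal.ofReal (f₂ (N.loaded (gossipRule T) ω t))) ∂(drawMeasure n N.m) :=
    fun f₁ f₂ => (lintegral_add_left (measurable_loaded t f₁) _).symm
  rw [hadd, hadd]
  refine lintegral_mono fun ω => ?_
  dsimp only
  rw [← ENNReal.ofReal_add (hf ω) (hg ω)]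
  exact (ENNReal.ofReal_le_ofReal (h ω)).trans ENNReal.ofReal_add_le

theorem expect_const_mul {a : ℝ} (ha : 0 ≤ a) (f : (Fin n → NodeState n) → ℝ) :
    expect N T t (fun s => a * f s) = ENNReal.ofReal a * expect N T t f := by
  unfold expect
  simp_rw [ENNReal.ofReal_mul ha]
  exact lintegral_const_mul _ (measurable_loaded t f)

theorem expect_le_of_le {f : (Fin n → NodeState n) → ℝ} {a : ℝ}
    (h : ∀ ω, f (N.loaded (gossipRule T) ω t) ≤ a) : expect N T t f ≤ ENNReal.ofReal a := by
  refine (lintegral_mono fun ω => ENNReal.ofReal_le_ofReal (h ω)).trans ?_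
  simp

theorem expect_geometric {f : (Fin n → NodeState n) → ℝ} (hf : ∀ s, 0 ≤ f s) {lam M : ℝ}
    (hlam : 0 ≤ lam) {t₀ : ℕ} (hM : ∀ ω, f (N.loaded (gossipRule T) ω t₀) ≤ M)
    (hstep : ∀ t, t₀ ≤ t → ∀ ω, avg (fun x => f (N.step (gossipRule T)
      (N.loaded (gossipRule T) ω t) x)) ≤ lam * f (N.loaded (gossipRule T) ω t)) (i : ℕ) :
    expect N T (t₀ + i) f ≤ ENNReal.ofReal (M * lam ^ i) := by
  induction i with
  | zero => simpa using expect_le_of_le hM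
  | succ i ih =>
    rw [← add_assoc, expect_succ hf]
    refine (expect_mono (g := fun s => lam * f s) fun ω => hstep _ (by omega) ω).trans ?_
    rw [expect_const_mul hlam]
    refine (mul_le_mul_right ih _).trans ?_
    rw [← ENNReal.ofReal_mul hlam]
    exact ENNReal.ofReal_le_ofReal (le_of_eq (by ring))

/-- The drift inequality, telescoped. The truncation at 0 makes the function non-negative on all
states, not only on those that satisfy the invariants, as `expect_succ` demands. -/
theorem sum_expect_pending_le [DecidableRel N.G.Adj] (hc : 1 ≤ N.c) (hm : 2 ≤ N.m)
    (hp0 : 0 ≤ p) (hp1 : p ≤ 1) (hp : p ≤ (1 - 1 / (N.m : ℝ)) ^ (2 * N.G.maxDegree)) (τ : ℕ) :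
    ∑ t ∈ Finset.range τ, expect N T t (fun s => p * totalPending s) ≤
      expect N T τ (fun s => max 0 (acknowledged N s)) +
        ∑ t ∈ Finset.range τ, expect N T t (fun s =>
          if T (N.localView N.B.root) ≤ t then n * unfinished N s else 0) := by
  induction τ with
  | zero => simp
  | succ τ ih =>
    rw [Finset.sum_range_succ, Finset.sum_range_succ]
    have hA : expect N T τ (fun s => max 0 (acknowledged N s)) +
        expect N T τ (fun s => p * totalPending s) ≤
        expect N T (τ + 1) (fun s => max 0 (acknowledged N s)) +
        expect N T τ (fun s => if T (N.localView N.B.root) ≤ τ then n * unfinished N s else 0) := by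
      rw [expect_succ fun s => le_max_left _ _]
      refine expect_add_le (fun ω => le_max_left _ _)
        (fun ω => mul_nonneg hp0 (totalPending_nonneg _)) fun ω => ?_
      have hI := N.inv_loaded (T := T) hc ω τ
      have h1 := hI.pending_add_acknowledged_le (T := T) hm hp1 hp
      have h2 : avg (fun x => acknowledged N (N.step (gossipRule T)
          (N.loaded (gossipRule T) ω τ) x)) ≤ avg (fun x => max 0 (acknowledged N
            (N.step (gossipRule T) (N.loaded (gossipRule T) ω τ) x))) :=
        avg_mono fun x => le_max_right _ _
      rw [max_eq_right hI.acknowledged_nonneg]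
      linarith
    calc _ ≤ (expect N T τ (fun s => max 0 (acknowledged N s)) +
        ∑ t ∈ Finset.range τ, expect N T t (fun s =>
          if T (N.localView N.B.root) ≤ t then n * unfinished N s else 0)) +
          expect N T τ (fun s => p * totalPending s) := add_le_add_left ih _
      _ = (expect N T τ (fun s => max 0 (acknowledged N s)) +
          expect N T τ (fun s => p * totalPending s)) +
          ∑ t ∈ Finset.range τ, expect N T t (fun s =>
          if T (N.localView N.B.root) ≤ t then n * unfinished N s else 0) := by ring
      _ ≤ _ := add_le_add_left hA _
      _ = _ := by ring

end Expectation
end Messages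

/-! ### The expected costs -/

/-- A trivial bound up to `t₀`, then a geometric tail of total at most `a / (1 - lam) ≤ 1`. -/
theorem sum_delayed_geometric_le {a b lam : ℝ} (hb : 0 ≤ b) (hlam : 0 ≤ lam)
    (h : a ≤ 1 - lam) (t₀ τ : ℕ) :
    ∑ t ∈ Finset.range τ, (if t₀ ≤ t then a * lam ^ (t - t₀) else b) ≤ b * t₀ + 1 := by
  have key : ∑ t ∈ Finset.range τ, (if t₀ ≤ t then a * lam ^ (t - t₀) else b) ≤
      b * (min τ t₀ : ℕ) + ∑ i ∈ Finset.range (τ - t₀), a * lam ^ i := by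
    induction τ with
    | zero => simp
    | succ τ ih =>
      rw [Finset.sum_range_succ]
      split_ifs with h1
      · rw [Nat.succ_sub h1, Finset.sum_range_succ, min_eq_right (by omega)]
        rw [min_eq_right h1] at ih
        linarith
      · rw [min_eq_left (by omega : τ + 1 ≤ t₀), Nat.sub_eq_zero_of_le (by omega : τ + 1 ≤ t₀)]
        rw [min_eq_left (by omega : τ ≤ t₀), Nat.sub_eq_zero_of_le (by omega : τ ≤ t₀)] at ih
        push_cast
        linarith
  refine key.trans (add_le_add ?_ ?_)
  · exact mul_le_mul_of_nonneg_left (Nat.cast_le.2 (min_le_right _ _)) hb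
  · rw [← Finset.mul_sum]
    have h1 := geom_sum_mul_neg lam (τ - t₀)
    have h2 : 0 ≤ ∑ i ∈ Finset.range (τ - t₀), lam ^ i := Finset.sum_nonneg fun i _ => by positivity
    have h3 : 0 ≤ lam ^ (τ - t₀) := by positivity
    nlinarith [mul_le_mul_of_nonneg_right h h2]

/-- If a rumor is missing somewhere, a message is outstanding, and no outstanding message weighs
less than `ρ ^ (K + H)`. The potential thus bounds the probability of incompleteness. -/
theorem Inv.one_le_potential {n : ℕ} {N : Network n} {ρ : ℝ} {h : Fin n → ℕ} {H : ℕ} {T₀ t : ℕ}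
    {s : Fin n → NodeState n} (hI : Inv N T₀ t s)
    (hc : 1 ≤ N.c) (hS : N.c ≤ N.S.card) (hρ : 0 < ρ) (hρ1 : ρ ≤ 1) (hH : ∀ v, h v ≤ H)
    (hbad : ¬ ∀ v, N.S ⊆ N.known v (s v)) :
    1 ≤ ρ⁻¹ ^ (N.S.card ⌈/⌉ N.c + H) * potential N ρ h s := by
  set K := N.S.card ⌈/⌉ N.c
  have hone : ρ⁻¹ ^ (K + H) * ρ ^ (K + H) = 1 := by
    rw [← mul_pow, inv_mul_cancel₀ hρ.ne', one_pow]
  rw [← hone]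
  refine mul_le_mul_of_nonneg_left ?_ (by positivity)
  have hU := upPotential_nonneg (N := N) (h := h) (s := s) hρ
  have hD := downPotential_nonneg (N := N) (h := h) (s := s) hρ
  unfold potential
  by_cases hfin : ∀ v, v ≠ N.B.root → (s v).Finished
  · by_cases hdown : ∀ u, u ≠ N.B.root → K ≤ (s (N.B.parent u)).downCount u
    · exact absurd (hI.known_of_complete hc hS hfin hdown) hbad
    · push Not at hdown
      obtain ⟨u, hu, hlt⟩ := hdown
      exact (le_downPotential hρ hρ1 hH hu hlt).trans
        (le_add_of_nonneg_left (mul_nonneg (by positivity) hU))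
  · push Not at hfin
    obtain ⟨v, hv, hf⟩ := hfin
    have hle := hI.le_upPotential (h := h) hc hρ hρ1 hv hf
    refine le_trans ?_ (le_add_of_nonneg_right hD)
    have hn : (1 : ℝ) ≤ n := by
      have := v.pos
      exact_mod_cast this
    calc ρ ^ (K + H) ≤ ρ ^ K := pow_le_pow_of_le_one hρ.le hρ1 (by omega)
      _ = 1 * 1 * ρ ^ K := by ring
      _ ≤ n * ρ⁻¹ ^ (K + 1) * upPotential N ρ h s := by
          have := one_le_inv_pow hρ hρ1 (K + 1)
          gcongr

theorem Network.known_loaded {n : ℕ} (N : Network n) (P : Rule n) (ω : Draws n N.m) (t : ℕ) (v : Fin n) :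
    N.known v (N.loaded P ω t v) = N.known v (N.state P ω t v) := by
  have h1 : ∀ g, (N.loaded P ω t v).Received g ↔ (N.state P ω t v).Received g := by
    intro g
    unfold NodeState.Received Network.loaded
    rw [N.load_inbox]
  ext a
  simp [Network.known, h1]

open Classical in
theorem Network.time_le {n : ℕ} (N : Network n) [NeZero N.m] (P : Rule n)
    (ω : Draws n N.m) : N.time P ω ≤
    ∑' t, ENNReal.ofReal (2 * N.m * if ∀ v, N.S ⊆ N.known v (N.loaded P ω t v) then 0 else 1) := by
  by_cases hex : ∃ t, ∀ v, N.S ⊆ N.known v (N.loaded P ω t v)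
  · refine (iInf₂_le (Nat.find hex) fun v => ?_).trans ?_
    · rw [← N.known_loaded]
      exact Nat.find_spec hex v
    · refine le_trans (le_of_eq ?_) (ENNReal.sum_le_tsum (Finset.range (Nat.find hex)))
      rw [Finset.sum_congr rfl (g := fun _ => ENNReal.ofReal (2 * N.m)) fun t ht => by
        rw [if_neg (Nat.find_min hex (Finset.mem_range.1 ht)), mul_one]]
      rw [Finset.sum_const, Finset.card_range, nsmul_eq_mul, ← ENNReal.ofReal_natCast,
        ← ENNReal.ofReal_natCast, ← ENNReal.ofReal_mul (Nat.cast_nonneg _)]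
      congr 1
      push_cast
      ring
  · push Not at hex
    have : ∀ t, ENNReal.ofReal (2 * N.m * if ∀ v, N.S ⊆ N.known v (N.loaded P ω t v) then 0 else 1)
        = ENNReal.ofReal (2 * N.m) := by
      intro t
      rw [if_neg (by push Not; exact hex t), mul_one]
    simp_rw [this]
    rw [ENNReal.tsum_const_eq_top_of_ne_zero]
    · exact le_top
    · have : 0 < N.m := Nat.pos_of_ne_zero (NeZero.ne N.m)
      simp only [ne_eq, ENNReal.ofReal_eq_zero, not_le]
      positivity

/-! ### Expected costs in terms of `p`, `ρ` and the height -/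

section Costs

variable {n : ℕ} {N : Network n} [NeZero N.m] {T : LocalView n → ℕ}
  {ρ p lam : ℝ} {h : Fin n → ℕ} {H : ℕ}

theorem tsum_expect (f : (Fin n → NodeState n) → ℝ) :
    ∑' t, expect N T t f =
      ∫⁻ ω, ∑' t, ENNReal.ofReal (f (N.loaded (gossipRule T) ω t)) ∂drawMeasure n N.m :=
  (lintegral_tsum fun t => (measurable_loaded t f).aemeasurable).symm

variable [DecidableRel N.G.Adj]

/-- Markov's inequality for the upward potential, which contracts from the first round on. -/
theorem expect_unfinished_le (hc : 1 ≤ N.c) (hm : 2 ≤ N.m) (hρ : 0 < ρ) (hρ1 : ρ ≤ 1)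
    (hh : ∀ v, v ≠ N.B.root → h (N.B.parent v) < h v) (hH : ∀ v, h v ≤ H)
    (hp1 : p ≤ 1) (hp : p ≤ (1 - 1 / (N.m : ℝ)) ^ (2 * N.G.maxDegree))
    (hlam : lam = 1 - p + (3 + 2 * N.G.maxDegree) * ρ) (t : ℕ) :
    expect N T t (unfinished N) ≤
      ENNReal.ofReal (ρ⁻¹ ^ (N.S.card ⌈/⌉ N.c) * (n * ρ⁻¹ ^ H) * lam ^ t) := by
  classical
  set K := N.S.card ⌈/⌉ N.c
  have hΔ : (0 : ℝ) ≤ N.G.maxDegree := Nat.cast_nonneg _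
  have hlam0 : 0 ≤ lam := by rw [hlam]; nlinarith [mul_nonneg hΔ hρ.le]
  have hgeo := expect_geometric (N := N) (T := T) (f := upPotential N ρ h)
    (fun s => upPotential_nonneg hρ) hlam0 (t₀ := 0) (fun ω => upPotential_le hρ hρ1 hH)
    (fun t _ ω => by
      refine ((N.inv_loaded (T := T) hc ω t).avg_upPotential_le (N.settled_loaded ω t) hm hρ hρ1
        hh hp1 hp).trans (mul_le_mul_of_nonneg_right ?_ (upPotential_nonneg hρ))
      rw [hlam]
      nlinarith [mul_nonneg hΔ hρ.le]) t
  rw [zero_add] at hgeo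
  refine (expect_mono (g := fun s => ρ⁻¹ ^ K * upPotential N ρ h s) fun ω => ?_).trans ?_
  · rw [unfinished]
    split_ifs with hfin
    · exact mul_nonneg (by positivity) (upPotential_nonneg hρ)
    · push Not at hfin
      obtain ⟨v, hv, hf⟩ := hfin
      have h1 := (N.inv_loaded (T := T) hc ω t).le_upPotential (h := h) hc hρ hρ1 hv hf
      calc (1 : ℝ) = ρ⁻¹ ^ K * ρ ^ K := by rw [← mul_pow, inv_mul_cancel₀ hρ.ne', one_pow]
        _ ≤ _ := mul_le_mul_of_nonneg_left h1 (by positivity)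
  · rw [expect_const_mul (by positivity)]
    refine (mul_le_mul_right hgeo _).trans ?_
    rw [← ENNReal.ofReal_mul (by positivity)]
    exact ENNReal.ofReal_le_ofReal (le_of_eq (by ring))

/-- The hypothesis `hT` says that the root starts late enough for the summed error of the drift
inequality to be at most 1, the last summand. -/
theorem expectedMessages_le (hc : 1 ≤ N.c) (hm : 2 ≤ N.m) (hρ : 0 < ρ) (hρ1 : ρ ≤ 1)
    (hh : ∀ v, v ≠ N.B.root → h (N.B.parent v) < h v) (hH : ∀ v, h v ≤ H)
    (hD : ∀ v, v ≠ N.B.root → N.B.parent v ∈ N.B.D)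
    (hp0 : 0 < p) (hp1 : p ≤ 1) (hp : p ≤ (1 - 1 / (N.m : ℝ)) ^ (2 * N.G.maxDegree))
    (hlam : lam = 1 - p + (3 + 2 * N.G.maxDegree) * ρ)
    (hT : n * (ρ⁻¹ ^ (N.S.card ⌈/⌉ N.c) * (n * ρ⁻¹ ^ H)) *
      lam ^ T (N.localView N.B.root) ≤ 1 - lam) :
    N.expectedMessages (gossipRule T) ≤ ENNReal.ofReal (2 / p * ((n +
      (N.S.card ⌈/⌉ N.c) * N.B.D.card + (N.S.card ⌈/⌉ N.c) * n) + 1)) := by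
  classical
  set K := N.S.card ⌈/⌉ N.c
  set T₀ := T (N.localView N.B.root)
  set A : ℝ := n + K * N.B.D.card + K * n
  have hA : 0 ≤ A := by positivity
  have hΔ : (0 : ℝ) ≤ N.G.maxDegree := Nat.cast_nonneg _
  have hlam0 : 0 ≤ lam := by rw [hlam]; nlinarith [mul_nonneg hΔ hρ.le]
  have h1 : N.expectedMessages (gossipRule T) ≤
      ∑' t, expect N T t fun s => 2 / p * (p * totalPending s) := by
    rw [tsum_expect]
    refine lintegral_mono fun ω => ENNReal.tsum_le_tsum fun t => ?_
    rw [← ENNReal.ofReal_natCast]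
    refine ENNReal.ofReal_le_ofReal ?_
    refine ((N.inv_loaded (T := T) hc ω t).roundMessages_le (ω t)).trans (le_of_eq ?_)
    field_simp
  refine h1.trans ?_
  simp_rw [expect_const_mul (N := N) (T := T) (show 0 ≤ 2 / p by positivity)]
  rw [ENNReal.tsum_mul_left, ENNReal.ofReal_mul (by positivity)]
  refine mul_le_mul_right (ENNReal.tsum_le_of_sum_range_le fun τ => ?_) _
  refine (sum_expect_pending_le hc hm hp0.le hp1 hp τ).trans ?_
  rw [ENNReal.ofReal_add hA zero_le_one]
  refine add_le_add (expect_le_of_le fun ω => max_le hA ?_) ?_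
  · exact (N.inv_loaded (T := T) hc ω τ).acknowledged_le hc hD
  · have hterm : ∀ t, expect N T t (fun s => if T₀ ≤ t then n * unfinished N s else 0) ≤
        ENNReal.ofReal (if T₀ ≤ t then
          (n * (ρ⁻¹ ^ K * (n * ρ⁻¹ ^ H)) * lam ^ T₀) * lam ^ (t - T₀) else 0) := by
      intro t
      split_ifs with ht
      · rw [expect_const_mul (Nat.cast_nonneg n)]
        refine (mul_le_mul_right (expect_unfinished_le hc hm hρ hρ1 hh hH hp1 hp hlam t) _).trans ?_
        rw [← ENNReal.ofReal_mul (Nat.cast_nonneg n)]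
        refine ENNReal.ofReal_le_ofReal (le_of_eq ?_)
        rw [mul_assoc _ (lam ^ T₀), ← pow_add, Nat.add_sub_cancel' ht]
        ring
      · simp [expect]
    refine (Finset.sum_le_sum fun t _ => hterm t).trans ?_
    rw [← ENNReal.ofReal_sum_of_nonneg fun t _ => by split_ifs <;> positivity]
    refine ENNReal.ofReal_le_ofReal ((sum_delayed_geometric_le le_rfl hlam0 hT
      _ _).trans (le_of_eq ?_))
    ring

/-- The rounds before `T₀ + i₀` are counted in full. From `T₀` on the potential decays, starting
from a bound `M` valid in every state, and after `i₀` more rounds the expected number of incomplete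
rounds left is at most 1. -/
theorem expectedTime_le (hc : 1 ≤ N.c) (hS : N.c ≤ N.S.card) (hm : 2 ≤ N.m) (hρ : 0 < ρ)
    (hρ1 : ρ ≤ 1) (hh : ∀ v, v ≠ N.B.root → h (N.B.parent v) < h v) (hH : ∀ v, h v ≤ H)
    (hp1 : p ≤ 1) (hp : p ≤ (1 - 1 / (N.m : ℝ)) ^ (2 * N.G.maxDegree))
    (hlam : lam = 1 - p + (3 + 2 * N.G.maxDegree) * ρ) {i₀ : ℕ}
    (hi₀ : ρ⁻¹ ^ (N.S.card ⌈/⌉ N.c + H) *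
      (n * ρ⁻¹ ^ (N.S.card ⌈/⌉ N.c + 1) * (n * ρ⁻¹ ^ H) + n) * lam ^ i₀ ≤ 1 - lam) :
    N.expectedTime (gossipRule T) ≤
      ENNReal.ofReal (2 * N.m * (T (N.localView N.B.root) + i₀ + 1)) := by
  classical
  set K := N.S.card ⌈/⌉ N.c
  set T₀ := T (N.localView N.B.root)
  have hΔ : (0 : ℝ) ≤ N.G.maxDegree := Nat.cast_nonneg _
  have hlam0 : 0 ≤ lam := by rw [hlam]; nlinarith [mul_nonneg hΔ hρ.le]
  set M : ℝ := n * ρ⁻¹ ^ (K + 1) * (n * ρ⁻¹ ^ H) + n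
  have hM0 : 0 ≤ M := by positivity
  let bad : (Fin n → NodeState n) → ℝ := fun s => if ∀ v, N.S ⊆ N.known v (s v) then 0 else 1
  have hbad1 : ∀ s, bad s ≤ 1 := fun s => by
    simp only [bad]
    split_ifs <;> norm_num
  have h1 : N.expectedTime (gossipRule T) ≤ ∑' t, expect N T t fun s => 2 * N.m * bad s := by
    rw [tsum_expect]
    exact lintegral_mono fun ω => N.time_le _ ω
  refine h1.trans ?_
  simp_rw [expect_const_mul (N := N) (T := T) (show (0 : ℝ) ≤ 2 * N.m by positivity)]
  rw [ENNReal.tsum_mul_left, ENNReal.ofReal_mul (p := 2 * (N.m : ℝ)) (by positivity)]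
  refine mul_le_mul_right (ENNReal.tsum_le_of_sum_range_le fun τ => ?_) _
  have hgeo := expect_geometric (N := N) (T := T) (f := potential N ρ h)
    (fun s => potential_nonneg hρ) hlam0 (t₀ := T₀) (M := M)
    (fun ω => add_le_add (mul_le_mul_of_nonneg_left (upPotential_le hρ hρ1 hH) (by positivity))
      (downPotential_le hρ hρ1))
    (fun t ht ω => by
      rw [hlam]
      exact (N.inv_loaded (T := T) hc ω t).avg_potential_le (N.settled_loaded ω t) hm hc ht hρ hρ1
        hh hp1 hp)
  have hterm : ∀ t, expect N T t bad ≤ ENNReal.ofReal (if T₀ + i₀ ≤ t then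
      (ρ⁻¹ ^ (K + H) * M * lam ^ i₀) * lam ^ (t - (T₀ + i₀)) else 1) := by
    intro t
    split_ifs with ht
    · refine (expect_mono (g := fun s => ρ⁻¹ ^ (K + H) * potential N ρ h s) fun ω => ?_).trans ?_
      · simp only [bad]
        split_ifs with hk
        · exact mul_nonneg (by positivity) (potential_nonneg hρ)
        · exact (N.inv_loaded (T := T) hc ω t).one_le_potential hc hS hρ hρ1 hH hk
      · rw [expect_const_mul (by positivity)]
        have := hgeo (t - T₀)
        rw [Nat.add_sub_cancel' (by omega)] at this
        refine (mul_le_mul_right this _).trans ?_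
        rw [← ENNReal.ofReal_mul (by positivity)]
        refine ENNReal.ofReal_le_ofReal (le_of_eq ?_)
        rw [mul_assoc _ (lam ^ i₀), ← pow_add, show i₀ + (t - (T₀ + i₀)) = t - T₀ by omega]
        ring
    · exact expect_le_of_le fun ω => hbad1 _
  refine (Finset.sum_le_sum fun t _ => hterm t).trans ?_
  rw [← ENNReal.ofReal_sum_of_nonneg fun t _ => by split_ifs <;> positivity]
  refine ENNReal.ofReal_le_ofReal ((sum_delayed_geometric_le zero_le_one hlam0 hi₀
    _ _).trans (le_of_eq ?_))
  push_cast
  ring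

end Costs

/-! ### Bounds in terms of the optimal costs -/

/-- A bound for the success probability of a single transmission. -/
def successBound (Δ m : ℕ) : ℝ := Real.exp (-4 * Δ / m)

/-- The ratio by which the potential discounts the progress of a node. -/
def discount (Δ m : ℕ) : ℝ :=
  successBound Δ m * (1 - successBound Δ m) / (3 + 2 * Δ)

/-- The round in which the root starts to send the rumors that it has collected. -/
def startTime {n : ℕ} (L : LocalView n) : ℕ :=
  sInf {T : ℕ | n * ((discount L.maxDegree L.m)⁻¹ ^ (L.numRumors ⌈/⌉ L.c) *
    (n * (discount L.maxDegree L.m)⁻¹ ^ (2 * L.diam + 1))) *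
      (1 - successBound L.maxDegree L.m ^ 2) ^ T ≤ successBound L.maxDegree L.m ^ 2}

theorem successBound_pos (Δ m : ℕ) : 0 < successBound Δ m := Real.exp_pos _

section Bounds

variable {Δ m : ℕ}

theorem successBound_lt_one (hΔ : 1 ≤ Δ) (hm : 2 ≤ m) : successBound Δ m < 1 := by
  have h1 : (0 : ℝ) < Δ := by exact_mod_cast hΔ
  have h2 : (0 : ℝ) < m := by exact_mod_cast (by omega : 0 < m)
  rw [successBound, ← Real.exp_zero, Real.exp_lt_exp, neg_mul, neg_div]
  exact neg_lt_zero.2 (by positivity)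

theorem discount_pos (hΔ : 1 ≤ Δ) (hm : 2 ≤ m) : 0 < discount Δ m := by
  have := successBound_lt_one hΔ hm
  exact div_pos (mul_pos (successBound_pos _ _) (by linarith)) (by positivity)

theorem discount_le_one (hΔ : 1 ≤ Δ) (hm : 2 ≤ m) : discount Δ m ≤ 1 := by
  have h1 := successBound_lt_one hΔ hm
  have h0 := successBound_pos Δ m
  have h2 : (0 : ℝ) ≤ Δ := Nat.cast_nonneg _
  rw [discount, div_le_one (by positivity)]
  nlinarith

/-- The discount is chosen so that the loss `(3 + 2 * Δ) * ρ` equals `p * (1 - p)`, which leaves a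
net gain of `p ^ 2`. The factor `1 - p` keeps the rate right when `p` is close to 1. -/
theorem one_sub_successBound_sq (Δ m : ℕ) : 1 - successBound Δ m ^ 2 =
    1 - successBound Δ m + (3 + 2 * Δ) * discount Δ m := by
  have h2 : (3 + 2 * Δ : ℝ) ≠ 0 := by positivity
  rw [discount, mul_div_cancel₀ _ h2]
  ring

theorem one_sub_successBound_sq_mem (hΔ : 1 ≤ Δ) (hm : 2 ≤ m) :
    0 < 1 - successBound Δ m ^ 2 ∧ 1 - successBound Δ m ^ 2 < 1 := by
  have h1 := successBound_lt_one hΔ hm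
  have h0 := successBound_pos Δ m
  constructor <;> nlinarith

theorem localView_maxDegree {n : ℕ} (N : Network n) [DecidableRel N.G.Adj] (v : Fin n) :
    (N.localView v).maxDegree = N.G.maxDegree := by
  unfold Network.localView
  dsimp only
  congr!

theorem startTime_spec {n : ℕ} (N : Network n) [DecidableRel N.G.Adj] (v : Fin n)
    (hΔ : 1 ≤ N.G.maxDegree) (hm : 2 ≤ N.m) :
    n * ((discount N.G.maxDegree N.m)⁻¹ ^ (N.S.card ⌈/⌉ N.c) *
    (n * (discount N.G.maxDegree N.m)⁻¹ ^ (2 * N.G.diam + 1))) *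
      (1 - successBound N.G.maxDegree N.m ^ 2) ^ startTime (N.localView v) ≤
      successBound N.G.maxDegree N.m ^ 2 := by
  have hmem := one_sub_successBound_sq_mem hΔ hm
  have hne : {T : ℕ | n * ((discount N.G.maxDegree N.m)⁻¹ ^ (N.S.card ⌈/⌉ N.c) *
    (n * (discount N.G.maxDegree N.m)⁻¹ ^ (2 * N.G.diam + 1))) *
      (1 - successBound N.G.maxDegree N.m ^ 2) ^ T ≤
      successBound N.G.maxDegree N.m ^ 2}.Nonempty := by
    have h1 := (tendsto_pow_atTop_nhds_zero_of_lt_one hmem.1.le hmem.2).const_mul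
      (n * ((discount N.G.maxDegree N.m)⁻¹ ^ (N.S.card ⌈/⌉ N.c) *
    (n * (discount N.G.maxDegree N.m)⁻¹ ^ (2 * N.G.diam + 1))) : ℝ)
    rw [mul_zero] at h1
    exact (h1.eventually_le_const (pow_pos (successBound_pos _ _) 2)).exists
  have h2 := Nat.sInf_mem hne
  rw [startTime, localView_maxDegree]
  exact h2

theorem startTime_le {n : ℕ} (N : Network n) [DecidableRel N.G.Adj] (v : Fin n) {T : ℕ}
    (hT : n * ((discount N.G.maxDegree N.m)⁻¹ ^ (N.S.card ⌈/⌉ N.c) *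
    (n * (discount N.G.maxDegree N.m)⁻¹ ^ (2 * N.G.diam + 1))) *
      (1 - successBound N.G.maxDegree N.m ^ 2) ^ T ≤ successBound N.G.maxDegree N.m ^ 2) :
    startTime (N.localView v) ≤ T := by
  rw [startTime, localView_maxDegree]
  exact Nat.sInf_le hT

theorem IsCDS.card_univ_le {n : ℕ} {G : SimpleGraph (Fin n)} [DecidableRel G.Adj]
    {D : Finset (Fin n)} (hD : IsCDS G D) : n ≤ D.card * (1 + D.sup fun v => G.degree v) := by
  classical
  have hsub : (Finset.univ : Finset (Fin n)) ⊆
      D.biUnion fun u => insert u (G.neighborFinset u) := by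
    intro v _
    simp only [Finset.mem_biUnion, Finset.mem_insert, SimpleGraph.mem_neighborFinset]
    by_cases h : v ∈ D
    · exact ⟨v, h, Or.inl rfl⟩
    · obtain ⟨u, hu, huv⟩ := hD.2 v h
      exact ⟨u, hu, Or.inr huv⟩
  have h1 := Finset.card_le_card hsub
  rw [Finset.card_univ, Fintype.card_fin] at h1
  refine h1.trans (Finset.card_biUnion_le.trans ?_)
  rw [← smul_eq_mul]
  refine Finset.sum_le_card_nsmul _ _ _ fun u hu => (Finset.card_insert_le _ _).trans ?_
  rw [SimpleGraph.card_neighborFinset_eq_degree, add_comm]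
  exact Nat.add_le_add_left (Finset.le_sup (f := fun v => G.degree v) hu) 1

theorem IsCDS.card_pos {V : Type*} {G : SimpleGraph V} {D : Finset V} (hD : IsCDS G D) :
    1 ≤ D.card := by
  obtain ⟨⟨v, hv⟩⟩ := hD.1.nonempty
  exact Finset.card_pos.2 ⟨v, hv⟩

theorem IsCDS.one_le_sup_degree {n : ℕ} {G : SimpleGraph (Fin n)} [DecidableRel G.Adj]
    (hG : G.Connected) (hn : 2 ≤ n) {D : Finset (Fin n)} (hD : IsCDS G D) :
    1 ≤ D.sup fun v => G.degree v := by
  have : Nontrivial (Fin n) := Fin.nontrivial_iff_two_le.2 hn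
  obtain ⟨⟨v, hv⟩⟩ := hD.1.nonempty
  exact le_trans (hG.preconnected.degree_pos_of_nontrivial v)
    (Finset.le_sup (f := fun v => G.degree v) hv)

theorem ceilDiv_mul_mcds_le {n : ℕ} {G : SimpleGraph (Fin n)} (hG : G.Connected) (hn : 2 ≤ n)
    {S : Finset (Fin n)} {c : ℕ} (hc : 1 ≤ c) (hS : c ≤ S.card) :
    (S.card ⌈/⌉ c) * mcds G ≤ 2 * mOpt G S c := by
  have : Nontrivial (Fin n) := Fin.nontrivial_iff_two_le.2 hn
  have h1 := card_mul_mcds_le_mOpt hG S hc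
  have h2 : (S.card ⌈/⌉ c) * c ≤ 2 * S.card := by
    rw [Nat.ceilDiv_eq_add_pred_div]
    exact (Nat.div_mul_le_self _ _).trans (by omega)
  refine Nat.le_of_mul_le_mul_left ?_ (show 0 < c by omega)
  calc c * ((S.card ⌈/⌉ c) * mcds G) = (S.card ⌈/⌉ c) * c * mcds G := by ring
    _ ≤ 2 * S.card * mcds G := Nat.mul_le_mul_right _ h2
    _ ≤ c * (2 * mOpt G S c) := by nlinarith

/-- All messages are within a constant factor of the optimum. -/
theorem message_bound {n : ℕ} {G : SimpleGraph (Fin n)} [DecidableRel G.Adj]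
    (hG : G.Connected) (hn : 2 ≤ n) {D₀ D : Finset (Fin n)} (hD₀ : IsCDS G D₀) (hD : IsCDS G D)
    (hcard : D.card ≤ 3 * D₀.card) {S : Finset (Fin n)} {c : ℕ} (hc : 1 ≤ c) (hS : c ≤ S.card)
    {α : ℝ} (hα : (D₀.card : ℝ) ≤ α * mcds G) :
    ((n + (S.card ⌈/⌉ c) * D.card + (S.card ⌈/⌉ c) * n) + 1 : ℝ) ≤
      36 * (α * mOpt G S c * (D.sup fun v => G.degree v : ℕ)) := by
  set K := S.card ⌈/⌉ c
  set M := D.sup fun v => G.degree v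
  have hK : 1 ≤ K := by
    rw [Nat.one_le_iff_ne_zero, ← Nat.pos_iff_ne_zero]
    exact Nat.pos_of_ne_zero fun h => by
      have := (ceilDiv_le_iff_le_mul (show 0 < c by omega)).1 h.le
      omega
  have hM : 1 ≤ M := hD.one_le_sup_degree hG hn
  have hDpos := hD.card_pos
  have hD₀pos : (1 : ℝ) ≤ D₀.card := by exact_mod_cast hD₀.card_pos
  have hα0 : 0 ≤ α := by
    by_contra! h
    nlinarith [mul_nonneg (neg_nonneg.2 h.le) (Nat.cast_nonneg (α := ℝ) (mcds G))]
  -- The four summands contribute 2, 1, 2 and 1, with `n ≤ |D| * (1 + M) ≤ 2 * |D| * M`.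
  have h1 : n + K * D.card + K * n + 1 ≤ 6 * (K * D.card * M) := by
    have ha : n ≤ 2 * (D.card * M) := hD.card_univ_le.trans (by nlinarith)
    have hb : D.card * M ≤ K * D.card * M := by
      rw [mul_assoc]
      exact Nat.le_mul_of_pos_left _ hK
    have hc' : K * D.card ≤ K * D.card * M := Nat.le_mul_of_pos_right _ hM
    have hd : K * n ≤ 2 * (K * D.card * M) := by
      calc K * n ≤ K * (2 * (D.card * M)) := Nat.mul_le_mul_left _ ha
        _ = _ := by ring
    have he : 1 ≤ D.card * M := Nat.mul_pos hDpos hM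
    omega
  have h2 : (K * mcds G : ℝ) ≤ 2 * mOpt G S c := by
    exact_mod_cast ceilDiv_mul_mcds_le hG hn hc hS
  have h3 : (K * D.card : ℝ) ≤ 6 * (α * mOpt G S c) := by
    have : (D.card : ℝ) ≤ 3 * (α * mcds G) := by
      have : (D.card : ℝ) ≤ 3 * D₀.card := by exact_mod_cast hcard
      linarith
    calc (K * D.card : ℝ) ≤ K * (3 * (α * mcds G)) := by gcongr
      _ = 3 * α * (K * mcds G) := by ring
      _ ≤ 3 * α * (2 * mOpt G S c) := by gcongr
      _ = _ := by ring
  have h4 : ((n + K * D.card + K * n) + 1 : ℝ) ≤ 6 * (K * D.card * M) := by exact_mod_cast h1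
  calc ((n + K * D.card + K * n) + 1 : ℝ) ≤ 6 * (K * D.card * M) := h4
    _ ≤ 6 * (6 * (α * mOpt G S c) * M) := by gcongr
    _ = _ := by ring

/-- The failure probability `1 - (1 - e) ^ 4` is at most a power of `e`, uniformly for `e ≤ s`. -/
theorem neg_log_failure_le {s e : ℝ} (he : 0 < e) (hes : e ≤ s) (hs : s < 1) :
    (1 - s) ^ 4 / 4 * -Real.log e ≤ -Real.log (1 - (1 - e) ^ 4) := by
  have hδ0 : 0 < (1 - s) ^ 4 := by
    have : 0 < 1 - s := by linarith
    positivity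
  have hδ1 : (1 - s) ^ 4 ≤ 1 := pow_le_one₀ (by linarith) (by linarith)
  have hδe : (1 - s) ^ 4 ≤ (1 - e) ^ 4 := pow_le_pow_left₀ (by linarith) (by linarith) 4
  have hf0 : 0 < 1 - (1 - e) ^ 4 := by
    have : (1 - e) ^ 4 < 1 := pow_lt_one₀ (by linarith) (by linarith) (by norm_num)
    linarith
  have hlog16 : Real.log 16 ≤ 4 := by
    rw [show (16 : ℝ) = 2 ^ 4 by norm_num, Real.log_pow]
    have := Real.log_two_lt_d9
    norm_num at this ⊢
    linarith
  have hloge : 0 ≤ -Real.log e := by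
    have := Real.log_nonpos he.le (by linarith)
    linarith
  -- For small `e` Bernoulli gives `1 - (1 - e) ^ 4 ≤ 4 * e ≤ √e`. Otherwise `-log e ≤ log 16 ≤ 4`
  -- is bounded, and `-log (1 - x) ≥ x` suffices.
  rcases le_total e (1 / 16) with h | h
  · have h1 : Real.log (1 - (1 - e) ^ 4) ≤ Real.log (4 * e) := by
      refine Real.log_le_log hf0 ?_
      have := one_add_mul_le_pow (a := -e) (by linarith) 4
      norm_num at this
      rw [← sub_eq_add_neg] at this
      linarith
    have h2 : Real.log e ≤ -Real.log 16 := by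
      rw [← Real.log_inv]
      exact Real.log_le_log he (by norm_num at h ⊢; exact h)
    rw [Real.log_mul (by norm_num) he.ne'] at h1
    have h3 : Real.log 16 = 2 * Real.log 4 := by
      rw [show (16 : ℝ) = 4 ^ 2 by norm_num, Real.log_pow]
      norm_num
    nlinarith
  · have h1 := Real.log_le_sub_one_of_pos hf0
    have h2 : -Real.log e ≤ 4 := by
      rw [← Real.log_inv]
      refine (Real.log_le_log (by positivity) ?_).trans hlog16
      rw [inv_le_comm₀ he (by norm_num)]
      norm_num at h ⊢
      exact h
    nlinarith

end Bounds

/-- Since `1 - p ≥ e ≥ 1 / Δ` and `3 + 2 * Δ ≤ 4 * Δ`, the discount is at least a constant times `Δ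
^ (-2)`. -/
theorem neg_log_discount_le {Δ m : ℕ} {w e : ℝ} (hΔ : 2 ≤ Δ) (he : 1 / (Δ : ℝ) ≤ e) (he1 : e < 1)
    (hp : successBound Δ m = (1 - e) ^ 2) (hw0 : 0 ≤ w) (hw : -Real.log (1 - e) ≤ w) :
    -Real.log (discount Δ m) ≤ (4 + 4 * w) * Real.log Δ := by
  have hΔ' : (2 : ℝ) ≤ Δ := by exact_mod_cast hΔ
  have hl : 1 / 2 ≤ Real.log Δ := by
    have h1 := Real.log_two_gt_d9
    have h2 := Real.log_le_log (by norm_num) hΔ'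
    norm_num at h1
    linarith
  have he0 : 0 < e := lt_of_lt_of_le (by positivity) he
  have h1 : (1 - e) ^ 2 * (1 / Δ) / (4 * Δ) ≤ discount Δ m := by
    rw [discount, hp]
    have : 0 ≤ 1 - (1 - e) ^ 2 := by nlinarith
    gcongr
    · nlinarith
    · linarith
  have hpos : 0 < (1 - e) ^ 2 * (1 / Δ) / (4 * Δ) := by
    have : 0 < 1 - e := by linarith
    positivity
  have h2 := Real.log_le_log hpos h1
  have h3 : Real.log ((1 - e) ^ 2 * (1 / Δ) / (4 * Δ)) =
      2 * Real.log (1 - e) - 2 * Real.log Δ - 2 * Real.log 2 := by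
    have h4 : (1 - e) ≠ 0 := by linarith
    have h5 : (Δ : ℝ) ≠ 0 := by linarith
    rw [show (1 - e) ^ 2 * (1 / Δ) / (4 * Δ) = ((1 - e) / (Δ * 2)) ^ 2 by field_simp; ring,
      Real.log_pow, Real.log_div h4 (by positivity), Real.log_mul h5 (by norm_num)]
    push_cast
    ring
  have h4 := Real.log_le_log (by norm_num) hΔ'
  nlinarith

/-- A geometric decay with ratio `lam` absorbs the factor `M` after a number of rounds that is
proportional to `log M`. -/
theorem mul_pow_ceil_le {M lam : ℝ} (hM : 0 < M) (h0 : 0 < lam) (h1 : lam < 1) {b : ℝ}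
    (hb : 0 < b) :
    M * lam ^ ⌈Real.log (M / b) / -Real.log lam⌉₊ ≤ b := by
  set i := ⌈Real.log (M / b) / -Real.log lam⌉₊
  have hlog : 0 < -Real.log lam := neg_pos.2 (Real.log_neg h0 h1)
  have h2 : Real.log (M / b) ≤ i * -Real.log lam := (div_le_iff₀ hlog).1 (Nat.le_ceil _)
  rw [← Real.log_le_log_iff (by positivity) hb, Real.log_mul hM.ne' (by positivity), Real.log_pow]
  rw [Real.log_div hM.ne' hb.ne'] at h2
  linarith

theorem log_initial_le {x l w d : ℝ} {n K H : ℕ} (hn : 1 ≤ n) (hx : 1 ≤ x) (hl : 1 / 2 ≤ l)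
    (hw : 0 ≤ w) (hlx : Real.log x ≤ (4 + 4 * w) * l) (hln : Real.log n ≤ d * (2 * l))
    (hd : 2 * d + 1 ≤ H) (hd0 : 0 ≤ d) :
    Real.log (x ^ (K + H) * (n * x ^ (K + 1) * (n * x ^ H) + n)) ≤ (18 + 12 * w) * (H + K) * l := by
  have hn' : (1 : ℝ) ≤ n := by exact_mod_cast hn
  have h1 : (n : ℝ) ≤ n * x ^ (K + 1) * (n * x ^ H) := by
    have h2 := one_le_pow₀ (n := K + 1) hx
    have h3 := one_le_pow₀ (n := H) hx
    calc (n : ℝ) = n * 1 * (1 * 1) := by ring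
      _ ≤ _ := by gcongr
  have h2 : x ^ (K + H) * (n * x ^ (K + 1) * (n * x ^ H) + n) ≤
      2 * n ^ 2 * x ^ (2 * K + 2 * H + 1) := by
    calc _ ≤ x ^ (K + H) * (2 * (n * x ^ (K + 1) * (n * x ^ H))) := by
          gcongr
          linarith
      _ = _ := by ring
  refine (Real.log_le_log (by positivity) h2).trans ?_
  rw [Real.log_mul (by positivity) (by positivity), Real.log_mul (by positivity) (by positivity),
    Real.log_pow, Real.log_pow]
  push_cast
  have hlog2 : Real.log 2 ≤ 1 := by
    have := Real.log_two_lt_d9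
    norm_num at this
    linarith
  have hK : (0 : ℝ) ≤ K := Nat.cast_nonneg K
  have hH : (1 : ℝ) ≤ H := by linarith
  have h3 : (2 * K + 2 * H + 1 : ℝ) * Real.log x ≤ (3 * (H + K)) * ((4 + 4 * w) * l) := by
    refine (mul_le_mul_of_nonneg_left hlx (by positivity)).trans ?_
    refine mul_le_mul_of_nonneg_right (by linarith) (by positivity)
  have h4 : (1 : ℝ) ≤ 2 * (H + K) * l := by nlinarith
  have h5 : d * (2 * l) ≤ (H + K) * l := by nlinarith
  nlinarith

theorem one_le_of_slots {Δ m : ℕ} {μ : ℝ} (hmμ : (m : ℝ) = μ * Δ) (hm : 2 ≤ m) : 1 ≤ Δ := by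
  by_contra! h
  have h0 : Δ = 0 := by omega
  rw [h0] at hmμ
  have : m = 0 := by simpa using hmμ
  omega

/-- The number of rounds after which the discounted weights outgrow all initial weights. -/
theorem exists_decay_time {n Δ m d K H : ℕ} {μ s : ℝ} (hn : 1 ≤ n) (hnΔ : n ≤ (1 + Δ) ^ d)
    (hH : H = 2 * d + 1) (hμ : 0 < μ) (hs : 1 - Real.exp (-2 / μ) ≤ s) (hs1 : s < 1)
    (hmμ : (m : ℝ) = μ * Δ) (hm : 2 ≤ m) (hΔ1 : 1 ≤ Δ) (hj : 1 ≤ rounds Δ μ) :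
    ∃ i₀ : ℕ, (discount Δ m)⁻¹ ^ (K + H) *
        (n * (discount Δ m)⁻¹ ^ (K + 1) * (n * (discount Δ m)⁻¹ ^ H) + n) *
        (1 - successBound Δ m ^ 2) ^ i₀ ≤ successBound Δ m ^ 2 ∧
      (i₀ : ℝ) ≤ (18 + 20 * -Real.log (1 - s)) / ((1 - s) ^ 4 / 4) *
        ((H + K) * rounds Δ μ) + 1 := by
  obtain ⟨e, he⟩ : ∃ e, e = 1 - Real.exp (-2 / μ) := ⟨_, rfl⟩
  obtain ⟨l, hl⟩ : ∃ l, l = Real.log Δ := ⟨_, rfl⟩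
  obtain ⟨w, hw⟩ : ∃ w, w = -Real.log (1 - s) := ⟨_, rfl⟩
  obtain ⟨a, ha⟩ : ∃ a, a = (1 - s) ^ 4 / 4 := ⟨_, rfl⟩
  obtain ⟨lam, hlam⟩ : ∃ lam, lam = 1 - successBound Δ m ^ 2 := ⟨_, rfl⟩
  obtain ⟨x, hx⟩ : ∃ x, x = (discount Δ m)⁻¹ := ⟨_, rfl⟩
  rw [← he] at hs
  rw [← hx, ← hlam, ← hw, ← ha]
  have he1 : e < 1 := by
    have := Real.exp_pos (-2 / μ)
    linarith
  have he0 : 0 < e := by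
    have : Real.exp (-2 / μ) < 1 := by
      rw [← Real.exp_zero, Real.exp_lt_exp, neg_div]
      exact neg_lt_zero.2 (by positivity)
    linarith
  have hloge : Real.log e < 0 := Real.log_neg he0 he1
  have hrounds : rounds Δ μ = l / -Real.log e := by
    rw [rounds, one_div, Real.log_inv, neg_div, div_neg, hl, he]
  -- The hypothesis `j' ≥ 1` means `e ≥ 1 / Δ`. It forces `Δ ≥ 2` and prevents the discount from
  -- being too small.
  have hel : -Real.log e ≤ l := by
    rw [hrounds, le_div_iff₀ (by linarith)] at hj
    linarith
  have hΔ2 : 2 ≤ Δ := by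
    by_contra! hlt
    have : l ≤ 0 := by
      rw [hl]
      exact Real.log_nonpos (Nat.cast_nonneg _) (by exact_mod_cast (by omega : Δ ≤ 1))
    linarith
  have hΔ' : (2 : ℝ) ≤ Δ := by exact_mod_cast hΔ2
  have hlhalf : 1 / 2 ≤ l := by
    have h1 := Real.log_two_gt_d9
    have h2 := Real.log_le_log (by norm_num) hΔ'
    norm_num at h1
    linarith
  have heΔ : 1 / (Δ : ℝ) ≤ e := by
    rw [← Real.log_le_log_iff (by positivity) he0, one_div, Real.log_inv, ← hl]
    linarith
  -- Both are `exp (-4 / μ)`, so the decay factor is `1 - (1 - e) ^ 4`.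
  have hp : successBound Δ m = (1 - e) ^ 2 := by
    rw [successBound, he, sub_sub_cancel, ← Real.exp_nat_mul, hmμ]
    congr 1
    field_simp
    norm_num
  have hw0 : 0 ≤ w := hw ▸ neg_nonneg.2 (Real.log_nonpos (by linarith) (by linarith))
  have hwe : -Real.log (1 - e) ≤ w := hw ▸ neg_le_neg (Real.log_le_log (by linarith) (by linarith))
  obtain ⟨hlam0, hlam1⟩ := one_sub_successBound_sq_mem hΔ1 hm
  rw [← hlam] at hlam0 hlam1
  have hx1 : 1 ≤ x := hx ▸ (one_le_inv₀ (discount_pos hΔ1 hm)).2 (discount_le_one hΔ1 hm)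
  have hlx : Real.log x ≤ (4 + 4 * w) * l := by
    rw [hx, Real.log_inv, hl]
    exact neg_log_discount_le hΔ2 heΔ he1 hp hw0 hwe
  have hln : Real.log n ≤ (d : ℝ) * (2 * l) := by
    have h1 : (n : ℝ) ≤ (Δ ^ 2 : ℝ) ^ d := by
      exact_mod_cast hnΔ.trans (Nat.pow_le_pow_left (by nlinarith) _)
    refine (Real.log_le_log (by positivity) h1).trans (le_of_eq ?_)
    rw [Real.log_pow, Real.log_pow, hl]
    push_cast
    ring
  have hlogM := log_initial_le (K := K) (H := H) hn hx1 hlhalf hw0 hlx hln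
    (by rw [hH]; push_cast; rfl) (Nat.cast_nonneg _)
  have hn' : (1 : ℝ) ≤ n := by exact_mod_cast hn
  have hM0 : 0 < x ^ (K + H) * (n * x ^ (K + 1) * (n * x ^ H) + n) := by positivity
  have hp0 := successBound_pos Δ m
  refine ⟨_, mul_pow_ceil_le hM0 hlam0 hlam1 (by positivity), ?_⟩
  obtain ⟨M, hM⟩ : ∃ M, M = x ^ (K + H) * (n * x ^ (K + 1) * (n * x ^ H) + n) := ⟨_, rfl⟩
  rw [← hM] at hlogM hM0 ⊢
  have hF : (1 : ℝ) ≤ H + K := by exact_mod_cast (by omega : 1 ≤ H + K)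
  have hlogMb : Real.log (M / successBound Δ m ^ 2) ≤ (18 + 20 * w) * ((H + K) * l) := by
    rw [Real.log_div hM0.ne' (by positivity), hp, ← pow_mul, Real.log_pow]
    have h1 : w * 1 ≤ w * (2 * ((H + K) * l)) :=
      mul_le_mul_of_nonneg_left (by nlinarith) hw0
    rw [mul_assoc] at hlogM
    generalize (H + K) * l = X at *
    norm_num
    linarith
  have ha0 : 0 < a := by
    have : 0 < 1 - s := by linarith
    rw [ha]
    positivity
  have hrate : a * -Real.log e ≤ -Real.log lam := by
    rw [hlam, hp, ← pow_mul, ha]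
    exact neg_log_failure_le he0 hs hs1
  have hpos : 0 ≤ (18 + 20 * w) * ((H + K) * l) := by positivity
  have h1 : Real.log (M / successBound Δ m ^ 2) / -Real.log lam ≤
      (18 + 20 * w) / a * ((H + K) * rounds Δ μ) := by
    calc _ ≤ (18 + 20 * w) * ((H + K) * l) / -Real.log lam :=
          div_le_div_of_nonneg_right hlogMb (neg_nonneg.2 (Real.log_nonpos hlam0.le hlam1.le))
      _ ≤ (18 + 20 * w) * ((H + K) * l) / (a * -Real.log e) :=
          div_le_div_of_nonneg_left hpos (mul_pos ha0 (by linarith)) hrate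
      _ = _ := by
          rw [hrounds, ← mul_div_assoc, div_mul_div_comm]
  have h2 : 0 ≤ (18 + 20 * w) / a * ((H + K) * rounds Δ μ) := by positivity
  exact (Nat.cast_le.2 (Nat.ceil_mono h1)).trans (Nat.ceil_lt_add_one h2).le

/-- All slots are within a constant factor of the optimum. -/
theorem slot_bound {n : ℕ} {G : SimpleGraph (Fin n)} [DecidableRel G.Adj] (B : Backbone G)
    (hG : G.Connected) (hn : 2 ≤ n) {h : Fin n → ℕ}
    (hh : ∀ v, v ≠ B.root → h (B.parent v) < h v) (hH : ∀ v, h v ≤ 2 * G.diam + 1)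
    {S : Finset (Fin n)} {c : ℕ} (hc : 1 ≤ c) (hS : c ≤ S.card) {μ s C : ℝ} (hμ : 0 < μ)
    (hs : 1 - Real.exp (-2 / μ) ≤ s) (hs1 : s < 1) {m : ℕ} [NeZero m]
    (hmμ : (m : ℝ) = μ * G.maxDegree) (hm : 2 ≤ m) (hj : 1 ≤ rounds G.maxDegree μ)
    (hC : 14 * (3 + 2 * ((18 + 20 * -Real.log (1 - s)) / ((1 - s) ^ 4 / 4))) ≤ C) :
    (Network.mk G B S c m).expectedTime (gossipRule startTime) ≤
      ENNReal.ofReal (C * (sOpt G S c * μ * G.maxDegree * rounds G.maxDegree μ)) := by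
  have : Nontrivial (Fin n) := Fin.nontrivial_iff_two_le.2 hn
  have hΔ := one_le_of_slots hmμ hm
  obtain ⟨i₀, hdecay, hi₀⟩ := exists_decay_time (K := S.card ⌈/⌉ c) (by omega)
    (card_le_of_connected hG) rfl hμ hs hs1 hmμ hm hΔ hj
  have hx1 := (one_le_inv₀ (discount_pos hΔ hm)).2 (discount_le_one hΔ hm)
  -- The weight to be absorbed before the start is only a factor of the one for the whole execution,
  -- so waiting at most doubles the time.
  have hstart : startTime ((Network.mk G B S c m).localView B.root) ≤ i₀ := by
    refine startTime_le (Network.mk G B S c m) B.root (le_trans ?_ hdecay)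
    refine mul_le_mul_of_nonneg_right ?_ (pow_nonneg (one_sub_successBound_sq_mem hΔ hm).1.le _)
    change n * ((discount G.maxDegree m)⁻¹ ^ (S.card ⌈/⌉ c) *
      (n * (discount G.maxDegree m)⁻¹ ^ (2 * G.diam + 1))) ≤ _
    generalize (discount G.maxDegree m)⁻¹ = x at hx1 ⊢
    generalize S.card ⌈/⌉ c = K
    generalize 2 * G.diam + 1 = H
    have h1 := one_le_pow₀ (n := K + H) hx1
    have h2 : x ^ K ≤ x ^ (K + 1) := pow_le_pow_right₀ hx1 (Nat.le_succ K)
    calc n * (x ^ K * (n * x ^ H)) = 1 * (n * x ^ K * (n * x ^ H) + 0) := by ring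
      _ ≤ _ := by
        gcongr
        positivity
  refine (expectedTime_le (N := Network.mk G B S c m) (T := startTime)
    (lam := 1 - successBound G.maxDegree m ^ 2) hc hS hm (discount_pos hΔ hm)
    (discount_le_one hΔ hm) hh hH (successBound_lt_one hΔ hm).le (exp_le_success hm _)
    (one_sub_successBound_sq _ _) (hdecay.trans (by rw [sub_sub_cancel]))).trans
    (ENNReal.ofReal_le_ofReal ?_)
  change 2 * (m : ℝ) * (startTime ((Network.mk G B S c m).localView B.root) + i₀ + 1) ≤ _
  have hstart' : (startTime ((Network.mk G B S c m).localView B.root) : ℝ) ≤ i₀ := by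
    exact_mod_cast hstart
  have hFs : ((2 * G.diam + 1 : ℕ) + (S.card ⌈/⌉ c : ℕ) : ℝ) ≤ 7 * sOpt G S c := by
    have h1 := diam_le_two_mul_sOpt hG hc hS
    have h2 := ceilDiv_le_two_mul_sOpt hG hc hS
    have h3 := one_le_sOpt hG hc hS
    exact_mod_cast (by omega : 2 * G.diam + 1 + S.card ⌈/⌉ c ≤ 7 * sOpt G S c)
  have hF : (1 : ℝ) ≤ (2 * G.diam + 1 : ℕ) + (S.card ⌈/⌉ c : ℕ) := by
    exact_mod_cast (by omega : 1 ≤ 2 * G.diam + 1 + S.card ⌈/⌉ c)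
  generalize ((2 * G.diam + 1 : ℕ) + (S.card ⌈/⌉ c : ℕ) : ℝ) = F at *
  have hA : 0 ≤ (18 + 20 * -Real.log (1 - s)) / ((1 - s) ^ 4 / 4) := by
    have he : Real.exp (-2 / μ) < 1 := by
      rw [← Real.exp_zero, Real.exp_lt_exp, neg_div]
      exact neg_lt_zero.2 (by positivity)
    have h1 := Real.log_nonpos (x := 1 - s) (by linarith) (by linarith)
    have h2 : 0 < 1 - s := by linarith
    exact div_nonneg (by linarith) (by positivity)
  generalize (18 + 20 * -Real.log (1 - s)) / ((1 - s) ^ 4 / 4) = A at *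
  have hone : 1 ≤ F * rounds G.maxDegree μ := one_le_mul_of_one_le_of_one_le hF hj
  have hj0 : 0 ≤ rounds G.maxDegree μ := by linarith
  calc 2 * (m : ℝ) * (startTime ((Network.mk G B S c m).localView B.root) + i₀ + 1)
      ≤ 2 * m * ((3 + 2 * A) * (F * rounds G.maxDegree μ)) := by
        gcongr
        linarith
    _ ≤ 2 * m * ((3 + 2 * A) * (7 * sOpt G S c * rounds G.maxDegree μ)) := by gcongr
    _ = 14 * (3 + 2 * A) * (sOpt G S c * μ * G.maxDegree * rounds G.maxDegree μ) := by
        rw [hmμ]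
        ring
    _ ≤ _ := by gcongr

/-- All transmissions are within a constant factor of the optimum. -/
theorem transmission_bound {n : ℕ} {G : SimpleGraph (Fin n)} [DecidableRel G.Adj] (B : Backbone G)
    (hG : G.Connected) (hn : 2 ≤ n) {D₀ : Finset (Fin n)} (hD₀ : IsCDS G D₀)
    (hroot : B.root ∈ B.D) (hcard : B.D.card ≤ 3 * D₀.card) {h : Fin n → ℕ}
    (hh : ∀ v, v ≠ B.root → h (B.parent v) < h v) (hH : ∀ v, h v ≤ 2 * G.diam + 1)
    {S : Finset (Fin n)} {c : ℕ} (hc : 1 ≤ c) (hS : c ≤ S.card) {α : ℝ}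
    (hα : (D₀.card : ℝ) ≤ α * mcds G) {μ₀ μ C : ℝ} (hμ₀ : 0 < μ₀) (hμ : μ₀ ≤ μ) {m : ℕ} [NeZero m]
    (hmμ : (m : ℝ) = μ * G.maxDegree) (hm : 2 ≤ m) (hC : 72 * Real.exp (4 / μ₀) ≤ C) :
    (Network.mk G B S c m).expectedMessages (gossipRule startTime) ≤
      ENNReal.ofReal (C * (α * mOpt G S c *
        (Real.exp (2 / μ) * (B.D.sup fun v => G.degree v : ℕ) + rounds G.maxDegree μ))) := by
  have hμ0 : 0 < μ := hμ₀.trans_le hμ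
  have hΔ := one_le_of_slots hmμ hm
  have hΔ' : (0 : ℝ) < G.maxDegree := by exact_mod_cast hΔ
  have hmessages := expectedMessages_le (N := Network.mk G B S c m) (T := startTime)
    (lam := 1 - successBound G.maxDegree m ^ 2) hc hm (discount_pos hΔ hm) (discount_le_one hΔ hm)
    hh hH (fun v hv => (B.parent_mem v hv).elim (fun h => h ▸ hroot) id)
    (successBound_pos _ _) (successBound_lt_one hΔ hm).le (exp_le_success hm _)
    (one_sub_successBound_sq _ _)
    ((startTime_spec (Network.mk G B S c m) B.root hΔ hm).trans (by rw [sub_sub_cancel]))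
  refine hmessages.trans (ENNReal.ofReal_le_ofReal ?_)
  have hα0 : 0 ≤ α := by
    have : (1 : ℝ) ≤ D₀.card := by exact_mod_cast hD₀.card_pos
    by_contra! h
    nlinarith [mul_nonneg (neg_nonneg.2 h.le) (Nat.cast_nonneg (α := ℝ) (mcds G))]
  have hrounds : 0 ≤ rounds G.maxDegree μ := by
    have h1 : Real.log (1 / G.maxDegree) ≤ 0 :=
      Real.log_nonpos (by positivity) ((div_le_one hΔ').2 (by exact_mod_cast hΔ))
    have h2 : Real.log (1 - Real.exp (-2 / μ)) ≤ 0 := by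
      have h3 : Real.exp (-2 / μ) < 1 := by
        rw [← Real.exp_zero, Real.exp_lt_exp, neg_div]
        exact neg_lt_zero.2 (by positivity)
      have := Real.exp_pos (-2 / μ)
      exact Real.log_nonpos (by linarith) (by linarith)
    exact div_nonneg_of_nonpos h1 h2
  -- The retransmission factor is bounded in terms of `μ₀` alone, so `exp (2 / μ) ≥ 1` and `j' ≥ 0`
  -- are mere slack in the message bound.
  have hp : 2 / successBound G.maxDegree m ≤ 2 * Real.exp (4 / μ₀) := by
    rw [successBound, div_eq_mul_inv, ← Real.exp_neg, hmμ,
      show -(-4 * (G.maxDegree : ℝ) / (μ * G.maxDegree)) = 4 / μ by field_simp]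
    gcongr
  have hbound := message_bound hG hn hD₀ B.isCDS hcard hc hS hα
  have hexp : 1 ≤ Real.exp (2 / μ) := Real.one_le_exp (by positivity)
  set M := B.D.sup fun v => G.degree v
  have hM : (M : ℝ) ≤ Real.exp (2 / μ) * M + rounds G.maxDegree μ := by
    nlinarith [Nat.cast_nonneg (α := ℝ) M]
  calc 2 / successBound G.maxDegree m *
        ((n + (S.card ⌈/⌉ c) * B.D.card + (S.card ⌈/⌉ c) * n) + 1 : ℝ)
      ≤ 2 * Real.exp (4 / μ₀) * (36 * (α * mOpt G S c * M)) := by gcongr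
    _ ≤ 2 * Real.exp (4 / μ₀) * (36 * (α * mOpt G S c *
          (Real.exp (2 / μ) * M + rounds G.maxDegree μ))) := by gcongr
    _ = 72 * Real.exp (4 / μ₀) * (α * mOpt G S c *
          (Real.exp (2 / μ) * M + rounds G.maxDegree μ)) := by ring
    _ ≤ _ := by gcongr

/-- On a single node the backbone is trivial. -/
theorem exists_backbone_of_subsingleton {n : ℕ} {G : SimpleGraph (Fin n)} (hn : n < 2)
    {D₀ : Finset (Fin n)} (hD₀ : IsCDS G D₀) : ∃ B : Backbone G, D₀ ⊆ B.D := by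
  have : Subsingleton (Fin n) := Fin.subsingleton_iff_le_one.2 (by omega)
  obtain ⟨⟨r, hr⟩⟩ := hD₀.1.nonempty
  exact ⟨{
    D := D₀
    isCDS := hD₀
    root := r
    root_le := fun v => (Subsingleton.elim r v).le
    parent := id
    parent_root := rfl
    adj_parent := fun v hv => absurd (Subsingleton.elim v r) hv
    parent_mem := fun v hv => absurd (Subsingleton.elim v r) hv
    reaches_root := fun v => ⟨0, Subsingleton.elim _ _⟩ }, subset_rfl⟩

end MultiBroadcast

end

open MultiBroadcast in
theorem mainTheorem8 :
    ∃ P : (n : ℕ) → Rule n, ∀ μ₀ : ℝ, 0 < μ₀ → ∃ C : ℝ, 0 < C ∧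
      ∀ (n : ℕ) (G : SimpleGraph (Fin n)) [DecidableRel G.Adj], G.Connected →
      ∀ D₀ : Finset (Fin n), IsCDS G D₀ →
      ∃ B : Backbone G, D₀ ⊆ B.D ∧
      ∀ (S : Finset (Fin n)) (c : ℕ), 1 ≤ c → c ≤ S.card →
      ∀ α : ℝ, (D₀.card : ℝ) ≤ α * mcds G →
      ∀ (μ : ℝ) (m : ℕ) [NeZero m], μ₀ ≤ μ → (m : ℝ) = μ * G.maxDegree → 2 ≤ m →
        (Network.mk G B S c m).expectedMessages (P n) ≤
          ENNReal.ofReal (C * (α * mOpt G S c *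
            (Real.exp (2 / μ) * (B.D.sup fun v => G.degree v : ℕ) + rounds G.maxDegree μ))) ∧
        (1 ≤ rounds G.maxDegree μ →
          (Network.mk G B S c m).expectedTime (P n) ≤
            ENNReal.ofReal (C * (sOpt G S c * μ * G.maxDegree * rounds G.maxDegree μ))) := by
  refine ⟨fun n => gossipRule startTime, fun μ₀ hμ₀ => ?_⟩
  have hs1 : 1 - Real.exp (-2 / μ₀) < 1 := sub_lt_self 1 (Real.exp_pos _)
  obtain ⟨s, hs⟩ : ∃ s, s = 1 - Real.exp (-2 / μ₀) := ⟨_, rfl⟩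
  rw [← hs] at hs1
  refine ⟨max (72 * Real.exp (4 / μ₀))
    (14 * (3 + 2 * ((18 + 20 * -Real.log (1 - s)) / ((1 - s) ^ 4 / 4)))),
    lt_max_of_lt_left (by positivity), fun n G _ hG D₀ hD₀ => ?_⟩
  rcases lt_or_ge n 2 with hn | hn
  -- A single node has `Δ = 0`, which contradicts `μ * Δ ≥ 2`; only the backbone has to be provided.
  · obtain ⟨B, hB⟩ := exists_backbone_of_subsingleton hn hD₀
    refine ⟨B, hB, fun S c _ _ α _ μ m _ _ hmμ hm => ?_⟩
    have : Subsingleton (Fin n) := Fin.subsingleton_iff_le_one.2 (by omega)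
    have hΔ := one_le_of_slots hmμ hm
    have : G.maxDegree ≤ 0 := SimpleGraph.maxDegree_le_of_forall_degree_le _ _ fun v => by
      rw [← SimpleGraph.card_neighborFinset_eq_degree, Nat.le_zero, Finset.card_eq_zero,
        Finset.eq_empty_iff_forall_notMem]
      exact fun u hu => ((G.mem_neighborFinset v u).1 hu).ne (Subsingleton.elim v u)
    omega
  · obtain ⟨B, hsub, hroot, hcard, h, hh, hH⟩ := exists_shallow_backbone hG hn hD₀
    refine ⟨B, hsub, fun S c hc hS α hα μ m _ hμ hmμ hm => ⟨?_, fun hj => ?_⟩⟩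
    · exact transmission_bound B hG hn hD₀ hroot hcard hh hH hc hS hα hμ₀ hμ hmμ hm
        (le_max_left _ _)
    · refine slot_bound B hG hn hh hH hc hS (hμ₀.trans_le hμ) ?_ hs1 hmμ hm hj (le_max_right _ _)
      rw [hs, neg_div, neg_div]
      gcongr
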